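/- Let $(P,\omega)$ be a finite-dimensional symplectic manifold with a smooth symplectic action of a compact Lie group $G$ (Lie algebra $\mathfrak g$), a coadjoint-equivariant momentum mapping $J:P\to\mathfrak g^*$ (with $\omega(\xi p,\cdot)=d\langle J,\xi\rangle(p)$, where $\xi p$ is the infinitesimal generator at $p$) and a smooth $G$-invariant Hamiltonian $H$; $X_f$ is defined by $\omega(X_f,\cdot)=df$. Let $p_e$ be a relative equilibrium with generator $\xi_e$, so that $t\mapsto\exp(t\xi_e)p_e$ is an integral curve of $X_H$. Assume that $p_e$ is regular ($\xi p_e\neq0$ for $0\ne\xi\in\mathfrak g$). Put $\mu_e=J(p_e)$, $\mathfrak g_{\mu_e}=\{\xi:\operatorname{coad}_\xi\mu_e=0\}$, $H_{\xi_e}=H-\langle J,\xi_e\rangle$, and let $dX_{H_{\xi_e}}(p_e)=S+N$ be the Jordan decomposition into commuting semisimple and nilpotent parts. Let $T_{\bar p_e}P_{\mu_e}=\ker dJ(p_e)/\mathfrak g_{\mu_e}p_e$ be the tangent space of the reduced space, with reduced form $\omega_{\mu_e}$ and reduced linearization $L=dX_{H_{\mu_e}}(\bar p_e)$, the map induced by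 $dX_{H_{\xi_e}}(p_e)$. Assume that $p_e$ is formally stable: the Hessian of the reduced Hamiltonian at $\bar p_e$ (the form induced by $d^2H_{\xi_e}(p_e)$) is positive or negative definite. Assume a 1:1 group-reduced resonance of multiplicity one: for some $\lambda>0$ the spectra of $\operatorname{ad}_{\xi_e}:\mathfrak g_{\mu_e}\to\mathfrak g_{\mu_e}$ and of $L$ intersect in exactly $\{\pm i\lambda\}$, and $\pm i\lambda$ have algebraic multiplicity one in each. Let $T_{\bar p_e}P_{\mu_e}=W^0_{\rm red}\oplus W^1_{\rm red}$ and $\mathfrak g_{\mu_e}=\mathfrak g^0_{\mu_e}\oplus\mathfrak g^1_{\mu_e}$ be the spectral splittings, the superscript $1$ denoting the generalized eigenspace of $\pm i\lambda$ and $0$ the sum of the others, and let $\mathfrak g^*_{\mu_e}=\mathfrak g^{0*}_{\mu_e}\oplus\mathfrak g^{1*}_{\mu_e}$ be the dual splitting. Then the following hold. (a) These are direct sums. There are linear maps $N^{21}:T_{\bar p_e}P_{\mu_e}\to\mathfrak g_{\mu_e}$ and $N^{13}:\mathfrak g_{\mu_e}^*\to T_{\bar p_e}P_{\mu_e}$ with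 $Nv=(N^{21}[v])p_e$ for $v\in\ker dJ(p_e)$, and $Nz\in\ker dJ(p_e)$, $N^{13}(dJ(p_e)z|_{\mathfrak g_{\mu_e}})=[Nz]$ for $z\in T_{p_e}P$. They are dual, $\omega_{\mu_e}(N^{13}\nu,x)=\langle\nu,N^{21}x\rangle$, and $$W^0_{\rm red}\subseteq\ker N^{21},\quad \operatorname{Image}N^{21}\subseteq\mathfrak g^1_{\mu_e},\quad \mathfrak g^{0*}_{\mu_e}\subseteq\ker N^{13},\quad \operatorname{Image}N^{13}\subseteq W^1_{\rm red}.$$ (b) Choose: an $S$-invariant complement $W_{\rm red}$ to $\mathfrak g_{\mu_e}p_e$ in $\ker dJ(p_e)$ (identified with $T_{\bar p_e}P_{\mu_e}$); an $\operatorname{Ad}_{G_{\mu_e}}$-invariant complement $\mathfrak b$ to $\mathfrak g_{\mu_e}$ in $\mathfrak g$; and an $S$-invariant Lagrangian complement $Z$ to $\mathfrak g_{\mu_e}p_e$ in $(W_{\rm red}\oplus\mathfrak bp_e)^{\perp\omega}$. Then $T_{p_e}P=W_{\rm red}\oplus\mathfrak g_{\mu_e}p_e\oplus Z\oplus\mathfrak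 bp_e$. There is a symmetric bilinear form $N^{23}$ on $\mathfrak g_{\mu_e}^*$ such that, for $z\in(W_{\rm red}\oplus\mathfrak bp_e)^{\perp\omega}$, the component of $Nz$ in the second summand of $\ker dJ(p_e)=W_{\rm red}\oplus\mathfrak g_{\mu_e}p_e$ is $\eta p_e$ with $N^{23}(dJ(p_e)z|_{\mathfrak g_{\mu_e}},\cdot)=\langle\cdot,\eta\rangle$. The quadratic Hamiltonian $H_{\rm nil}(z)=\frac12\omega(Nz,z)$ of $N$ is $$H_{\rm nil}=\tfrac12N^{23}(\mu,\mu)+\langle\mu,N^{21}x\rangle$$ at the point with $W_{\rm red}$-component $x$ and $Z$-component $\zeta$, $\mu=dJ(p_e)\zeta|_{\mathfrak g_{\mu_e}}$. For $x\in W^1_{\rm red}$ and $\mu=\mu^0+\mu^1$, $\mu^i\in\mathfrak g^{i*}_{\mu_e}$, this function is invariant under $T_{\xi_e}\times S^1$: $(x,\mu^0,\mu^1)\mapsto(a^{-1}x,\operatorname{CoAd}_t\mu^0,a\mu^1)$. Here $t\in T_{\xi_e}=\overline{\exp(\mathbb R\xi_e)}$, and $a=\exp(\theta^\wedge)$ (with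 $\theta^\wedge$ the infinitesimal rotation of $\mathbb R^2$ by $\theta\in\mathbb R$) acts by $\exp(\frac\theta\lambda L)$ on $W^1_{\rm red}$ and by $\operatorname{CoAd}_{\exp(\theta\xi_e/\lambda)}$ on $\mathfrak g^{1*}_{\mu_e}$. (c) There is a sign $s\in\{1,-1\}$ such that the following holds for every $\operatorname{Ad}$-invariant inner product on $\mathfrak g$. Call a basis $f_1,f_2$ of $W^1_{\rm red}$ and an orthonormal basis $e_1,e_2$ of $\mathfrak g^1_{\mu_e}$ *adapted with sign $s$* if $\omega_{\mu_e}(f_1,f_2)=1$, $Lf_1=-s\lambda f_2$, $Lf_2=s\lambda f_1$, $\operatorname{ad}_{\xi_e}e_1=s\lambda e_2$, $\operatorname{ad}_{\xi_e}e_2=-s\lambda e_1$. There are adapted bases with sign $s$ and none with sign $-s$, so there are two distinct cases, the "$+$" case $s=1$ and the "$-$" case $s=-1$. There is $\kappa\ge0$ such that the matrix of $N^{211}=N^{21}|W^1_{\rm red}$ in any adapted bases is $\kappa$ times a rotation, and for some adapted bases it is $\kappa$ times the identity. Given any splitting as in (b), there is a constant $I_1$ such that for all adapted bases of the latter kind $$H_{\rm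 nil}=\tfrac12N^{230}(\mu^0,\mu^0)+\tfrac12I_1(\pi_1^2+\pi_2^2)+\kappa(\pi_1x_1+\pi_2x_2).$$ Here $N^{230}$ is the restriction of $N^{23}$ to $\mathfrak g^{0*}_{\mu_e}$, $\mu=\mu^0+\mu^1$, $\pi_i=\langle\mu^1,e_i\rangle$, and $x_1f_1+x_2f_2$ is the $W^1_{\rm red}$-component of $x$. -/

import Mathlib

open scoped Manifold ContDiff TensorProduct
open Module

noncomputable section

namespace RelEq

/-! ### Linear algebra -/

section LinearAlgebra

variable {V : Type*} [AddCommGroup V] [Module ℝ V]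

/-- The restriction of `T` to a `T`-invariant subspace (zero if the subspace is not invariant). -/
def restrictEnd (T : Module.End ℝ V) (p : Submodule ℝ V) : Module.End ℝ p :=
  open Classical in if h : ∀ v ∈ p, T v ∈ p then T.restrict h else 0

/-- The map that `T` induces on the subquotient `K / (K ∩ O)` when `K` and `O` are `T`-invariant
(zero if they are not). -/
def inducedEnd (T : Module.End ℝ V) (K O : Submodule ℝ V) :
    Module.End ℝ (K ⧸ O.submoduleOf K) :=
  open Classical in
  if h : (∀ v ∈ K, T v ∈ K) ∧ (∀ v ∈ O, T v ∈ O) then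
    (O.submoduleOf K).mapQ (O.submoduleOf K) (T.restrict h.1) (fun v hv => h.2 v.1 hv)
  else 0

/-- The complex spectrum of a real operator. -/
def complexSpectrum (T : Module.End ℝ V) : Set ℂ :=
  spectrum ℂ (LinearMap.baseChange ℂ T : Module.End ℂ (ℂ ⊗[ℝ] V))

/-- The algebraic multiplicity of a complex number as an eigenvalue of a real operator. -/
def eigenMultiplicity (T : Module.End ℝ V) (z : ℂ) : ℕ :=
  finrank ℂ (Module.End.maxGenEigenspace (LinearMap.baseChange ℂ T : Module.End ℂ (ℂ ⊗[ℝ] V)) z)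

/-- The real vectors that lie in the sum of the generalized eigenspaces (in the complexification)
of the eigenvalues belonging to `s`. -/
def spectralSubspace (T : Module.End ℝ V) (s : Set ℂ) : Submodule ℝ V :=
  ((⨆ z ∈ s, Module.End.maxGenEigenspace
      (LinearMap.baseChange ℂ T : Module.End ℂ (ℂ ⊗[ℝ] V)) z).restrictScalars ℝ).comap
    (TensorProduct.mk ℝ ℂ V 1)

/-- The exponential of an endomorphism of a finite-dimensional real vector space. -/
def expEnd [FiniteDimensional ℝ V] (T : Module.End ℝ V) : Module.End ℝ V :=
  Matrix.toLin (finBasis ℝ V) (finBasis ℝ V)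
    (NormedSpace.exp (LinearMap.toMatrix (finBasis ℝ V) (finBasis ℝ V) T))

/-- `A = S + N` is the Jordan decomposition of `A` into commuting semisimple and nilpotent parts. -/
structure IsJordanDecomposition (A S N : Module.End ℝ V) : Prop where
  sum_eq : A = S + N
  commute : Commute S N
  semisimple : S.IsSemisimple
  nilpotent : IsNilpotent N

end LinearAlgebra

/-- The resonant pair of eigenvalues `±iλ`. -/
def resonantPair (lam : ℝ) : Set ℂ := {Complex.I * lam, -(Complex.I * lam)}

/-! ### Differential calculus on manifolds -/

section Manifolds

variable {E : Type*} [NormedAddCommGroup E] [NormedSpace ℝ E]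
  {M : Type*} [TopologicalSpace M] [ChartedSpace E M]

instance instFiniteDimensionalTangent [FiniteDimensional ℝ E] (p : M) :
    FiniteDimensional ℝ (TangentSpace 𝓘(ℝ, E) p) :=
  inferInstanceAs (FiniteDimensional ℝ E)

/-- The differential of a real function at a point, as a linear functional. -/
def dFun (f : M → ℝ) (p : M) : TangentSpace 𝓘(ℝ, E) p →ₗ[ℝ] ℝ :=
  (mfderiv 𝓘(ℝ, E) 𝓘(ℝ, ℝ) f p : TangentSpace 𝓘(ℝ, E) p →L[ℝ] ℝ).toLinearMap

/-- The linearization at `p` of a vector field `X` that vanishes at `p`: the derivative of the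
coordinate expression of `X` in the chart at `p`, transported to the tangent space at `p`. -/
def linearization (X : ∀ q : M, TangentSpace 𝓘(ℝ, E) q) (p : M) :
    Module.End ℝ (TangentSpace 𝓘(ℝ, E) p) :=
  let φ := extChartAt 𝓘(ℝ, E) p
  let D : TangentSpace 𝓘(ℝ, E) p →L[ℝ] E := mfderiv 𝓘(ℝ, E) 𝓘(ℝ, E) φ p
  let A : E →L[ℝ] E :=
    fderiv ℝ (fun y => VectorField.mpullback 𝓘(ℝ, E) 𝓘(ℝ, E) φ.symm X y) (φ p)
  (D.inverse.comp (A.comp D)).toLinearMap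

/-- The Hessian at a critical point `p` of `f`, computed in the chart at `p`. -/
def hessian (f : M → ℝ) (p : M) (v w : TangentSpace 𝓘(ℝ, E) p) : ℝ :=
  let φ := extChartAt 𝓘(ℝ, E) p
  let D : TangentSpace 𝓘(ℝ, E) p →L[ℝ] E := mfderiv 𝓘(ℝ, E) 𝓘(ℝ, E) φ p
  fderiv ℝ (fun y => fderiv ℝ (f ∘ φ.symm) y) (φ p) (D v) (D w)

variable (E M) in
/-- A symplectic form: a smooth, alternating, nondegenerate, closed two-form. Closedness is the
vanishing of the exterior derivative in every chart. -/
structure SymplecticForm [IsManifold 𝓘(ℝ, E) ∞ M] where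
  form (p : M) : TangentSpace 𝓘(ℝ, E) p →L[ℝ] TangentSpace 𝓘(ℝ, E) p →L[ℝ] ℝ
  alternating (p : M) (v : TangentSpace 𝓘(ℝ, E) p) : form p v v = 0
  nondegenerate (p : M) (v : TangentSpace 𝓘(ℝ, E) p) (hv : ∀ w, form p v w = 0) : v = 0
  smooth : ContMDiff 𝓘(ℝ, E) (𝓘(ℝ, E).prod 𝓘(ℝ, E →L[ℝ] E →L[ℝ] ℝ)) ∞
    (fun p : M => Bundle.TotalSpace.mk' (E →L[ℝ] E →L[ℝ] ℝ)
      (E := fun q : M => TangentSpace 𝓘(ℝ, E) q →L[ℝ] TangentSpace 𝓘(ℝ, E) q →L[ℝ] ℝ) p (form p))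
  closed (x : M) (y : E) (hy : y ∈ (extChartAt 𝓘(ℝ, E) x).target) (u v w : E) :
    let ψ := (extChartAt 𝓘(ℝ, E) x).symm
    let c : E → E → E → ℝ := fun a b y' => form (ψ y')
      (mfderiv 𝓘(ℝ, E) 𝓘(ℝ, E) ψ y' a) (mfderiv 𝓘(ℝ, E) 𝓘(ℝ, E) ψ y' b)
    fderiv ℝ (c v w) y u + fderiv ℝ (c w u) y v + fderiv ℝ (c u v) y w = 0

namespace SymplecticForm

variable [IsManifold 𝓘(ℝ, E) ∞ M] (Ω : SymplecticForm E M)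

/-- The symplectic form at a point as a bilinear form. -/
def bilin (p : M) : LinearMap.BilinForm ℝ (TangentSpace 𝓘(ℝ, E) p) :=
  LinearMap.mk₂ ℝ (fun v w => Ω.form p v w) (by simp) (by simp) (by simp) (by simp)

theorem bilin_apply (p : M) (v w : TangentSpace 𝓘(ℝ, E) p) : Ω.bilin p v w = Ω.form p v w := rfl

theorem bilin_isAlt (p : M) : (Ω.bilin p).IsAlt := fun v => Ω.alternating p v

theorem bilin_nondegenerate (p : M) : (Ω.bilin p).Nondegenerate :=
  (LinearMap.IsRefl.nondegenerate_iff_separatingLeft (Ω.bilin_isAlt p).isRefl).2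
    (fun v hv => Ω.nondegenerate p v hv)

/-- The Hamiltonian vector field of `f`, determined by `ω(X_f, ·) = df`. -/
def hamiltonianVF [FiniteDimensional ℝ E] (f : M → ℝ) (p : M) : TangentSpace 𝓘(ℝ, E) p :=
  ((Ω.bilin p).toDual (Ω.bilin_nondegenerate p)).symm (dFun f p)

end SymplecticForm

end Manifolds

/-! ### Lie groups -/

section LieGroups

variable {EG : Type*} [NormedAddCommGroup EG] [NormedSpace ℝ EG]
  {G : Type*} [TopologicalSpace G] [ChartedSpace EG G] [Group G]

/-- The adjoint action: the derivative at the identity of conjugation by `g`. -/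
def Ad (g : G) : Module.End ℝ (GroupLieAlgebra 𝓘(ℝ, EG) G) :=
  (mfderiv 𝓘(ℝ, EG) 𝓘(ℝ, EG) (fun h : G => g * h * g⁻¹) 1 :
    GroupLieAlgebra 𝓘(ℝ, EG) G →L[ℝ] GroupLieAlgebra 𝓘(ℝ, EG) G).toLinearMap

/-- `c` is the one-parameter subgroup `t ↦ exp (t ξ)`: a homomorphism that is the integral curve
of the left-invariant vector field of `ξ`. -/
structure IsOneParameterSubgroup (c : ℝ → G) (ξ : GroupLieAlgebra 𝓘(ℝ, EG) G) : Prop where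
  map_add (s t : ℝ) : c (s + t) = c s * c t
  integralCurve : IsMIntegralCurve c (fun g => mulInvariantVectorField (I := 𝓘(ℝ, EG)) ξ g)

/-- `T_ξ`, the closure of `exp (ℝ ξ)` in `G`. -/
def toralClosure (ξ : GroupLieAlgebra 𝓘(ℝ, EG) G) : Set G :=
  closure {g | ∃ (c : ℝ → G) (t : ℝ), IsOneParameterSubgroup c ξ ∧ c t = g}

/-- The isotropy group `G_μ` of `μ` under the coadjoint action `CoAd_g μ = μ ∘ Ad_{g⁻¹}`. -/
def isotropyGroup (μ : Dual ℝ (GroupLieAlgebra 𝓘(ℝ, EG) G)) : Set G :=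
  {g | μ ∘ₗ Ad g⁻¹ = μ}

/-- An `Ad`-invariant inner product on the Lie algebra. -/
structure IsAdInvariantInner (B : LinearMap.BilinForm ℝ (GroupLieAlgebra 𝓘(ℝ, EG) G)) :
    Prop where
  symm (η ζ : GroupLieAlgebra 𝓘(ℝ, EG) G) : B η ζ = B ζ η
  pos (η : GroupLieAlgebra 𝓘(ℝ, EG) G) (hη : η ≠ 0) : 0 < B η η
  invariant (g : G) (η ζ : GroupLieAlgebra 𝓘(ℝ, EG) G) : B (Ad g η) (Ad g ζ) = B η ζ

instance instLieGroupMinSmoothness [LieGroup 𝓘(ℝ, EG) ∞ G] :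
    LieGroup 𝓘(ℝ, EG) (minSmoothness ℝ 3) G :=
  LieGroup.of_le (n := ∞) (by
    rw [minSmoothness_of_isRCLikeNormedField]
    exact ENat.LEInfty.out)

variable [FiniteDimensional ℝ EG] [LieGroup 𝓘(ℝ, EG) ∞ G]

instance (priority := low) instCompleteSpaceOfFiniteDimensional : CompleteSpace EG := FiniteDimensional.complete ℝ EG

/-- `ad_ξ` on the Lie algebra of `G`. -/
def ad (ξ : GroupLieAlgebra 𝓘(ℝ, EG) G) : Module.End ℝ (GroupLieAlgebra 𝓘(ℝ, EG) G) :=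
  LieAlgebra.ad ℝ (GroupLieAlgebra 𝓘(ℝ, EG) G) ξ

/-- The Lie algebra `𝔤_μ` of the isotropy group of `μ`: the `ξ` with `coad_ξ μ = -μ ∘ ad_ξ = 0`. -/
def isotropyAlgebra (μ : Dual ℝ (GroupLieAlgebra 𝓘(ℝ, EG) G)) :
    Submodule ℝ (GroupLieAlgebra 𝓘(ℝ, EG) G) where
  carrier := {ξ | ∀ η, μ ⁅ξ, η⁆ = 0}
  zero_mem' := by simp
  add_mem' {a b} ha hb η := by simp [ha η, hb η]
  smul_mem' r a ha η := by simp [ha η]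

end LieGroups

/-! ### Hamiltonian systems with symmetry -/

section HamiltonianSystems

variable (EG : Type*) [NormedAddCommGroup EG] [NormedSpace ℝ EG]
  (G : Type*) [TopologicalSpace G] [ChartedSpace EG G] [Group G]
  (EP : Type*) [NormedAddCommGroup EP] [NormedSpace ℝ EP]
  (P : Type*) [TopologicalSpace P] [ChartedSpace EP P] [MulAction G P]

variable {EG G EP P} in
/-- The infinitesimal generator `ξ p = (d/dt) exp (t ξ) p` at `t = 0`, as a linear map in `ξ`. -/
def infGen (p : P) : GroupLieAlgebra 𝓘(ℝ, EG) G →ₗ[ℝ] TangentSpace 𝓘(ℝ, EP) p :=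
  (mfderiv 𝓘(ℝ, EG) 𝓘(ℝ, EP) (fun g : G => g • p) 1 :
    GroupLieAlgebra 𝓘(ℝ, EG) G →L[ℝ] TangentSpace 𝓘(ℝ, EP) p).toLinearMap

/-- A Hamiltonian system with symmetry: a symplectic manifold `P`, a smooth symplectic action of
the Lie group `G`, a coadjoint-equivariant momentum mapping `J`, and an invariant Hamiltonian. -/
structure HamiltonianSystem [IsManifold 𝓘(ℝ, EP) ∞ P] where
  symp : SymplecticForm EP P
  smooth_action : ContMDiff (𝓘(ℝ, EG).prod 𝓘(ℝ, EP)) 𝓘(ℝ, EP) ∞ (fun x : G × P => x.1 • x.2)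
  symplectic_action (g : G) (p : P) (v w : TangentSpace 𝓘(ℝ, EP) p) :
    symp.form (g • p) (mfderiv 𝓘(ℝ, EP) 𝓘(ℝ, EP) (fun q : P => g • q) p v)
      (mfderiv 𝓘(ℝ, EP) 𝓘(ℝ, EP) (fun q : P => g • q) p w) = symp.form p v w
  J : P → Dual ℝ (GroupLieAlgebra 𝓘(ℝ, EG) G)
  smooth_momentum (η : GroupLieAlgebra 𝓘(ℝ, EG) G) :
    ContMDiff 𝓘(ℝ, EP) 𝓘(ℝ, ℝ) ∞ (fun p => J p η)
  momentum (p : P) (η : GroupLieAlgebra 𝓘(ℝ, EG) G) (v : TangentSpace 𝓘(ℝ, EP) p) :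
    dFun (fun q => J q η) p v = symp.bilin p (infGen p η) v
  equivariant (g : G) (p : P) : J (g • p) = J p ∘ₗ Ad g⁻¹
  H : P → ℝ
  smooth_hamiltonian : ContMDiff 𝓘(ℝ, EP) 𝓘(ℝ, ℝ) ∞ H
  invariant (g : G) (p : P) : H (g • p) = H p

end HamiltonianSystems

namespace HamiltonianSystem

variable {EG : Type*} [NormedAddCommGroup EG] [NormedSpace ℝ EG] [FiniteDimensional ℝ EG]
  {G : Type*} [TopologicalSpace G] [ChartedSpace EG G] [Group G] [LieGroup 𝓘(ℝ, EG) ∞ G]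
  {EP : Type*} [NormedAddCommGroup EP] [NormedSpace ℝ EP] [FiniteDimensional ℝ EP]
  {P : Type*} [TopologicalSpace P] [ChartedSpace EP P] [IsManifold 𝓘(ℝ, EP) ∞ P] [MulAction G P]
  (𝓢 : HamiltonianSystem EG G EP P) (p : P) (ξ : GroupLieAlgebra 𝓘(ℝ, EG) G)

/-- `p` is a relative equilibrium with generator `ξ`: the integral curve of the Hamiltonian vector
field through `p` is `exp (t ξ) p`. -/
def IsRelativeEquilibrium : Prop :=
  ∃ c : ℝ → G, IsOneParameterSubgroup c ξ ∧
    IsMIntegralCurve (fun t => c t • p) (fun q => 𝓢.symp.hamiltonianVF 𝓢.H q)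

/-- `p` is regular: `η p ≠ 0` for every nonzero `η` in the Lie algebra. -/
def IsRegular (_𝓢 : HamiltonianSystem EG G EP P) (p : P) : Prop :=
  ∀ η : GroupLieAlgebra 𝓘(ℝ, EG) G, (infGen p η : TangentSpace 𝓘(ℝ, EP) p) = 0 → η = 0

/-- The augmented Hamiltonian `H_ξ = H - J_ξ`. -/
def augmented (q : P) : ℝ := 𝓢.H q - 𝓢.J q ξ

/-- `dX_{H_ξ}(p)`, the linearization at `p` of the Hamiltonian vector field of `H_ξ`. -/
def lin : Module.End ℝ (TangentSpace 𝓘(ℝ, EP) p) :=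
  linearization (fun q => 𝓢.symp.hamiltonianVF (𝓢.augmented ξ) q) p

/-- The differential `dJ(p) : T_p P → 𝔤*`. -/
def dJ : TangentSpace 𝓘(ℝ, EP) p →ₗ[ℝ] Dual ℝ (GroupLieAlgebra 𝓘(ℝ, EG) G) :=
  LinearMap.mk₂ ℝ (fun v η => dFun (fun q => 𝓢.J q η) p v)
    (by simp) (by simp)
    (fun v η ζ => by rw [𝓢.momentum, 𝓢.momentum, 𝓢.momentum, map_add, map_add]; rfl)
    (fun r v η => by rw [𝓢.momentum, 𝓢.momentum, map_smul, map_smul]; rfl)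

/-- `ker dJ(p)`. -/
def kerdJ : Submodule ℝ (TangentSpace 𝓘(ℝ, EP) p) := LinearMap.ker (𝓢.dJ p)

/-- `𝔤_μ` with `μ = J(p)`. -/
def gmu : Submodule ℝ (GroupLieAlgebra 𝓘(ℝ, EG) G) := isotropyAlgebra (𝓢.J p)

/-- `𝔤_μ p`, the tangent space at `p` to the orbit `G_μ p`. -/
def gmuOrbit : Submodule ℝ (TangentSpace 𝓘(ℝ, EP) p) := (𝓢.gmu p).map (infGen p)

/-- The restriction of `dJ(p) z` to `𝔤_μ`, i.e. `T_p P → 𝔤* → 𝔤_μ*`. -/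
def dJmu : TangentSpace 𝓘(ℝ, EP) p →ₗ[ℝ] Dual ℝ (𝓢.gmu p) :=
  (𝓢.gmu p).dualRestrict ∘ₗ 𝓢.dJ p

/-- The tangent space at the class of `p` to the reduced space `P_μ = J⁻¹(μ) / G_μ`, which is
`T_p J⁻¹(μ) / T_p (G_μ p) = ker dJ(p) / 𝔤_μ p`. -/
abbrev RedTangent : Type _ := 𝓢.kerdJ p ⧸ (𝓢.gmuOrbit p).submoduleOf (𝓢.kerdJ p)

/-- The derivative `ker dJ(p) → T P_μ` of the projection `π_μ : J⁻¹(μ) → P_μ`. -/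
def redProj : 𝓢.kerdJ p →ₗ[ℝ] 𝓢.RedTangent p :=
  ((𝓢.gmuOrbit p).submoduleOf (𝓢.kerdJ p)).mkQ

theorem symp_gmuOrbit_kerdJ (u : (𝓢.gmuOrbit p).submoduleOf (𝓢.kerdJ p)) (v : 𝓢.kerdJ p) :
    𝓢.symp.bilin p u v = 0 := by
  obtain ⟨u, hu⟩ := u
  obtain ⟨η, -, hη⟩ := hu
  have hv : 𝓢.dJ p v = 0 := v.2
  change 𝓢.symp.bilin p (u : TangentSpace 𝓘(ℝ, EP) p) v = 0
  have hη' : infGen p η = (u : TangentSpace 𝓘(ℝ, EP) p) := hη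
  rw [← hη', ← 𝓢.momentum]
  exact LinearMap.congr_fun hv η

/-- The reduced symplectic form `ω_μ` at the class of `p`: `π_μ^* ω_μ` is the restriction of `ω`
to `ker dJ(p)`. -/
def redForm : LinearMap.BilinForm ℝ (𝓢.RedTangent p) :=
  ((𝓢.gmuOrbit p).submoduleOf (𝓢.kerdJ p)).liftQ
    (LinearMap.mk₂ ℝ
      (fun (v : 𝓢.kerdJ p) (x : 𝓢.RedTangent p) =>
        ((𝓢.gmuOrbit p).submoduleOf (𝓢.kerdJ p)).liftQ
          ((𝓢.symp.bilin p v) ∘ₗ (𝓢.kerdJ p).subtype)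
          (fun u hu => by
            have h := 𝓢.symp_gmuOrbit_kerdJ p ⟨u, hu⟩ v
            change 𝓢.symp.bilin p v u = 0
            rw [← (𝓢.symp.bilin_isAlt p).neg_eq, neg_eq_zero]
            exact h) x)
      (fun a b x => by
        obtain ⟨x, rfl⟩ := Submodule.Quotient.mk_surjective _ x
        simp)
      (fun r a x => by
        obtain ⟨x, rfl⟩ := Submodule.Quotient.mk_surjective _ x
        simp)
      (fun a x y => by simp)
      (fun r a x => by simp))
    (fun u hu => by
      refine LinearMap.ext fun x => ?_
      obtain ⟨x, rfl⟩ := Submodule.Quotient.mk_surjective _ x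
      exact 𝓢.symp_gmuOrbit_kerdJ p ⟨u, hu⟩ x)

theorem redForm_redProj (v w : 𝓢.kerdJ p) :
    𝓢.redForm p (𝓢.redProj p v) (𝓢.redProj p w) = 𝓢.symp.bilin p v w := rfl

/-- `dX_{H_μ}` at the class of `p`: since `X_{H_μ}` and the restriction of `X_{H_ξ}` to `J⁻¹(μ)` are
`π_μ`-related, it is the map that `dX_{H_ξ}(p)` induces on `ker dJ(p) / 𝔤_μ p`. -/
def redLin : Module.End ℝ (𝓢.RedTangent p) :=
  inducedEnd (𝓢.lin p ξ) (𝓢.kerdJ p) (𝓢.gmuOrbit p)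

/-- `p` is formally stable: the Hessian of the reduced Hamiltonian, i.e. the form induced by
`d²H_ξ(p)` on `ker dJ(p) / 𝔤_μ p`, is positive or negative definite. -/
def IsFormallyStable : Prop :=
  (∀ v ∈ 𝓢.kerdJ p, v ∉ 𝓢.gmuOrbit p → 0 < hessian (𝓢.augmented ξ) p v v) ∨
    (∀ v ∈ 𝓢.kerdJ p, v ∉ 𝓢.gmuOrbit p → hessian (𝓢.augmented ξ) p v v < 0)

/-- `ad_ξ : 𝔤_μ → 𝔤_μ`. -/
def adMu : Module.End ℝ (𝓢.gmu p) := restrictEnd (ad ξ) (𝓢.gmu p)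

/-- The coadjoint action of `g ∈ G_μ` on `𝔤_μ*`. -/
def coAdMu (g : G) (ν : Dual ℝ (𝓢.gmu p)) : Dual ℝ (𝓢.gmu p) :=
  ν ∘ₗ restrictEnd (Ad g⁻¹) (𝓢.gmu p)

/-- The 1:1 group-reduced resonance at `±iλ` with multiplicity one. -/
structure IsResonant (lam : ℝ) : Prop where
  pos : 0 < lam
  inter : complexSpectrum (𝓢.adMu p ξ) ∩ complexSpectrum (𝓢.redLin p ξ) = resonantPair lam
  mult_group (z : ℂ) (hz : z ∈ resonantPair lam) : eigenMultiplicity (𝓢.adMu p ξ) z = 1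
  mult_reduced (z : ℂ) (hz : z ∈ resonantPair lam) : eigenMultiplicity (𝓢.redLin p ξ) z = 1

/-- The resonant part `W_red¹` of the reduced tangent space. -/
def redRes (lam : ℝ) : Submodule ℝ (𝓢.RedTangent p) :=
  spectralSubspace (𝓢.redLin p ξ) (resonantPair lam)

/-- The nonresonant part `W_red⁰` of the reduced tangent space. -/
def redNonres (lam : ℝ) : Submodule ℝ (𝓢.RedTangent p) :=
  spectralSubspace (𝓢.redLin p ξ) (resonantPair lam)ᶜ

/-- The resonant part `𝔤_μ¹` of `𝔤_μ`. -/
def gmuRes (lam : ℝ) : Submodule ℝ (𝓢.gmu p) :=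
  spectralSubspace (𝓢.adMu p ξ) (resonantPair lam)

/-- The nonresonant part `𝔤_μ⁰` of `𝔤_μ`. -/
def gmuNonres (lam : ℝ) : Submodule ℝ (𝓢.gmu p) :=
  spectralSubspace (𝓢.adMu p ξ) (resonantPair lam)ᶜ

/-- `𝔤_μ^{0*} ⊆ 𝔤_μ*` in the dual splitting: the functionals that vanish on `𝔤_μ¹`. -/
def dualNonres (lam : ℝ) : Submodule ℝ (Dual ℝ (𝓢.gmu p)) := (𝓢.gmuRes p ξ lam).dualAnnihilator

/-- `𝔤_μ^{1*} ⊆ 𝔤_μ*` in the dual splitting: the functionals that vanish on `𝔤_μ⁰`. -/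
def dualRes (lam : ℝ) : Submodule ℝ (Dual ℝ (𝓢.gmu p)) := (𝓢.gmuNonres p ξ lam).dualAnnihilator

/-- The choices in a Moncrief (Witt) splitting `T_p P = W_red ⊕ 𝔤_μ p ⊕ Z ⊕ 𝔟 p`, where `S` is the
semisimple part of `dX_{H_ξ}(p)`. -/
structure Splitting (S : Module.End ℝ (TangentSpace 𝓘(ℝ, EP) p)) where
  /-- An `S`-invariant complement to `𝔤_μ p` in `ker dJ(p)`. -/
  W : Submodule ℝ (TangentSpace 𝓘(ℝ, EP) p)
  W_inf : W ⊓ 𝓢.gmuOrbit p = ⊥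
  W_sup : W ⊔ 𝓢.gmuOrbit p = 𝓢.kerdJ p
  W_invariant : ∀ w ∈ W, S w ∈ W
  /-- An `Ad`-invariant complement to `𝔤_μ` in `𝔤`. -/
  b : Submodule ℝ (GroupLieAlgebra 𝓘(ℝ, EG) G)
  b_compl : IsCompl b (𝓢.gmu p)
  b_invariant : ∀ g ∈ isotropyGroup (𝓢.J p), ∀ β ∈ b, Ad g β ∈ b
  /-- An `S`-invariant Lagrangian complement to `𝔤_μ p` in the symplectic complement of
  `W ⊕ 𝔟 p`. -/
  Z : Submodule ℝ (TangentSpace 𝓘(ℝ, EP) p)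
  Z_inf : Z ⊓ 𝓢.gmuOrbit p = ⊥
  Z_sup : Z ⊔ 𝓢.gmuOrbit p = (𝓢.symp.bilin p).orthogonal (W ⊔ b.map (infGen p))
  Z_isotropic : ∀ z ∈ Z, ∀ z' ∈ Z, 𝓢.symp.bilin p z z' = 0
  Z_invariant : ∀ z ∈ Z, S z ∈ Z

namespace Splitting

variable {𝓢 p} {S : Module.End ℝ (TangentSpace 𝓘(ℝ, EP) p)} (σ : 𝓢.Splitting p S)

/-- The subspace `𝔟 p`. -/
def bOrbit : Submodule ℝ (TangentSpace 𝓘(ℝ, EP) p) := σ.b.map (infGen p)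

/-- The vector `w + η p + z + β p` with components `w`, `η`, `z`, `β` in the splitting. -/
def assemble (w : σ.W) (η : 𝓢.gmu p) (z : σ.Z) (β : σ.b) : TangentSpace 𝓘(ℝ, EP) p :=
  w.1 + infGen p η.1 + z.1 + infGen p β.1

theorem W_le : σ.W ≤ 𝓢.kerdJ p := σ.W_sup ▸ le_sup_left

/-- The identification of `W_red` with the reduced tangent space. -/
def toRed : σ.W →ₗ[ℝ] 𝓢.RedTangent p := 𝓢.redProj p ∘ₗ Submodule.inclusion σ.W_le

end Splitting

/-- `N²¹ : T P_μ → 𝔤_μ` is the map with `N v = (N²¹ [v]) p` for `v ∈ ker dJ(p)`. -/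
def IsN21 (N : Module.End ℝ (TangentSpace 𝓘(ℝ, EP) p))
    (N21 : 𝓢.RedTangent p →ₗ[ℝ] 𝓢.gmu p) : Prop :=
  ∀ v : 𝓢.kerdJ p, N v = infGen p (N21 (𝓢.redProj p v) : GroupLieAlgebra 𝓘(ℝ, EG) G)

/-- `N¹³ : 𝔤_μ* → T P_μ` is the map with `N¹³ (dJ(p) z) = [N z]` for `z ∈ T_p P`, where
`N z ∈ ker dJ(p)`. -/
def IsN13 (N : Module.End ℝ (TangentSpace 𝓘(ℝ, EP) p))
    (N13 : Dual ℝ (𝓢.gmu p) →ₗ[ℝ] 𝓢.RedTangent p) : Prop :=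
  ∀ z, ∃ h : N z ∈ 𝓢.kerdJ p, N13 (𝓢.dJmu p z) = 𝓢.redProj p ⟨N z, h⟩

variable {𝓢 p} in
/-- `N²³`, as a bilinear form on `𝔤_μ*`: for `z` in the symplectic complement of `W_red ⊕ 𝔟 p`,
the component of `N z` along the second summand of `ker dJ(p) = W_red ⊕ 𝔤_μ p` is
`(N²³)^♭ (dJ(p) z)`. -/
def IsN23 {S : Module.End ℝ (TangentSpace 𝓘(ℝ, EP) p)} (σ : 𝓢.Splitting p S)
    (N : Module.End ℝ (TangentSpace 𝓘(ℝ, EP) p))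
    (N23 : LinearMap.BilinForm ℝ (Dual ℝ (𝓢.gmu p))) : Prop :=
  ∀ z ∈ (𝓢.symp.bilin p).orthogonal (σ.W ⊔ σ.bOrbit), ∃ w ∈ σ.W, ∃ η : 𝓢.gmu p,
    N z = w + infGen p (η : GroupLieAlgebra 𝓘(ℝ, EG) G) ∧
      ∀ ν : Dual ℝ (𝓢.gmu p), N23 (𝓢.dJmu p z) ν = ν η

/-- The quadratic Hamiltonian `H_nil(z) = ½ ω(N z, z)` of the infinitesimally symplectic map `N`. -/
def nilHamiltonian (N : Module.End ℝ (TangentSpace 𝓘(ℝ, EP) p)) (z : TangentSpace 𝓘(ℝ, EP) p) : ℝ :=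
  1 / 2 * 𝓢.symp.bilin p (N z) z

/-- The function `½ N²³(ν, ν) + ⟨ν, N²¹ x⟩` of `x ∈ T P_μ` and `ν ∈ 𝔤_μ*`. -/
def nilNormalForm (N21 : 𝓢.RedTangent p →ₗ[ℝ] 𝓢.gmu p)
    (N23 : LinearMap.BilinForm ℝ (Dual ℝ (𝓢.gmu p)))
    (x : 𝓢.RedTangent p) (ν : Dual ℝ (𝓢.gmu p)) : ℝ :=
  1 / 2 * N23 ν ν + ν (N21 x)

/-- The circle action `exp(θ^) x = exp ((θ / λ) dX_{H_μ}) x` on the reduced tangent space. -/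
def circleRed (lam θ : ℝ) : Module.End ℝ (𝓢.RedTangent p) :=
  expEnd ((θ / lam) • 𝓢.redLin p ξ)

/-- Bases `f` of `W_red¹` and `e` of `𝔤_μ¹` adapted to the symplectic form, to the inner product
`B` and to the circle actions generated by `dX_{H_μ} / λ` and `ad_ξ / λ`: the form is `dx₁ ∧ dx₂`,
`e` is orthonormal, and the two actions are rotations in opposite senses. For `s = 1` (the "+" case)
the action on `W_red¹` is clockwise and the action on `𝔤_μ¹` is counterclockwise; for `s = -1`
(the "-" case) the senses are exchanged. -/
structure IsAdapted (lam : ℝ) (B : LinearMap.BilinForm ℝ (GroupLieAlgebra 𝓘(ℝ, EG) G)) (s : ℝ)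
    (f : Basis (Fin 2) ℝ (𝓢.redRes p ξ lam)) (e : Basis (Fin 2) ℝ (𝓢.gmuRes p ξ lam)) : Prop where
  darboux : 𝓢.redForm p (f 0) (f 1) = 1
  orthonormal (i j : Fin 2) : B (e i : 𝓢.gmu p) (e j : 𝓢.gmu p) = if i = j then 1 else 0
  red_zero : 𝓢.redLin p ξ (f 0) = -(s * lam) • (f 1 : 𝓢.RedTangent p)
  red_one : 𝓢.redLin p ξ (f 1) = (s * lam) • (f 0 : 𝓢.RedTangent p)
  group_zero : 𝓢.adMu p ξ (e 0) = (s * lam) • (e 1 : 𝓢.gmu p)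
  group_one : 𝓢.adMu p ξ (e 1) = -(s * lam) • (e 0 : 𝓢.gmu p)

end HamiltonianSystem

end RelEq

/-!
Let `A = dX_{H_ξ}(p)` be the linearization at the relative equilibrium and `A = S + N` its Jordan
decomposition.

*Properties of `A`.* Since `p` is a critical point of `H_ξ`, the form `ω(A v, w)` is the Hessian of
`H_ξ` (`bilin_linearization`), so `A` is skew for `ω`. Differentiation of
`H_ξ(g q) = H_ξ(q) + ⟨J(q), ξ - Ad_{g⁻¹} ξ⟩` gives `A(ηp) = -(ad_ξ η) p`, and by duality
`dJ(A v) = dJ(v) ∘ ad_ξ` (`hessian_infGen`, `lin_infGen`, `dJ_lin`). This uses that the derivative of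
`Ad` at the identity is the bracket (`exists_hasFDerivAt_Ad`).

*Where `N` lives.* `N` is a polynomial in `A` and is skew for `ω` as well
(`IsJordanDecomposition.exists_aeval`, `IsJordanDecomposition.skew`). The group is compact, so `ad_ξ`
is skew for an inner product (`exists_isAdInvariantInner`) and hence semisimple; as `A` acts on `𝔤p`
by `-ad_ξ`, `N` vanishes there (`nilpotent_infGen`), and by skewness its image lies in
`(𝔤p)^ω = ker dJ(p)`. By formal stability the reduced linearization `L` is skew for the definite
reduced Hessian, hence semisimple, and so `N` maps `ker dJ(p)` to `𝔤_μ p`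
(`nilpotent_mem_gmuOrbit`). At a regular point this is the map `N²¹`, and its transpose is `N¹³`.

*Localization.* `N` commutes with `A`, which means `N²¹ L = -ad_ξ N²¹`: generalized eigenspaces of
`L` for `z` are mapped to those of `ad_ξ` for `-z`. The spectrum of the skew operator `ad_ξ` is
symmetric, and it meets that of `L` in `±iλ` only, so `N²¹` vanishes on the nonresonant part
(`eq_zero_of_intertwine_neg`, `redNonres_le_ker`). By multiplicity one the resonant and nonresonant
subspaces of an operator `T` are the kernel and the range of `T² + λ²`
(`spectralSubspace_resonant`, `spectralSubspace_nonresonant`), which gives the remaining inclusions.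

*The normal form.* In a splitting, `dJ(p)` identifies `Z` with `𝔤_μ*`, and
`N²³(dJ z, dJ z') = ω(N z, z')` on `Z`. This form is symmetric and infinitesimally invariant under
the coadjoint action of `ξ` (`isN23_skew`), so that `𝔤_μ^{0*}` and `𝔤_μ^{1*}` are orthogonal for it
(`isN23_eq_zero`). The symmetry of `H_nil` follows by differentiation along `exp (tξ)` and passage
to the closure (`bilin_coAdMu`, `pairing_circle`).

*Adapted bases.* Since `ω_μ(L f₁, f₁) = sλ` in an adapted basis with sign `s`, the sign is that of
the reduced Hessian. On `W_red¹` and `𝔤_μ¹` the operators `L` and `ad_ξ` are `λ` times complex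
structures, `N²¹` intertwines them up to sign, and a choice of `e₁` along `N²¹ f₁` makes `N²¹` a
multiple of the identity (`exists_adapted`). Two adapted bases differ by rotations, and the invariant
form `N²³` on the plane `𝔤_μ^{1*}` is a multiple `I₁` of the inner product (`exists_inertia`).
-/

namespace RelEq
open Filter Topology Set

/-! ### The Hessian and the linearization of a Hamiltonian vector field -/

/-- The product rule for `M y (f y)` at a zero of `f` needs `M` to be continuous only. -/
theorem hasFDerivAt_clm_apply_of_eq_zero {E F G : Type*} [NormedAddCommGroup E] [NormedSpace ℝ E]
    [NormedAddCommGroup F] [NormedSpace ℝ F] [NormedAddCommGroup G] [NormedSpace ℝ G]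
    {M : E → F →L[ℝ] G} {f : E → F} {f' : E →L[ℝ] F} {x : E}
    (hM : ContinuousAt M x) (hf : HasFDerivAt f f' x) (h0 : f x = 0) :
    HasFDerivAt (fun y => M y (f y)) ((M x).comp f') x := by
  have h1 : HasFDerivAt (fun y => M x (f y)) ((M x).comp f') x :=
    (M x).hasFDerivAt.comp x hf
  have h2 : HasFDerivAt (fun y => (M y - M x) (f y)) (0 : E →L[ℝ] G) x := by
    have h3 : (fun y => M y - M x) =o[𝓝 x] (fun _ => (1 : ℝ)) := by
      rw [Asymptotics.isLittleO_one_iff]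
      simpa using hM.sub_const (M x)
    have h4 : f =O[𝓝 x] (fun y => y - x) := by simpa [h0] using hf.isBigO_sub
    have h5 : (fun y => (M y - M x) (f y)) =o[𝓝 x] (fun y => y - x) := by
      refine Asymptotics.IsBigO.trans_isLittleO (g := fun y => ‖M y - M x‖ * ‖f y‖) ?_ ?_
      · exact Asymptotics.IsBigO.of_bound 1 (Eventually.of_forall fun y => by
          simpa using (M y - M x).le_opNorm (f y))
      · refine Asymptotics.IsLittleO.of_norm_right ?_
        simpa using h3.norm_left.mul_isBigO h4.norm_left.norm_right
    refine .of_isLittleO ?_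
    simpa [h0] using h5
  refine (h1.add h2).congr_fderiv (by simp) |>.congr_of_eventuallyEq
    (Eventually.of_forall fun y => ?_)
  simp

section
variable {E : Type*} [NormedAddCommGroup E] [NormedSpace ℝ E]
  {M : Type*} [TopologicalSpace M] [ChartedSpace E M]

/-- The derivative at `p` of a function with values in a vector space is the derivative of its
coordinate expression in the chart at `p`. -/
theorem mfderiv_eq_fderiv_chart {F : Type*} [NormedAddCommGroup F] [NormedSpace ℝ F]
    {f : M → F} {p : M} (hf : MDifferentiableAt 𝓘(ℝ, E) 𝓘(ℝ, F) f p) :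
    (mfderiv 𝓘(ℝ, E) 𝓘(ℝ, F) f p : E →L[ℝ] F) =
      fderiv ℝ (f ∘ (extChartAt 𝓘(ℝ, E) p).symm) (extChartAt 𝓘(ℝ, E) p p) := by
  rw [hf.mfderiv]
  simp [writtenInExtChartAt]
  rfl

variable [IsManifold 𝓘(ℝ, E) ∞ M]

theorem mdifferentiableAt_symm {p : M} {y : E} (hy : y ∈ (extChartAt 𝓘(ℝ, E) p).target) :
    MDifferentiableAt 𝓘(ℝ, E) 𝓘(ℝ, E) (extChartAt 𝓘(ℝ, E) p).symm y := by
  have : IsManifold 𝓘(ℝ, E) 1 M := IsManifold.of_le (n := ∞) (by simp)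
  have := mdifferentiableWithinAt_extChartAt_symm (I := 𝓘(ℝ, E)) hy
  rwa [modelWithCornersSelf_coe, range_id, mdifferentiableWithinAt_univ] at this

theorem isInvertible_mfderiv_symm {p : M} {y : E} (hy : y ∈ (extChartAt 𝓘(ℝ, E) p).target) :
    (mfderiv 𝓘(ℝ, E) 𝓘(ℝ, E) (extChartAt 𝓘(ℝ, E) p).symm y).IsInvertible := by
  have : IsManifold 𝓘(ℝ, E) 1 M := IsManifold.of_le (n := ∞) (by simp)
  have := isInvertible_mfderivWithin_extChartAt_symm (I := 𝓘(ℝ, E)) hy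
  simpa using this

theorem fderiv_comp_symm {F : Type*} [NormedAddCommGroup F] [NormedSpace ℝ F]
    {f : M → F} {p : M} {y : E} (hy : y ∈ (extChartAt 𝓘(ℝ, E) p).target)
    (hf : MDifferentiableAt 𝓘(ℝ, E) 𝓘(ℝ, F) f ((extChartAt 𝓘(ℝ, E) p).symm y)) :
    fderiv ℝ (f ∘ (extChartAt 𝓘(ℝ, E) p).symm) y =
      (mfderiv 𝓘(ℝ, E) 𝓘(ℝ, F) f ((extChartAt 𝓘(ℝ, E) p).symm y)).comp
        (mfderiv 𝓘(ℝ, E) 𝓘(ℝ, E) (extChartAt 𝓘(ℝ, E) p).symm y) := by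
  rw [← mfderiv_eq_fderiv, mfderiv_comp y hf (mdifferentiableAt_symm hy)]

/-- The chart at `p` has derivative the identity at `p`, so that the transport to the tangent space
in the definition of the linearization is trivial. -/
theorem linearization_eq (X : ∀ q : M, TangentSpace 𝓘(ℝ, E) q) (p : M) (v : E) :
    (linearization X p v : E) = fderiv ℝ (fun y => VectorField.mpullback 𝓘(ℝ, E) 𝓘(ℝ, E)
      (extChartAt 𝓘(ℝ, E) p).symm X y) (extChartAt 𝓘(ℝ, E) p p) v := by
  have : IsManifold 𝓘(ℝ, E) 1 M := IsManifold.of_le (n := ∞) (by simp)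
  unfold linearization
  simp only [mfderiv_extChartAt_self]
  erw [ContinuousLinearMap.inverse_id]
  rfl

theorem hessian_eq (f : M → ℝ) (p : M) (v w : E) :
    hessian (E := E) f p v w = fderiv ℝ (fun y => fderiv ℝ (f ∘ (extChartAt 𝓘(ℝ, E) p).symm) y)
      (extChartAt 𝓘(ℝ, E) p p) v w := by
  have : IsManifold 𝓘(ℝ, E) 1 M := IsManifold.of_le (n := ∞) (by simp)
  unfold hessian
  simp only [mfderiv_extChartAt_self]
  rfl

theorem hessian_symm {f : M → ℝ} (hf : ContMDiff 𝓘(ℝ, E) 𝓘(ℝ, ℝ) ∞ f) (p : M) (v w : E) :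
    hessian (E := E) f p v w = hessian (E := E) f p w v := by
  rw [hessian_eq, hessian_eq]
  have : ContDiffAt ℝ 2 (f ∘ (extChartAt 𝓘(ℝ, E) p).symm) (extChartAt 𝓘(ℝ, E) p p) := by
    have h1 := hf.contMDiffAt (x := (extChartAt 𝓘(ℝ, E) p).symm (extChartAt 𝓘(ℝ, E) p p))
    have h2 := (contMDiffOn_extChartAt_symm (I := 𝓘(ℝ, E)) (n := ∞) p).contMDiffAt
      (extChartAt_target_mem_nhds p)
    exact ((h1.comp _ h2).contDiffAt).of_le (by exact ENat.LEInfty.out)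
  have := this.isSymmSndFDerivAt (by simp)
  exact this v w

/-- The symplectic form in the chart at `p`, as a function on the model space. -/
def chartForm (Ω : SymplecticForm E M) (p : M) (y : E) : E →L[ℝ] E →L[ℝ] ℝ :=
  let B : E →L[ℝ] E := mfderiv 𝓘(ℝ, E) 𝓘(ℝ, E) (extChartAt 𝓘(ℝ, E) p).symm y
  let w : E →L[ℝ] E →L[ℝ] ℝ := Ω.form ((extChartAt 𝓘(ℝ, E) p).symm y)
  w.bilinearComp B B

theorem chartForm_self (Ω : SymplecticForm E M) (p : M) (v w : E) :
    chartForm Ω p (extChartAt 𝓘(ℝ, E) p p) v w = Ω.bilin p v w := by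
  have : IsManifold 𝓘(ℝ, E) 1 M := IsManifold.of_le (n := ∞) (by simp)
  have h := mfderivWithin_range_extChartAt_symm (I := 𝓘(ℝ, E)) (x := p)
  rw [modelWithCornersSelf_coe, range_id, mfderivWithin_univ] at h
  have e : (extChartAt 𝓘(ℝ, E) p).symm (extChartAt 𝓘(ℝ, E) p p) = p := extChartAt_to_inv p
  -- The chart inverse returns `p` only propositionally; generalizing the base point makes the
  -- tangent spaces agree definitionally.
  have e1 : ∀ q, q = p → ∀ B : E →L[ℝ] E, B = ContinuousLinearMap.id ℝ E →
      (Ω.form q : E →L[ℝ] E →L[ℝ] ℝ) (B v) (B w) = (Ω.form p : E →L[ℝ] E →L[ℝ] ℝ) v w := by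
    rintro _ rfl _ rfl; rfl
  exact e1 _ e _ h

theorem continuousAt_chartForm [FiniteDimensional ℝ E] (Ω : SymplecticForm E M) (p : M) :
    ContinuousAt (chartForm Ω p) (extChartAt 𝓘(ℝ, E) p p) := by
  have : IsManifold 𝓘(ℝ, E) 1 M := IsManifold.of_le (n := ∞) (by simp)
  -- In finite dimensions continuity may be tested on constant vectors, which correspond to smooth
  -- sections of the tangent bundle near `p`.
  suffices h : ∀ a b, ContinuousAt (fun y => chartForm Ω p y a b) (extChartAt 𝓘(ℝ, E) p p) by
    exact continuousAt_clm_apply.2 fun a => continuousAt_clm_apply.2 fun b => h a b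
  intro a b
  let t := trivializationAt E (TangentSpace 𝓘(ℝ, E)) p
  have hp : p ∈ t.baseSet := FiberBundle.mem_baseSet_trivializationAt' p
  have hs (a : E) : ContMDiffAt 𝓘(ℝ, E) (𝓘(ℝ, E).prod 𝓘(ℝ, E)) 0
      (fun m => Bundle.TotalSpace.mk' E (E := TangentSpace 𝓘(ℝ, E)) m (t.symmL ℝ m a)) p := by
    have h1 := t.contMDiffAt_symmL (IB := 𝓘(ℝ, E)) (n := 0) hp
    have h2 : ContMDiffAt 𝓘(ℝ, E) (𝓘(ℝ, E).prod 𝓘(ℝ, E)) 0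
      (fun m : M => Bundle.TotalSpace.mk' E (E := Bundle.Trivial M E) m a) p := by
      rw [Bundle.contMDiffAt_section]
      exact contMDiffAt_const
    exact h1.clm_bundle_apply h2
  have h1 := ContMDiffAt.clm_bundle_apply₂ (E₃ := Bundle.Trivial M ℝ) (F₃ := ℝ) (b := id)
    ((Ω.smooth.contMDiffAt (x := p)).of_le (m := 0) (by simp)) (hs a) (hs b)
  have h2 := (Bundle.contMDiffAt_totalSpace.1 h1).2.continuousAt
  have h3 : ContinuousAt (extChartAt 𝓘(ℝ, E) p).symm (extChartAt 𝓘(ℝ, E) p p) :=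
    continuousAt_extChartAt_symm p
  have h4 := ContinuousAt.comp_of_eq h2 h3 (extChartAt_to_inv p)
  refine h4.congr ?_
  filter_upwards [extChartAt_target_mem_nhds (I := 𝓘(ℝ, E)) p] with y hy
  have h5 := TangentBundle.symmL_trivializationAt (I := 𝓘(ℝ, E)) (x₀ := p) (x :=
    (extChartAt 𝓘(ℝ, E) p).symm y)
    (by simpa using (extChartAt 𝓘(ℝ, E) p).map_target hy)
  rw [modelWithCornersSelf_coe, range_id, mfderivWithin_univ] at h5
  have h6 : extChartAt 𝓘(ℝ, E) p ((extChartAt 𝓘(ℝ, E) p).symm y) = y :=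
    (extChartAt 𝓘(ℝ, E) p).right_inv hy
  have e1 : ∀ z, z = y → ∀ B : E →L[ℝ] E, B = mfderiv 𝓘(ℝ, E) 𝓘(ℝ, E) (extChartAt 𝓘(ℝ, E)
    p).symm z →
      (Ω.form ((extChartAt 𝓘(ℝ, E) p).symm y) : E →L[ℝ] E →L[ℝ] ℝ) (B a) (B b) =
        chartForm Ω p y a b := by
    rintro _ rfl _ rfl; rfl
  exact e1 _ h6 _ h5

theorem chartForm_isInvertible [FiniteDimensional ℝ E] (Ω : SymplecticForm E M) (p : M) {y : E}
    (hy : y ∈ (extChartAt 𝓘(ℝ, E) p).target) : (chartForm Ω p y).IsInvertible := by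
  have hB := isInvertible_mfderiv_symm hy
  obtain ⟨B, hB⟩ := hB
  have hinj : Function.Injective (chartForm Ω p y) := by
    rw [injective_iff_map_eq_zero]
    intro a ha
    have h1 : B a = 0 := by
      refine Ω.nondegenerate _ _ fun w => ?_
      have := congrArg (fun l : E →L[ℝ] ℝ => l (B.symm w)) ha
      have h2 : (Ω.form ((extChartAt 𝓘(ℝ, E) p).symm y)) (B a) (B (B.symm w)) = 0 := by
        have h3 : ∀ C : E →L[ℝ] E, C = mfderiv 𝓘(ℝ, E) 𝓘(ℝ, E) (extChartAt 𝓘(ℝ, E) p).symm y →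
          (Ω.form ((extChartAt 𝓘(ℝ, E) p).symm y) : E →L[ℝ] E →L[ℝ] ℝ) (C a) (C (B.symm w)) = 0 :=
            by
          rintro _ rfl
          exact this
        exact h3 _ hB
      rwa [B.apply_symm_apply] at h2
    exact B.map_eq_zero_iff.1 h1
  let e : E ≃ₗ[ℝ] (E →L[ℝ] ℝ) := LinearEquiv.ofBijective (chartForm Ω p y).toLinearMap ⟨hinj, by
    refine (LinearMap.injective_iff_surjective_of_finrank_eq_finrank ?_).1 hinj
    rw [← LinearMap.toContinuousLinearMap.finrank_eq (R := ℝ)]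
    exact (Subspace.dual_finrank_eq (K := ℝ) (V := E)).symm⟩
  exact ⟨e.toContinuousLinearEquiv, by ext; rfl⟩

theorem chartForm_hamiltonianVF [FiniteDimensional ℝ E] (Ω : SymplecticForm E M) (p : M) {y : E}
    (hy : y ∈ (extChartAt 𝓘(ℝ, E) p).target) {f : M → ℝ} (hf : ContMDiff 𝓘(ℝ, E) 𝓘(ℝ, ℝ) ∞ f) :
    chartForm Ω p y (VectorField.mpullback 𝓘(ℝ, E) 𝓘(ℝ, E) (extChartAt 𝓘(ℝ, E) p).symm
      (Ω.hamiltonianVF f) y) =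
      fderiv ℝ (f ∘ (extChartAt 𝓘(ℝ, E) p).symm) y := by
  rw [fderiv_comp_symm hy (hf.mdifferentiable (by simp) _)]
  ext w
  have hB := isInvertible_mfderiv_symm hy
  set q := (extChartAt 𝓘(ℝ, E) p).symm y with hq
  obtain ⟨B, hB⟩ := hB
  have h1 : Ω.form q (Ω.hamiltonianVF f q) (B w) = dFun f q (B w) := by
    have := LinearMap.BilinForm.apply_toDual_symm_apply (hB := Ω.bilin_nondegenerate q) (dFun f q)
      (B w)
    exact this
  have h2 : ∀ C : TangentSpace 𝓘(ℝ, E) y →L[ℝ] TangentSpace 𝓘(ℝ, E) q, C = B → (Ω.form q)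
    (C (C.inverse (Ω.hamiltonianVF f q))) (C w) = mfderiv 𝓘(ℝ, E) 𝓘(ℝ, ℝ) f q (C w) := by
    rintro _ rfl
    rw [ContinuousLinearMap.inverse_equiv]
    erw [B.apply_symm_apply]
    exact h1
  exact h2 _ hB.symm

/-- The linearization of a Hamiltonian vector field at a critical point is the Hamiltonian operator
of the Hessian. In a chart `X_f = ω⁻¹ df` and `df` vanishes at the point, so that the derivative of
`ω⁻¹` does not enter. -/
theorem bilin_linearization [FiniteDimensional ℝ E] (Ω : SymplecticForm E M) (p : M) {f : M → ℝ}
    (hf : ContMDiff 𝓘(ℝ, E) 𝓘(ℝ, ℝ) ∞ f) (h0 : dFun (E := E) f p = 0) (v w : TangentSpace 𝓘(ℝ, E)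
      p) :
    Ω.bilin p (linearization (Ω.hamiltonianVF f) p v) w = hessian f p v w := by
  set φ := extChartAt 𝓘(ℝ, E) p with hφ
  have hsm : ContDiffAt ℝ 2 (f ∘ φ.symm) (φ p) := by
    have h1 := hf.contMDiffAt (x := φ.symm (φ p))
    have h2 := (contMDiffOn_extChartAt_symm (I := 𝓘(ℝ, E)) (n := ∞) p).contMDiffAt
      (extChartAt_target_mem_nhds p)
    exact ((h1.comp _ h2).contDiffAt).of_le (by exact ENat.LEInfty.out)
  have hd : DifferentiableAt ℝ (fderiv ℝ (f ∘ φ.symm)) (φ p) :=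
    (hsm.fderiv_right (m := 1) (by norm_num)).differentiableAt (by simp)
  have h00 : fderiv ℝ (f ∘ φ.symm) (φ p) = 0 := by
    rw [← mfderiv_eq_fderiv_chart (hf.mdifferentiable (by simp) _)]
    ext v
    exact LinearMap.congr_fun h0 v
  have hinv := chartForm_isInvertible Ω p (mem_extChartAt_target (I := 𝓘(ℝ, E)) p)
  have hc : ContinuousAt (fun y => (chartForm Ω p y).inverse) (φ p) := by
    obtain ⟨e, he⟩ := hinv
    have := (contDiffAt_map_inverse (𝕜 := ℝ) (n := 0) e).continuousAt
    exact ContinuousAt.comp_of_eq this (continuousAt_chartForm Ω p) he.symm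
  have key := hasFDerivAt_clm_apply_of_eq_zero hc hd.hasFDerivAt h00
  have key2 : HasFDerivAt (fun y => VectorField.mpullback 𝓘(ℝ, E) 𝓘(ℝ, E) φ.symm (Ω.hamiltonianVF f)
    y)
    (((chartForm Ω p (φ p)).inverse).comp (fderiv ℝ (fderiv ℝ (f ∘ φ.symm)) (φ p))) (φ p) := by
    refine key.congr_of_eventuallyEq ?_
    filter_upwards [extChartAt_target_mem_nhds (I := 𝓘(ℝ, E)) p] with y hy
    rw [← chartForm_hamiltonianVF Ω p hy hf]
    obtain ⟨e, he⟩ := chartForm_isInvertible Ω p hy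
    rw [← he, ContinuousLinearMap.inverse_equiv]
    exact (e.symm_apply_apply _).symm
  have e1 := linearization_eq (Ω.hamiltonianVF f) p v
  rw [key2.fderiv] at e1
  refine (chartForm_self Ω p _ _).symm.trans (Eq.trans ?_ (hessian_eq (E := E) f p v w).symm)
  obtain ⟨e, he⟩ := hinv
  rw [← he, ContinuousLinearMap.inverse_equiv] at e1
  have e3 := e.apply_symm_apply (fderiv ℝ (fderiv ℝ (f ∘ φ.symm)) (φ p) v)
  have e4 : chartForm Ω p (φ p) (linearization (Ω.hamiltonianVF f) p v) =
      fderiv ℝ (fderiv ℝ (f ∘ φ.symm)) (φ p) v := by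
    rw [← hφ] at he
    rw [← he, ← e3]
    exact congrArg e e1
  exact congrArg (fun l : E →L[ℝ] ℝ => l w) e4
end

/-! ### The derivative of the adjoint action at the identity -/

/-- Let `m` be a local multiplication with unit `x₀`, and let `F` solve `∂₁m(x₀, x) F(x) = ∂₂m(x,
x₀) η`, which says that `F(x) = Ad_x η`. Then `F` is differentiable at `x₀`, and `DF(x₀) ζ` is the
Lie bracket of the left-invariant vector fields of `ζ` and `η`. -/
theorem hasFDerivAt_of_conjugation {E : Type*} [NormedAddCommGroup E] [NormedSpace ℝ E]
    [CompleteSpace E]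
    {m : E × E → E} {x₀ : E} (hm : ContDiffAt ℝ 2 m (x₀, x₀))
    (hl : ∀ᶠ x in 𝓝 x₀, m (x₀, x) = x) (hr : ∀ᶠ x in 𝓝 x₀, m (x, x₀) = x)
    {F : E → E} {η : E}
    (hF : ∀ᶠ x in 𝓝 x₀, fderiv ℝ m (x₀, x) (F x, 0) = fderiv ℝ m (x, x₀) (0, η)) :
    ∃ D : E →L[ℝ] E, HasFDerivAt F D x₀ ∧ ∀ ζ, D ζ =
      VectorField.lieBracket ℝ (fun x => fderiv ℝ m (x, x₀) (0, ζ))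
        (fun x => fderiv ℝ m (x, x₀) (0, η)) x₀ := by
  have hmd : DifferentiableAt ℝ m (x₀, x₀) := hm.differentiableAt (by simp)
  have hd : DifferentiableAt ℝ (fderiv ℝ m) (x₀, x₀) :=
    (hm.fderiv_right (m := 1) (by norm_num)).differentiableAt (by simp)
  set D2 := fderiv ℝ (fderiv ℝ m) (x₀, x₀) with hD2
  have hsymm : ∀ u v, D2 u v = D2 v u := fun u v => hm.isSymmSndFDerivAt (by simp) u v
  have hi1 : HasFDerivAt (fun x : E => (x, x₀)) (ContinuousLinearMap.inl ℝ E E) x₀ :=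
    hasFDerivAt_prodMk_left x₀ x₀
  have hi2 : HasFDerivAt (fun x : E => (x₀, x)) (ContinuousLinearMap.inr ℝ E E) x₀ :=
    hasFDerivAt_prodMk_right x₀ x₀
  have hL (η : E) : HasFDerivAt (fun x => fderiv ℝ m (x, x₀) (0, η))
      ((ContinuousLinearMap.apply ℝ E ((0, η) : E × E)).comp
        (D2.comp (ContinuousLinearMap.inl ℝ E E))) x₀ :=
    (ContinuousLinearMap.apply ℝ E ((0, η) : E × E)).hasFDerivAt.comp x₀
      (HasFDerivAt.comp (g := fderiv ℝ m) x₀ hd.hasFDerivAt hi1)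
  have hR (η : E) : HasFDerivAt (fun x => fderiv ℝ m (x₀, x) (η, 0))
      ((ContinuousLinearMap.apply ℝ E ((η, 0) : E × E)).comp
        (D2.comp (ContinuousLinearMap.inr ℝ E E))) x₀ :=
    (ContinuousLinearMap.apply ℝ E ((η, 0) : E × E)).hasFDerivAt.comp x₀
      (HasFDerivAt.comp (g := fderiv ℝ m) x₀ hd.hasFDerivAt hi2)
  have hl1 (v : E) : fderiv ℝ m (x₀, x₀) (0, v) = v := by
    have h1 := HasFDerivAt.comp (g := m) (f := fun x : E => (x₀, x)) x₀ hmd.hasFDerivAt hi2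
    have h2 : HasFDerivAt (m ∘ fun x : E => (x₀, x)) (ContinuousLinearMap.id ℝ E) x₀ :=
      (hasFDerivAt_id x₀).congr_of_eventuallyEq hl
    simpa using congrArg (fun l : E →L[ℝ] E => l v) (h1.unique h2)
  have hr1 (v : E) : fderiv ℝ m (x₀, x₀) (v, 0) = v := by
    have h1 := HasFDerivAt.comp (g := m) (f := fun x : E => (x, x₀)) x₀ hmd.hasFDerivAt hi1
    have h2 : HasFDerivAt (m ∘ fun x : E => (x, x₀)) (ContinuousLinearMap.id ℝ E) x₀ :=
      (hasFDerivAt_id x₀).congr_of_eventuallyEq hr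
    simpa using congrArg (fun l : E →L[ℝ] E => l v) (h1.unique h2)
  -- the derivative of `m` in its first argument, invertible near `x₀`
  let R : E → E →L[ℝ] E := fun x => (fderiv ℝ m (x₀, x)).comp (ContinuousLinearMap.inl ℝ E E)
  have hR0 : R x₀ = (ContinuousLinearEquiv.refl ℝ E : E →L[ℝ] E) := by
    ext v; simpa [R] using hr1 v
  have hRc : ContinuousAt R x₀ := by
    have h1 : ContinuousAt (fun x => fderiv ℝ m (x₀, x)) x₀ :=
      ContinuousAt.comp (f := fun x : E => (x₀, x)) hd.continuousAt hi2.continuousAt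
    exact h1.clm_comp continuousAt_const
  have hinvAt := contDiffAt_map_inverse (𝕜 := ℝ) (n := 0) (ContinuousLinearEquiv.refl ℝ E)
  have hinvc : ContinuousAt (fun x => (R x).inverse) x₀ :=
    ContinuousAt.comp_of_eq hinvAt.continuousAt hRc hR0
  -- `F - η = R⁻¹ (∂₂m(x, x₀) η - ∂₁m(x₀, x) η)`, and the last factor vanishes at `x₀`; the
  -- derivative of `R⁻¹` is not needed.
  have hg : HasFDerivAt (fun x => fderiv ℝ m (x, x₀) (0, η) - fderiv ℝ m (x₀, x) (η, 0)) _ x₀ :=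
    (hL η).sub (hR η)
  have key := (hasFDerivAt_clm_apply_of_eq_zero hinvc hg (by rw [hl1, hr1, sub_self])).add_const η
  have hRinv : ∀ᶠ x in 𝓝 x₀, (R x).IsInvertible := by
    have h1 := (ContinuousLinearEquiv.isOpen (𝕜 := ℝ) (E := E) (F := E)).mem_nhds
      ⟨ContinuousLinearEquiv.refl ℝ E, rfl⟩
    exact hRc.eventually (hR0 ▸ h1)
  refine ⟨_, key.congr_of_eventuallyEq ?_, fun ζ => ?_⟩
  · filter_upwards [hF, hRinv] with x hx hinv
    obtain ⟨e, he⟩ := hinv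
    have h1 : fderiv ℝ m (x, x₀) (0, η) - fderiv ℝ m (x₀, x) (η, 0) = R x (F x - η) := by
      rw [← hx]
      simp [R, ← map_sub]
    rw [h1, ← he, ContinuousLinearMap.inverse_equiv]
    simp
  · rw [VectorField.lieBracket_eq]
    simp only [(hL _).fderiv, hR0, ContinuousLinearMap.inverse_equiv, hl1]
    simp [hsymm (0, ζ) (η, 0)]

section
variable {EG : Type*} [NormedAddCommGroup EG] [NormedSpace ℝ EG]
  {G : Type*} [TopologicalSpace G] [ChartedSpace EG G] [Group G] [LieGroup 𝓘(ℝ, EG) ∞ G]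

/-- The multiplication in the chart at the identity. -/
def chartMul (z : EG × EG) : EG :=
  extChartAt 𝓘(ℝ, EG) (1 : G) ((extChartAt 𝓘(ℝ, EG) (1 : G)).symm z.1 * (extChartAt 𝓘(ℝ, EG) (1 :
    G)).symm z.2)

local notation "φG" => extChartAt 𝓘(ℝ, EG) (1 : G)

theorem contDiffAt_chartMul : ContDiffAt ℝ ∞ (chartMul (EG := EG) (G := G)) (φG 1, φG 1) := by
  have hs := (contMDiffOn_extChartAt_symm (I := 𝓘(ℝ, EG)) (n := ∞) (1 : G)).contMDiffAt
      (extChartAt_target_mem_nhds (1 : G))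
  have h1 : ContMDiffAt 𝓘(ℝ, EG × EG) 𝓘(ℝ, EG) ∞ (fun z : EG × EG => (φG).symm z.1) (φG 1, φG 1) :=
    ContMDiffAt.comp (x := (φG 1, φG 1)) (g := (φG).symm) (f := Prod.fst)
      hs contDiff_fst.contDiffAt.contMDiffAt
  have h2 : ContMDiffAt 𝓘(ℝ, EG × EG) 𝓘(ℝ, EG) ∞ (fun z : EG × EG => (φG).symm z.2) (φG 1, φG 1) :=
    ContMDiffAt.comp (x := (φG 1, φG 1)) (g := (φG).symm) (f := Prod.snd)
      hs contDiff_snd.contDiffAt.contMDiffAt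
  have h3 := h1.mul h2
  have h4 : ContMDiffAt 𝓘(ℝ, EG) 𝓘(ℝ, EG) ∞ φG (1 : G) := contMDiffAt_extChartAt
  refine ContMDiffAt.contDiffAt ?_
  refine ContMDiffAt.comp_of_eq (x := (φG 1, φG 1)) (g := φG) h4 h3 ?_
  simp

/-- The coordinate expression of the derivative at the identity of a self-map of the group. -/
theorem mfderiv_chart_comp {p : G} {f : G → G} (hf : MDifferentiableAt 𝓘(ℝ, EG) 𝓘(ℝ, EG) f 1) (hp :
    f 1 ∈ (extChartAt 𝓘(ℝ, EG) p).source) (v : EG) :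
   (mfderiv 𝓘(ℝ, EG) 𝓘(ℝ, EG) (extChartAt 𝓘(ℝ, EG) p) (f 1) (mfderiv 𝓘(ℝ, EG) 𝓘(ℝ, EG) f 1 v) :
     EG) =
    fderiv ℝ (extChartAt 𝓘(ℝ, EG) p ∘ f ∘ (φG).symm) (φG 1) v := by
  have : IsManifold 𝓘(ℝ, EG) 1 G := IsManifold.of_le (n := ∞) (by simp)
  have h1 := mdifferentiableAt_extChartAt (I := 𝓘(ℝ, EG)) (by simpa using hp)
  have h2 := h1.comp 1 hf
  have h3 := mfderiv_eq_fderiv_chart h2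
  rw [mfderiv_comp (I' := 𝓘(ℝ, EG)) _ h1 hf] at h3
  exact congrArg (fun l : EG →L[ℝ] EG => l v) h3

theorem inverse_mfderiv_symm {M : Type*} [TopologicalSpace M] [ChartedSpace EG M]
    [IsManifold 𝓘(ℝ, EG) ∞ M] {p : M} {y : EG}
    (hy : y ∈ (extChartAt 𝓘(ℝ, EG) p).target) :
    (mfderiv 𝓘(ℝ, EG) 𝓘(ℝ, EG) (extChartAt 𝓘(ℝ, EG) p).symm y).inverse =
      mfderiv 𝓘(ℝ, EG) 𝓘(ℝ, EG) (extChartAt 𝓘(ℝ, EG) p) ((extChartAt 𝓘(ℝ, EG) p).symm y) := by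
  have : IsManifold 𝓘(ℝ, EG) 1 M := IsManifold.of_le (n := ∞) (by simp)
  have h1 := mfderiv_extChartAt_comp_mfderivWithin_extChartAt_symm (I := 𝓘(ℝ, EG)) hy
  have h2 := mfderivWithin_extChartAt_symm_comp_mfderiv_extChartAt (I := 𝓘(ℝ, EG)) hy
  rw [modelWithCornersSelf_coe, range_id, mfderivWithin_univ] at h1 h2
  exact ContinuousLinearMap.inverse_eq h2 h1

theorem eventually_differentiableAt_chartMul :
    ∀ᶠ z in 𝓝 (φG 1, φG 1), DifferentiableAt ℝ (chartMul (EG := EG) (G := G)) z := by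
  have h := (contDiffAt_chartMul (EG := EG) (G := G)).of_le (m := 1) (by exact ENat.LEInfty.out)
  exact (h.eventually (by simp)).mono fun z hz => hz.differentiableAt (by simp)

/-- In the chart, `∂₂m(x, 1) η` is the left-invariant vector field of `η`. -/
theorem eventually_fderiv_chartMul_left :
    ∀ᶠ x in 𝓝 (φG 1), ∀ η : EG, fderiv ℝ (chartMul (EG := EG) (G := G)) (x, φG 1) (0, η) =
      VectorField.mpullback 𝓘(ℝ, EG) 𝓘(ℝ, EG) (φG).symm
        (mulInvariantVectorField (I := 𝓘(ℝ, EG)) (G := G) η) x := by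
  have hc : ContinuousAt (fun x : EG => (x, φG 1)) (φG 1) := by fun_prop
  filter_upwards [hc.eventually (eventually_differentiableAt_chartMul (EG := EG) (G := G)),
    extChartAt_target_mem_nhds (I := 𝓘(ℝ, EG)) (1 : G)] with x hx hxt η
  have h1 : fderiv ℝ (chartMul (EG := EG) (G := G)) (x, φG 1) (0, η) =
      fderiv ℝ (φG ∘ (fun h => (φG).symm x * h) ∘ (φG).symm) (φG 1) η := by
    have h2 := HasFDerivAt.comp (g := chartMul (EG := EG) (G := G)) (f := fun y : EG => (x, y))
      (φG 1)
      hx.hasFDerivAt (hasFDerivAt_prodMk_right x (φG 1))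
    have h3 : (φG ∘ (fun h => (φG).symm x * h) ∘ (φG).symm) = chartMul (EG := EG) (G := G) ∘
      (fun y : EG => (x, y)) := rfl
    rw [h3, h2.fderiv]
    simp
  rw [h1, VectorField.mpullback_apply, inverse_mfderiv_symm hxt]
  have hs : (φG).symm x * 1 ∈ (φG).source := by
    rw [mul_one]; exact (φG).map_target hxt
  rw [← mfderiv_chart_comp (p := (1 : G)) (f := fun h => (φG).symm x * h)
    ((contMDiff_mul_left (I := 𝓘(ℝ, EG)) (n := ∞)).mdifferentiable (by simp) _) hs]
  have e : ∀ q q' : G, q = q' → ∀ w : EG, (mfderiv 𝓘(ℝ, EG) 𝓘(ℝ, EG) φG q : EG →L[ℝ] EG) w =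
    (mfderiv 𝓘(ℝ, EG) 𝓘(ℝ, EG) φG q' : EG →L[ℝ] EG) w := by
    rintro _ _ rfl _; rfl
  exact e _ _ (mul_one _) _

/-- `Ad g` as a continuous linear map of the model space `EG`, with which the Lie algebra is
definitionally identified. -/
def AdL (g : G) : EG →L[ℝ] EG := mfderiv 𝓘(ℝ, EG) 𝓘(ℝ, EG) (fun h => g * h * g⁻¹) 1

/-- The Lie bracket of the Lie algebra of `G` as an operation on the model space. -/
def lieBr (G : Type*) [TopologicalSpace G] [ChartedSpace EG G] [Group G] (ζ η : EG) : EG :=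
  Bracket.bracket (L := GroupLieAlgebra 𝓘(ℝ, EG) G) (M := GroupLieAlgebra 𝓘(ℝ, EG) G) ζ η

theorem hasFDerivAt_chart_conj (g : G) : HasFDerivAt (φG ∘ (fun h => g * h * g⁻¹) ∘ (φG).symm)
    (AdL (EG := EG) g) (φG 1) := by
  have hs : (fun h => g * h * g⁻¹) 1 ∈ (φG).source := by simp
  have hsm : ContMDiff 𝓘(ℝ, EG) 𝓘(ℝ, EG) ∞ (fun h : G => g * h * g⁻¹) :=
    (contMDiff_mul_right).comp contMDiff_mul_left
  have h1 := (hsm.mdifferentiable (by simp) 1).hasMFDerivAt.2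
  have e : ∀ q : G, q = 1 → ∀ D : EG →L[ℝ] EG,
      HasFDerivWithinAt (extChartAt 𝓘(ℝ, EG) q ∘ (fun h => g * h * g⁻¹) ∘ (φG).symm) D
        (range 𝓘(ℝ, EG)) (φG 1) →
      HasFDerivAt (φG ∘ (fun h => g * h * g⁻¹) ∘ (φG).symm) D (φG 1) := by
    rintro _ rfl D h
    rwa [modelWithCornersSelf_coe, range_id, hasFDerivWithinAt_univ] at h
  exact e _ (by simp) _ h1

/-- The identity `x h = (x h x⁻¹) x`, differentiated in `h` at the unit, is the equation that
characterizes `Ad_x η` in terms of the multiplication. -/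
theorem eventually_fderiv_chartMul_Ad (η : EG) :
    ∀ᶠ x in 𝓝 (φG 1), fderiv ℝ (chartMul (EG := EG) (G := G)) (φG 1, x) (AdL ((φG).symm x) η, 0) =
      fderiv ℝ (chartMul (EG := EG) (G := G)) (x, φG 1) (0, η) := by
  have hc : ContinuousAt (fun x : EG => (x, φG 1)) (φG 1) := by fun_prop
  have hc' : ContinuousAt (fun x : EG => (φG 1, x)) (φG 1) := by fun_prop
  filter_upwards [hc.eventually (eventually_differentiableAt_chartMul (EG := EG) (G := G)),
    hc'.eventually (eventually_differentiableAt_chartMul (EG := EG) (G := G)),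
    extChartAt_target_mem_nhds (I := 𝓘(ℝ, EG)) (1 : G)] with x hx hx' hxt
  have h2 := HasFDerivAt.comp (g := chartMul (EG := EG) (G := G)) (f := fun y : EG => (x, y)) (φG 1)
      hx.hasFDerivAt (hasFDerivAt_prodMk_right x (φG 1))
  set g := (φG).symm x with hg
  have h3 := hasFDerivAt_chart_conj (EG := EG) g
  have h0 : (φG ∘ (fun h => g * h * g⁻¹) ∘ (φG).symm) (φG 1) = φG 1 := by simp
  have h4 : HasFDerivAt (fun y => ((φG ∘ (fun h => g * h * g⁻¹) ∘ (φG).symm) y, x)) _ (φG 1) :=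
    h3.prodMk (hasFDerivAt_const x (φG 1))
  have h5 := HasFDerivAt.comp (g := chartMul (EG := EG) (G := G))
    (f := fun y => ((φG ∘ (fun h => g * h * g⁻¹) ∘ (φG).symm) y, x)) (φG 1)
    (by rw [h0]; exact hx'.hasFDerivAt) h4
  have h6 : (chartMul (EG := EG) (G := G) ∘ fun y => ((φG ∘ (fun h => g * h * g⁻¹) ∘ (φG).symm) y,
    x)) =ᶠ[𝓝 (φG 1)]
      (chartMul (EG := EG) (G := G) ∘ fun y : EG => (x, y)) := by
    have : ∀ᶠ y in 𝓝 (φG 1), g * (φG).symm y * g⁻¹ ∈ (φG).source := by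
      have c1 : ContinuousAt (fun y => g * (φG).symm y * g⁻¹) (φG 1) := by
        have := topologicalGroup_of_lieGroup 𝓘(ℝ, EG) (G := G) ∞
        have := continuousAt_extChartAt_symm (I := 𝓘(ℝ, EG)) (1 : G)
        exact (continuousAt_const.mul this).mul continuousAt_const
      refine c1.eventually ((isOpen_extChartAt_source (1 : G)).mem_nhds ?_)
      simp
    filter_upwards [this] with y hy
    simp only [chartMul, Function.comp]
    rw [(φG).left_inv hy, ← hg, inv_mul_cancel_right]
  have h7 := h5.unique (h2.congr_of_eventuallyEq h6)
  have h8 := congrArg (fun l : EG →L[ℝ] EG => l η) h7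
  exact h8

/-- The derivative of `x ↦ Ad_x η` at the identity in the direction `ζ` is `⁅ζ, η⁆`. -/
theorem exists_hasFDerivAt_Ad [FiniteDimensional ℝ EG] (η : EG) :
    ∃ D : EG →L[ℝ] EG, HasFDerivAt (fun x => AdL (EG := EG) ((φG).symm x) η) D (φG 1) ∧
      ∀ ζ : EG, D ζ = lieBr G ζ η := by
  have : IsManifold 𝓘(ℝ, EG) 1 G := IsManifold.of_le (n := ∞) (by simp)
  have hl : ∀ᶠ x in 𝓝 (φG 1), chartMul (EG := EG) (G := G) (φG 1, x) = x := by
    filter_upwards [extChartAt_target_mem_nhds (I := 𝓘(ℝ, EG)) (1 : G)] with x hx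
    simp only [chartMul, extChartAt_to_inv, one_mul]
    exact (φG).right_inv hx
  have hr : ∀ᶠ x in 𝓝 (φG 1), chartMul (EG := EG) (G := G) (x, φG 1) = x := by
    filter_upwards [extChartAt_target_mem_nhds (I := 𝓘(ℝ, EG)) (1 : G)] with x hx
    simp only [chartMul, extChartAt_to_inv, mul_one]
    exact (φG).right_inv hx
  obtain ⟨D, hD, hb⟩ := hasFDerivAt_of_conjugation
    (contDiffAt_chartMul.of_le (by exact ENat.LEInfty.out)) hl hr (eventually_fderiv_chartMul_Ad η)
  refine ⟨D, hD, fun ζ => ?_⟩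
  have h1 : VectorField.mlieBracket 𝓘(ℝ, EG) (mulInvariantVectorField (I := 𝓘(ℝ, EG)) (G := G) ζ)
    (mulInvariantVectorField (I := 𝓘(ℝ, EG)) (G := G) η) (1 : G) =
      VectorField.lieBracket ℝ (VectorField.mpullback 𝓘(ℝ, EG) 𝓘(ℝ, EG) (φG).symm
        (mulInvariantVectorField (I := 𝓘(ℝ, EG)) (G := G) ζ))
        (VectorField.mpullback 𝓘(ℝ, EG) 𝓘(ℝ, EG) (φG).symm (mulInvariantVectorField (I := 𝓘(ℝ, EG))
          (G := G) η)) (φG 1) := by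
    unfold VectorField.mlieBracket
    rw [VectorField.mlieBracketWithin_def]
    simp only [modelWithCornersSelf_coe, range_id, VectorField.mpullbackWithin_univ, preimage_univ,
      univ_inter]
    have h2 (V : ∀ x : EG, TangentSpace 𝓘(ℝ, EG) x) :
        VectorField.mpullback 𝓘(ℝ, EG) 𝓘(ℝ, EG) φG V (1 : G) = V (φG 1) := by
      rw [VectorField.mpullback_apply, mfderiv_extChartAt_self]
      exact congrArg (fun l : EG →L[ℝ] EG => l (V (φG 1))) ContinuousLinearMap.inverse_id
    refine (h2 _).trans ?_
    exact congrFun (VectorField.lieBracketWithin_univ (𝕜 := ℝ) (E := EG)) _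
  refine Eq.trans ?_ (show lieBr G ζ η = _ from h1).symm
  rw [hb ζ]
  refine Filter.EventuallyEq.lieBracket_vectorField_eq ?_ ?_
  · filter_upwards [eventually_fderiv_chartMul_left (EG := EG) (G := G)] with x hx
    exact hx ζ
  · filter_upwards [eventually_fderiv_chartMul_left (EG := EG) (G := G)] with x hx
    exact hx η
end

/-! ### The group law of the adjoint action and one-parameter subgroups -/

section
variable {EG : Type*} [NormedAddCommGroup EG] [NormedSpace ℝ EG]
  {G : Type*} [TopologicalSpace G] [ChartedSpace EG G] [Group G] [LieGroup 𝓘(ℝ, EG) ∞ G]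

local notation "φG" => extChartAt 𝓘(ℝ, EG) (1 : G)

theorem AdL_one : AdL (EG := EG) (1 : G) = ContinuousLinearMap.id ℝ EG := by
  have h1 : (fun h : G => 1 * h * 1⁻¹) = id := by ext; simp
  have h2 : HasFDerivAt (φG ∘ (fun h : G => 1 * h * 1⁻¹) ∘ (φG).symm) (ContinuousLinearMap.id ℝ EG)
    (φG 1) := by
    refine (hasFDerivAt_id _).congr_of_eventuallyEq ?_
    filter_upwards [extChartAt_target_mem_nhds (I := 𝓘(ℝ, EG)) (1 : G)] with x hx
    rw [h1]
    exact (φG).right_inv hx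
  exact (hasFDerivAt_chart_conj (EG := EG) (1 : G)).unique h2

theorem AdL_mul (g h : G) : AdL (EG := EG) (g * h) = (AdL g).comp (AdL h) := by
  have hg := hasFDerivAt_chart_conj (EG := EG) g
  have hh := hasFDerivAt_chart_conj (EG := EG) h
  have e0 : (φG ∘ (fun k => h * k * h⁻¹) ∘ (φG).symm) (φG 1) = φG 1 := by simp
  have h1 := HasFDerivAt.comp (g := φG ∘ (fun k => g * k * g⁻¹) ∘ (φG).symm)
    (f := φG ∘ (fun k => h * k * h⁻¹) ∘ (φG).symm) (φG 1) (by rw [e0]; exact hg) hh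
  have h2 : (φG ∘ (fun k => g * h * k * (g * h)⁻¹) ∘ (φG).symm) =ᶠ[𝓝 (φG 1)]
      (φG ∘ (fun k => g * k * g⁻¹) ∘ (φG).symm) ∘ (φG ∘ (fun k => h * k * h⁻¹) ∘ (φG).symm) := by
    have : ∀ᶠ y in 𝓝 (φG 1), h * (φG).symm y * h⁻¹ ∈ (φG).source := by
      have c1 : ContinuousAt (fun y => h * (φG).symm y * h⁻¹) (φG 1) := by
        have := topologicalGroup_of_lieGroup 𝓘(ℝ, EG) (G := G) ∞
        have := continuousAt_extChartAt_symm (I := 𝓘(ℝ, EG)) (1 : G)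
        exact (continuousAt_const.mul this).mul continuousAt_const
      refine c1.eventually ((isOpen_extChartAt_source (1 : G)).mem_nhds ?_)
      simp
    filter_upwards [this] with y hy
    simp only [Function.comp]
    rw [(φG).left_inv hy]
    congr 1
    group
  exact (hasFDerivAt_chart_conj (EG := EG) (g * h)).unique (h1.congr_of_eventuallyEq h2)

theorem AdL_mul_apply (g h : G) (η : EG) : AdL (EG := EG) (g * h) η = AdL g (AdL h η) := by
  rw [AdL_mul]; rfl

theorem AdL_inv_AdL (g : G) (η : EG) : AdL g⁻¹ (AdL g η) = η := by
  rw [← AdL_mul_apply, inv_mul_cancel, AdL_one]; rfl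

/-- Continuity at the identity follows from differentiability there, and continuity elsewhere from
the group law `Ad_{gh} = Ad_g Ad_h`. -/
theorem continuous_AdL [FiniteDimensional ℝ EG] : Continuous (AdL (EG := EG) : G → EG →L[ℝ] EG) :=
    by
  have hG := topologicalGroup_of_lieGroup 𝓘(ℝ, EG) (G := G) ∞
  have h1 : ContinuousAt (AdL (EG := EG) : G → EG →L[ℝ] EG) 1 := by
    rw [continuousAt_clm_apply]
    intro η
    obtain ⟨D, hD, -⟩ := exists_hasFDerivAt_Ad (EG := EG) (G := G) η
    have h2 := ContinuousAt.comp (f := φG) (x := (1 : G)) hD.continuousAt (continuousAt_extChartAt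
      (I := 𝓘(ℝ, EG)) (1 : G))
    refine h2.congr ?_
    filter_upwards [extChartAt_source_mem_nhds (I := 𝓘(ℝ, EG)) (1 : G)] with g hg
    simp only [Function.comp]
    rw [(φG).left_inv hg]
  refine continuous_iff_continuousAt.2 fun g => ?_
  have h3 : (AdL (EG := EG) : G → EG →L[ℝ] EG) = fun k => (AdL g).comp (AdL (g⁻¹ * k)) := by
    ext k v
    rw [← AdL_mul, mul_inv_cancel_left]
  rw [h3]
  have h5 : ContinuousAt (fun k : G => g⁻¹ * k) g := by fun_prop
  exact continuousAt_const.clm_comp (ContinuousAt.comp_of_eq h1 h5 (inv_mul_cancel g))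

/-- The derivative of `x ↦ Ad_{x⁻¹} η` at the identity in the direction `ζ` is `-⁅ζ, η⁆`. -/
theorem exists_hasFDerivAt_Ad_inv [FiniteDimensional ℝ EG] (η : EG) :
    ∃ D : EG →L[ℝ] EG, HasFDerivAt (fun x => AdL (EG := EG) ((φG).symm x)⁻¹ η) D (φG 1) ∧
      ∀ ζ : EG, D ζ = -lieBr G ζ η := by
  have hG := topologicalGroup_of_lieGroup 𝓘(ℝ, EG) (G := G) ∞
  obtain ⟨D, hD, hb⟩ := exists_hasFDerivAt_Ad (EG := EG) (G := G) η
  have hs := continuousAt_extChartAt_symm (I := 𝓘(ℝ, EG)) (1 : G)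
  have hM : ContinuousAt (fun x => AdL (EG := EG) ((φG).symm x)⁻¹) (φG 1) :=
    ContinuousAt.comp (f := (φG).symm) (g := fun g => AdL (EG := EG) g⁻¹)
      (continuous_AdL.comp continuous_inv).continuousAt hs
  have h0 : AdL (EG := EG) ((φG).symm (φG 1)) η - η = 0 := by
    rw [extChartAt_to_inv, AdL_one]; exact sub_self η
  -- `Ad_{x⁻¹} η - η = -Ad_{x⁻¹} (Ad_x η - η)`, and `Ad_x η - η` vanishes at the identity
  have key := (hasFDerivAt_clm_apply_of_eq_zero hM (hD.sub_const η) h0).neg.add_const η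
  refine ⟨_, key.congr_of_eventuallyEq (Eventually.of_forall fun x => ?_), fun ζ => ?_⟩
  · simp [map_sub, AdL_inv_AdL]
  · simp [extChartAt_to_inv, AdL_one, hb]

theorem mulInvariantVectorField_one (ξ : GroupLieAlgebra 𝓘(ℝ, EG) G) :
    mulInvariantVectorField ξ (1 : G) = ξ := by
  unfold mulInvariantVectorField
  have : (fun x : G => 1 * x) = id := by ext; simp
  rw [this, mfderiv_id]
  rfl

theorem IsOneParameterSubgroup.map_zero {c : ℝ → G} {ξ : GroupLieAlgebra 𝓘(ℝ, EG) G}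
    (hc : IsOneParameterSubgroup c ξ) : c 0 = 1 := by
  have := hc.map_add 0 0
  simpa using this

theorem IsOneParameterSubgroup.map_neg {c : ℝ → G} {ξ : GroupLieAlgebra 𝓘(ℝ, EG) G}
    (hc : IsOneParameterSubgroup c ξ) (t : ℝ) : c (-t) = (c t)⁻¹ := by
  refine eq_inv_of_mul_eq_one_left ?_
  rw [← hc.map_add, neg_add_cancel, hc.map_zero]

theorem IsOneParameterSubgroup.hasDerivAt_chart {c : ℝ → G}
    {ξ : GroupLieAlgebra 𝓘(ℝ, EG) G} (hc : IsOneParameterSubgroup c ξ) :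
    HasDerivAt (F := EG) (φG ∘ c) ξ 0 := by
  have h1 := (hc.integralCurve 0).2
  have e : ∀ q : G, q = 1 → HasFDerivWithinAt (extChartAt 𝓘(ℝ, EG) q ∘ c)
      (ContinuousLinearMap.smulRight (M₂ := EG) (1 : ℝ →L[ℝ] ℝ) (mulInvariantVectorField ξ q))
        univ 0 →
      HasDerivAt (F := EG) (φG ∘ c) ξ 0 := by
    rintro _ rfl h
    rw [hasFDerivWithinAt_univ, mulInvariantVectorField_one] at h
    exact h.hasDerivAt.congr_deriv (one_smul ℝ (ξ : EG))
  refine e _ hc.map_zero ?_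
  rw [modelWithCornersSelf_coe, range_id] at h1
  exact h1

/-- `d/dt Ad_{c(t)} η = Ad_{c(t)} ⁅ξ, η⁆` along the one-parameter subgroup `c` of `ξ`. -/
theorem IsOneParameterSubgroup.hasDerivAt_AdL [FiniteDimensional ℝ EG] {c : ℝ → G}
    {ξ : GroupLieAlgebra 𝓘(ℝ, EG) G} (hc : IsOneParameterSubgroup c ξ) (t : ℝ) (η : EG) :
    HasDerivAt (fun s => AdL (c s) η) (AdL (c t) (lieBr G ξ η)) t := by
  have h0 := hc.hasDerivAt_chart
  obtain ⟨D, hD, hb⟩ := exists_hasFDerivAt_Ad (EG := EG) (G := G) η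
  have h2 : HasDerivAt (fun s => AdL (c s) η) (lieBr G ξ η) 0 := by
    have h3 : HasDerivAt ((fun x => AdL (EG := EG) ((φG).symm x) η) ∘ (φG ∘ c)) (D ξ) 0 := by
      refine HasFDerivAt.comp_hasDerivAt 0 ?_ h0
      simpa [hc.map_zero] using hD
    replace h3 := h3.congr_deriv (hb ξ)
    refine h3.congr_of_eventuallyEq ?_
    have h4 : ∀ᶠ s in 𝓝 (0 : ℝ), c s ∈ (φG).source := by
      refine (hc.integralCurve 0).1.eventually ((isOpen_extChartAt_source (1 : G)).mem_nhds ?_)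
      rw [hc.map_zero]; exact mem_extChartAt_source (1 : G)
    filter_upwards [h4] with s hs
    simp only [Function.comp]
    rw [(φG).left_inv hs]
  have h5 : (fun s => AdL (c s) η) = fun s => AdL (EG := EG) (c t) (AdL (c (s - t)) η) := by
    ext s
    rw [← AdL_mul_apply, ← hc.map_add, add_sub_cancel]
  rw [h5]
  have h6 : HasDerivAt (fun s => AdL (c (s - t)) η) (lieBr G ξ η) t :=
    HasDerivAt.comp_sub_const t t (by rw [sub_self]; exact h2)
  exact (AdL (EG := EG) (c t)).hasFDerivAt.comp_hasDerivAt t h6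
end

/-! ### The momentum mapping and the Hessian along a group orbit -/

namespace HamiltonianSystem
section
variable {EG : Type*} [NormedAddCommGroup EG] [NormedSpace ℝ EG] [FiniteDimensional ℝ EG]
  {G : Type*} [TopologicalSpace G] [ChartedSpace EG G] [Group G] [LieGroup 𝓘(ℝ, EG) ∞ G]
  {EP : Type*} [NormedAddCommGroup EP] [NormedSpace ℝ EP] [FiniteDimensional ℝ EP]
  {P : Type*} [TopologicalSpace P] [ChartedSpace EP P] [IsManifold 𝓘(ℝ, EP) ∞ P] [MulAction G P]

local notation "φG" => extChartAt 𝓘(ℝ, EG) (1 : G)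

/-- The infinitesimal action at `p` as a continuous linear map between the model spaces. -/
def infL (EG G) [NormedAddCommGroup EG] [NormedSpace ℝ EG] [TopologicalSpace G] [ChartedSpace EG G]
    [Group G] [MulAction G P] (p : P) : EG →L[ℝ] EP := mfderiv 𝓘(ℝ, EG) 𝓘(ℝ, EP) (fun g :
      G => g • p) 1

/-- The action in the charts at the identity and at `p`. -/
def chartAct (EG G EP) [NormedAddCommGroup EG] [NormedSpace ℝ EG] [TopologicalSpace G]
    [ChartedSpace EG G] [Group G] [MulAction G P] [NormedAddCommGroup EP] [NormedSpace ℝ EP]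
      [ChartedSpace EP P] (p : P) (z : EG × EP) : EP :=
  extChartAt 𝓘(ℝ, EP) p ((extChartAt 𝓘(ℝ, EG) (1 : G)).symm z.1 • (extChartAt 𝓘(ℝ, EP) p).symm z.2)

theorem contMDiff_smul_point (𝓢 : HamiltonianSystem EG G EP P) (q : P) : ContMDiff 𝓘(ℝ, EG) 𝓘(ℝ, EP)
    ∞ (fun g : G => g • q) :=
  𝓢.smooth_action.comp (contMDiff_id.prodMk contMDiff_const)

theorem contMDiff_smul_const (𝓢 : HamiltonianSystem EG G EP P) (g : G) : ContMDiff 𝓘(ℝ, EP) 𝓘(ℝ, EP)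
    ∞ (fun q : P => g • q) :=
  𝓢.smooth_action.comp (contMDiff_const.prodMk contMDiff_id)

theorem contDiffAt_chartAct (𝓢 : HamiltonianSystem EG G EP P) (p : P) : ContDiffAt ℝ ∞
    (chartAct EG G EP p) (φG 1, extChartAt 𝓘(ℝ, EP) p p) := by
  have hs := (contMDiffOn_extChartAt_symm (I := 𝓘(ℝ, EG)) (n := ∞) (1 : G)).contMDiffAt
      (extChartAt_target_mem_nhds (1 : G))
  have hs' := (contMDiffOn_extChartAt_symm (I := 𝓘(ℝ, EP)) (n := ∞) p).contMDiffAt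
      (extChartAt_target_mem_nhds p)
  have h1 : ContMDiffAt 𝓘(ℝ, EG × EP) 𝓘(ℝ, EG) ∞ (fun z : EG × EP => (φG).symm z.1)
    (φG 1, extChartAt 𝓘(ℝ, EP) p p) :=
    ContMDiffAt.comp (x := (φG 1, extChartAt 𝓘(ℝ, EP) p p)) (g := (φG).symm) (f := Prod.fst)
      hs contDiff_fst.contDiffAt.contMDiffAt
  have h2 : ContMDiffAt 𝓘(ℝ, EG × EP) 𝓘(ℝ, EP) ∞ (fun z : EG × EP => (extChartAt 𝓘(ℝ, EP)
    p).symm z.2) (φG 1, extChartAt 𝓘(ℝ, EP) p p) :=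
    ContMDiffAt.comp (x := (φG 1, extChartAt 𝓘(ℝ, EP) p p)) (g := (extChartAt 𝓘(ℝ, EP) p).symm)
      (f := Prod.snd) hs' contDiff_snd.contDiffAt.contMDiffAt
  have h3 := (𝓢.smooth_action _).comp (φG 1, extChartAt 𝓘(ℝ, EP) p p) (h1.prodMk h2)
  have h4 : ContMDiffAt 𝓘(ℝ, EP) 𝓘(ℝ, EP) ∞ (extChartAt 𝓘(ℝ, EP) p) p := contMDiffAt_extChartAt
  refine ContMDiffAt.contDiffAt ?_
  refine ContMDiffAt.comp_of_eq (x := (φG 1, extChartAt 𝓘(ℝ, EP) p p)) (g := extChartAt 𝓘(ℝ, EP) p)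
    h4 h3 ?_
  simp

theorem hasFDerivAt_chart_orbit (𝓢 : HamiltonianSystem EG G EP P) (p : P) : HasFDerivAt
    (extChartAt 𝓘(ℝ, EP) p ∘ (fun g : G => g • p) ∘ (φG).symm)
    (infL EG G p) (φG 1) := by
  have h1 := ((𝓢.contMDiff_smul_point p).mdifferentiable (by simp) 1).hasMFDerivAt.2
  -- `1 • p = p` holds only propositionally
  have e : ∀ q : P, q = p → ∀ D : EG →L[ℝ] EP,
      HasFDerivWithinAt (extChartAt 𝓘(ℝ, EP) q ∘ (fun g : G => g • p) ∘ (φG).symm) D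
        (range 𝓘(ℝ, EG)) (φG 1) →
      HasFDerivAt (extChartAt 𝓘(ℝ, EP) p ∘ (fun g : G => g • p) ∘ (φG).symm) D (φG 1) := by
    rintro _ rfl D h
    rwa [modelWithCornersSelf_coe, range_id, hasFDerivWithinAt_univ] at h
  exact e _ (one_smul _ _) _ h1

/-- The derivative of a real function along the orbit through `p`. -/
theorem hasFDerivAt_comp_orbit (𝓢 : HamiltonianSystem EG G EP P) (p : P) {f : P → ℝ} (hf :
    ContMDiff 𝓘(ℝ, EP) 𝓘(ℝ, ℝ) ∞ f) :
    ∃ D : EG →L[ℝ] ℝ, HasFDerivAt (fun x => f ((φG).symm x • p)) D (φG 1) ∧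
      ∀ η : GroupLieAlgebra 𝓘(ℝ, EG) G, D η = dFun (E := EP) f p (infGen p η) := by
  have h1 := 𝓢.hasFDerivAt_chart_orbit p
  have h2 : HasFDerivAt (f ∘ (extChartAt 𝓘(ℝ, EP) p).symm) (fderiv ℝ (f ∘ (extChartAt 𝓘(ℝ, EP)
    p).symm) (extChartAt 𝓘(ℝ, EP) p p)) (extChartAt 𝓘(ℝ, EP) p p) := by
    refine DifferentiableAt.hasFDerivAt ?_
    rw [← mdifferentiableAt_iff_differentiableAt]
    exact (hf.mdifferentiable
      (by simp) _).comp (extChartAt 𝓘(ℝ, EP) p p) (mdifferentiableAt_symm (mem_extChartAt_target p))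
  have e0 : (extChartAt 𝓘(ℝ, EP) p ∘ (fun g : G => g • p) ∘ (φG).symm) (φG 1) = extChartAt 𝓘(ℝ, EP)
    p p := by simp
  have h3 := HasFDerivAt.comp (g := f ∘ (extChartAt 𝓘(ℝ, EP) p).symm) (f := extChartAt 𝓘(ℝ, EP) p ∘
    (fun g : G => g • p) ∘ (φG).symm) (φG 1)
    (by rw [e0]; exact h2) h1
  refine ⟨_, h3.congr_of_eventuallyEq ?_, fun η => ?_⟩
  · have c1 : ContinuousAt (fun x => (φG).symm x • p) (φG 1) :=
      ContinuousAt.comp (g := fun g : G => g • p) (𝓢.contMDiff_smul_point p).continuous.continuousAt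
        (continuousAt_extChartAt_symm (I := 𝓘(ℝ, EG)) (1 : G))
    have : ∀ᶠ x in 𝓝 (φG 1), (φG).symm x • p ∈ (extChartAt 𝓘(ℝ, EP) p).source := by
      refine c1.eventually ((isOpen_extChartAt_source p).mem_nhds ?_)
      simp
    filter_upwards [this] with x hx
    simp only [Function.comp]
    rw [(extChartAt 𝓘(ℝ, EP) p).left_inv hx]
  · rw [← mfderiv_eq_fderiv_chart (hf.mdifferentiable (by simp) _)]
    rfl

/-- The differential of an invariant function vanishes along the orbit. -/
theorem dFun_infGen_eq_zero (𝓢 : HamiltonianSystem EG G EP P) (p : P) {f : P → ℝ} (hf :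
    ContMDiff 𝓘(ℝ, EP) 𝓘(ℝ, ℝ) ∞ f) (hinv : ∀ (g : G) q, f (g • q) = f q)
    (η : GroupLieAlgebra 𝓘(ℝ, EG) G) : dFun (E := EP) f p (infGen p η) = 0 := by
  obtain ⟨D, hD, h⟩ := 𝓢.hasFDerivAt_comp_orbit p hf
  simp only [hinv] at hD
  rw [← h, hD.unique (hasFDerivAt_const _ _)]
  rfl

/-- The derivative of the equivariance `J(g p) = J(p) ∘ Ad_{g⁻¹}` of the momentum mapping. -/
theorem dJ_infGen (𝓢 : HamiltonianSystem EG G EP P) (p : P) (ζ η : GroupLieAlgebra 𝓘(ℝ, EG) G) :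
    𝓢.dJ p (infGen p ζ) η = -𝓢.J p ⁅ζ, η⁆ := by
  obtain ⟨D, hD, h⟩ := 𝓢.hasFDerivAt_comp_orbit p (𝓢.smooth_momentum η)
  obtain ⟨D', hD', h'⟩ := exists_hasFDerivAt_Ad_inv (EG := EG) (G := G) η
  let μ : EG →L[ℝ] ℝ := LinearMap.toContinuousLinearMap (E := EG) (F' := ℝ) (𝓢.J p)
  have h1 : (fun x => 𝓢.J ((φG).symm x • p) η) = fun x => μ (AdL (EG := EG) ((φG).symm x)⁻¹ η) := by
    ext x
    rw [𝓢.equivariant]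
    rfl
  rw [h1] at hD
  have h2 := hD.unique (μ.hasFDerivAt.comp (φG 1) hD')
  have h3 := h ζ
  rw [h2] at h3
  refine h3.symm.trans ?_
  have h4 : μ (D' ζ) = μ (-lieBr (EG := EG) G ζ η) := congrArg μ (h' ζ)
  refine h4.trans (map_neg μ (lieBr (EG := EG) G ζ η))

theorem contMDiff_augmented (𝓢 : HamiltonianSystem EG G EP P) (ξ : GroupLieAlgebra 𝓘(ℝ, EG) G) :
    ContMDiff 𝓘(ℝ, EP) 𝓘(ℝ, ℝ) ∞ (𝓢.augmented ξ) :=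
  𝓢.smooth_hamiltonian.sub (𝓢.smooth_momentum ξ)

theorem contDiffAt_comp_symm {f : P → ℝ} (hf : ContMDiff 𝓘(ℝ, EP) 𝓘(ℝ, ℝ) ∞ f) (p : P) :
    ContDiffAt ℝ ∞ (f ∘ (extChartAt 𝓘(ℝ, EP) p).symm) (extChartAt 𝓘(ℝ, EP) p p) := by
  have h1 := hf.contMDiffAt (x := (extChartAt 𝓘(ℝ, EP) p).symm (extChartAt 𝓘(ℝ, EP) p p))
  have h2 := (contMDiffOn_extChartAt_symm (I := 𝓘(ℝ, EP)) (n := ∞) p).contMDiffAt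
    (extChartAt_target_mem_nhds p)
  exact (h1.comp _ h2).contDiffAt

theorem fderiv_comp_symm_apply {f : P → ℝ} (hf : ContMDiff 𝓘(ℝ, EP) 𝓘(ℝ, ℝ) ∞ f) (p : P) (v :
    TangentSpace 𝓘(ℝ, EP) p) :
    fderiv ℝ (f ∘ (extChartAt 𝓘(ℝ, EP) p).symm) (extChartAt 𝓘(ℝ, EP) p p) v = dFun f p v := by
  rw [← mfderiv_eq_fderiv_chart (hf.mdifferentiable (by simp) _)]
  rfl

/-- The derivative in `q`, at `q = p`, of the identity `H_ξ(g q) = H_ξ(q) + ⟨J(q), ξ - Ad_{g⁻¹} ξ⟩`,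
where `p` is a critical point of `H_ξ`. -/
theorem eventually_fderiv_augmented (𝓢 : HamiltonianSystem EG G EP P) (p : P) (ξ :
    GroupLieAlgebra 𝓘(ℝ, EG) G)
    (h0 : dFun (E := EP) (𝓢.augmented ξ) p = 0) (v : EP) :
    ∀ᶠ x in 𝓝 (φG 1), fderiv ℝ (𝓢.augmented ξ ∘ (extChartAt 𝓘(ℝ, EP) p).symm) (chartAct EG G EP p
      (x, extChartAt 𝓘(ℝ, EP) p p))
      (fderiv ℝ (chartAct EG G EP p) (x, extChartAt 𝓘(ℝ, EP) p p) (0, v)) =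
      𝓢.dJ p v (ξ - Ad ((φG).symm x)⁻¹ ξ) := by
  have hc : ContinuousAt (fun x : EG => (x, extChartAt 𝓘(ℝ, EP) p p)) (φG 1) := by fun_prop
  have hd : ∀ᶠ z in 𝓝 (φG 1, extChartAt 𝓘(ℝ, EP) p p), DifferentiableAt ℝ (chartAct EG G EP p) z :=
    (((𝓢.contDiffAt_chartAct p).of_le (m := 1)
      (by exact ENat.LEInfty.out)).eventually (by simp)).mono
      fun z hz => hz.differentiableAt (by simp)
  have hd2 : ∀ᶠ y in 𝓝 (extChartAt 𝓘(ℝ, EP) p p), DifferentiableAt ℝ (𝓢.augmented ξ ∘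
    (extChartAt 𝓘(ℝ, EP) p).symm) y :=
    (((contDiffAt_comp_symm (𝓢.contMDiff_augmented ξ) p).of_le (m := 1)
      (by exact ENat.LEInfty.out)).eventually (by simp)).mono
      fun z hz => hz.differentiableAt (by simp)
  have hc2 : ContinuousAt (fun x : EG => chartAct EG G EP p (x, extChartAt 𝓘(ℝ, EP) p p)) (φG 1) :=
    ContinuousAt.comp (f := fun x : EG => (x, extChartAt 𝓘(ℝ, EP) p p))
      (𝓢.contDiffAt_chartAct p).continuousAt hc
  have hc20 : chartAct EG G EP p (φG 1, extChartAt 𝓘(ℝ, EP) p p) = extChartAt 𝓘(ℝ, EP) p p :=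
    by simp [chartAct]
  have c1 : ContinuousAt (fun x => (φG).symm x • p) (φG 1) :=
    ContinuousAt.comp (g := fun g : G => g • p) (𝓢.contMDiff_smul_point p).continuous.continuousAt
      (continuousAt_extChartAt_symm (I := 𝓘(ℝ, EG)) (1 : G))
  have c2 : ∀ᶠ x in 𝓝 (φG 1), (φG).symm x • p ∈ (extChartAt 𝓘(ℝ, EP) p).source := by
    refine c1.eventually ((isOpen_extChartAt_source p).mem_nhds ?_)
    simp
  filter_upwards [hc.eventually hd, hc2.eventually (hc20 ▸ hd2), c2] with x hx hx2 hx3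
  set g := (φG).symm x with hg
  set η : GroupLieAlgebra 𝓘(ℝ, EG) G := ξ - Ad g⁻¹ ξ with hη
  have h1 := HasFDerivAt.comp (g := 𝓢.augmented ξ ∘ (extChartAt 𝓘(ℝ, EP) p).symm) (f :=
    fun y => chartAct EG G EP p (x, y)) (extChartAt 𝓘(ℝ, EP) p p)
    hx2.hasFDerivAt (HasFDerivAt.comp (g := chartAct EG G EP p) (f := fun y : EP => (x, y))
      (extChartAt 𝓘(ℝ, EP) p p) hx.hasFDerivAt
      (hasFDerivAt_prodMk_right x (extChartAt 𝓘(ℝ, EP) p p)))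
  have h2 : HasFDerivAt (𝓢.augmented ξ ∘ (extChartAt 𝓘(ℝ, EP) p).symm + (fun q => 𝓢.J q η) ∘
    (extChartAt 𝓘(ℝ, EP) p).symm)
      (fderiv ℝ (𝓢.augmented ξ ∘ (extChartAt 𝓘(ℝ, EP) p).symm) (extChartAt 𝓘(ℝ, EP) p p) + fderiv ℝ
        ((fun q => 𝓢.J q η) ∘ (extChartAt 𝓘(ℝ, EP) p).symm) (extChartAt 𝓘(ℝ, EP) p p))
          (extChartAt 𝓘(ℝ, EP) p p) := by
    refine HasFDerivAt.add ?_ ?_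
    · exact ((contDiffAt_comp_symm (𝓢.contMDiff_augmented ξ) p).differentiableAt
        (by simp)).hasFDerivAt
    · exact ((contDiffAt_comp_symm (𝓢.smooth_momentum η) p).differentiableAt (by simp)).hasFDerivAt
  have h3 : (𝓢.augmented ξ ∘ (extChartAt 𝓘(ℝ, EP) p).symm) ∘ (fun y => chartAct EG G EP p
    (x, y)) =ᶠ[𝓝 (extChartAt 𝓘(ℝ, EP) p p)]
      𝓢.augmented ξ ∘ (extChartAt 𝓘(ℝ, EP) p).symm + (fun q => 𝓢.J q η) ∘ (extChartAt 𝓘(ℝ, EP)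
        p).symm := by
    have c3 : ContinuousAt (fun y => g • (extChartAt 𝓘(ℝ, EP) p).symm y) (extChartAt 𝓘(ℝ, EP)
      p p) :=
      ContinuousAt.comp (g := fun q : P => g • q) (𝓢.contMDiff_smul_const g).continuous.continuousAt
        (continuousAt_extChartAt_symm p)
    have c4 : ∀ᶠ y in 𝓝 (extChartAt 𝓘(ℝ, EP) p p), g • (extChartAt 𝓘(ℝ, EP) p).symm y ∈
      (extChartAt 𝓘(ℝ, EP) p).source := by
      refine c3.eventually ((isOpen_extChartAt_source p).mem_nhds ?_)
      simpa using hx3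
    filter_upwards [c4] with y hy
    simp only [Function.comp, Pi.add_apply, chartAct]
    rw [← hg, (extChartAt 𝓘(ℝ, EP) p).left_inv hy]
    simp only [augmented, 𝓢.invariant, 𝓢.equivariant, hη, map_sub, LinearMap.comp_apply]
    ring
  have h4 := h1.unique (h2.congr_of_eventuallyEq h3)
  have h5 := congrArg (fun l : EP →L[ℝ] ℝ => l v) h4
  have h6 : fderiv ℝ (𝓢.augmented ξ ∘ (extChartAt 𝓘(ℝ, EP) p).symm) (extChartAt 𝓘(ℝ, EP) p p) v =
    0 := by
    have := fderiv_comp_symm_apply (𝓢.contMDiff_augmented ξ) p v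
    rw [h0] at this
    exact this
  have h7 : fderiv ℝ ((fun q => 𝓢.J q η) ∘ (extChartAt 𝓘(ℝ, EP) p).symm) (extChartAt 𝓘(ℝ, EP) p p)
    v = 𝓢.dJ p v η :=
    fderiv_comp_symm_apply (𝓢.smooth_momentum η) p v
  refine Eq.trans ?_ (h5.trans ?_)
  · simp
  · rw [add_apply, h6, h7, zero_add]

/-- The Hessian of the augmented Hamiltonian in the direction of the group orbit: the derivative in
`g` of `eventually_fderiv_augmented`. -/
theorem hessian_infGen (𝓢 : HamiltonianSystem EG G EP P) (p : P) (ξ : GroupLieAlgebra 𝓘(ℝ, EG) G)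
    (h0 : dFun (E := EP) (𝓢.augmented ξ) p = 0) (ζ : GroupLieAlgebra 𝓘(ℝ, EG) G) (v :
      TangentSpace 𝓘(ℝ, EP) p) :
    hessian (𝓢.augmented ξ) p (infGen p ζ) v = 𝓢.dJ p v ⁅ζ, ξ⁆ := by
  set h : EP → ℝ := 𝓢.augmented ξ ∘ (extChartAt 𝓘(ℝ, EP) p).symm with hh
  have hsm : ContDiffAt ℝ ∞ h (extChartAt 𝓘(ℝ, EP) p p) := contDiffAt_comp_symm
    (𝓢.contMDiff_augmented ξ) p
  have hD : DifferentiableAt ℝ (fderiv ℝ h) (extChartAt 𝓘(ℝ, EP) p p) :=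
    (hsm.fderiv_right (m := 1)
      (by rw [one_add_one_eq_two]; exact ENat.LEInfty.out)).differentiableAt (by simp)
  have hc20 : chartAct EG G EP p (φG 1, extChartAt 𝓘(ℝ, EP) p p) = extChartAt 𝓘(ℝ, EP) p p :=
    by simp [chartAct]
  have horb : HasFDerivAt (fun x => chartAct EG G EP p (x, extChartAt 𝓘(ℝ, EP) p p)) (infL EG G p)
    (φG 1) := by
    refine (𝓢.hasFDerivAt_chart_orbit p).congr_of_eventuallyEq (Eventually.of_forall fun x => ?_)
    simp [chartAct]
  have hf := HasFDerivAt.comp (g := fderiv ℝ h) (f := fun x => chartAct EG G EP p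
    (x, extChartAt 𝓘(ℝ, EP) p p)) (φG 1)
    (by rw [hc20]; exact hD.hasFDerivAt) horb
  have hf0 : (fderiv ℝ h ∘ fun x => chartAct EG G EP p (x, extChartAt 𝓘(ℝ, EP) p p)) (φG 1) = 0 :=
    by
    simp only [Function.comp, hc20]
    ext w
    have := fderiv_comp_symm_apply (𝓢.contMDiff_augmented ξ) p w
    rw [h0] at this
    exact this
  have hm : ContinuousAt (fun x => fderiv ℝ (chartAct EG G EP p) (x, extChartAt 𝓘(ℝ, EP) p p)
    (0, (v : EP))) (φG 1) := by
    have c1 : ContinuousAt (fderiv ℝ (chartAct EG G EP p)) (φG 1, extChartAt 𝓘(ℝ, EP) p p) :=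
      ((𝓢.contDiffAt_chartAct p).fderiv_right (m := 0)
        (by rw [zero_add]; exact ENat.LEInfty.out)).continuousAt
    have c2 : ContinuousAt (fun x : EG => (x, extChartAt 𝓘(ℝ, EP) p p)) (φG 1) := by fun_prop
    exact (ContinuousAt.comp (f := fun x : EG => (x, extChartAt 𝓘(ℝ, EP) p p))
      c1 c2).clm_apply continuousAt_const
  have hm0 : fderiv ℝ (chartAct EG G EP p) (φG 1, extChartAt 𝓘(ℝ, EP) p p) (0, (v : EP)) = v := by
    have h1 := HasFDerivAt.comp (g := chartAct EG G EP p) (f := fun y : EP => (φG 1, y))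
      (extChartAt 𝓘(ℝ, EP) p p)
      ((𝓢.contDiffAt_chartAct p).differentiableAt
        (by simp)).hasFDerivAt (hasFDerivAt_prodMk_right (φG 1) (extChartAt 𝓘(ℝ, EP) p p))
    have h2 : HasFDerivAt (chartAct EG G EP p ∘ fun y : EP => (φG 1, y))
      (ContinuousLinearMap.id ℝ EP) (extChartAt 𝓘(ℝ, EP) p p) := by
      refine (hasFDerivAt_id _).congr_of_eventuallyEq ?_
      filter_upwards [extChartAt_target_mem_nhds (I := 𝓘(ℝ, EP)) p] with y hy
      simp only [Function.comp, chartAct, extChartAt_to_inv, one_smul]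
      exact (extChartAt 𝓘(ℝ, EP) p).right_inv hy
    exact congrArg (fun l : EP →L[ℝ] EP => l v) (h1.unique h2)
  have hM : ContinuousAt (fun x => ContinuousLinearMap.apply ℝ ℝ
      (fderiv ℝ (chartAct EG G EP p) (x, extChartAt 𝓘(ℝ, EP) p p) (0, (v : EP)))) (φG 1) :=
    ContinuousAt.comp (g := ContinuousLinearMap.apply ℝ ℝ (E := EP))
      (ContinuousLinearMap.continuous _).continuousAt hm
  -- `dH_ξ` vanishes at `p`, so that only its own derivative enters, and not that of the action
  have key := hasFDerivAt_clm_apply_of_eq_zero hM hf hf0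
  obtain ⟨D', hD', h'⟩ := exists_hasFDerivAt_Ad_inv (EG := EG) (G := G) ξ
  let μ : EG →L[ℝ] ℝ := LinearMap.toContinuousLinearMap (E := EG) (F' := ℝ) (𝓢.dJ p v)
  have key2 := μ.hasFDerivAt.comp (φG 1) (hD'.const_sub (ξ : EG))
  have key3 := key.unique (key2.congr_of_eventuallyEq (𝓢.eventually_fderiv_augmented p ξ h0 v))
  have h1 := congrArg (fun l : EG →L[ℝ] ℝ => l ζ) key3
  refine (hessian_eq (E := EP) (𝓢.augmented ξ) p (infGen p ζ) v).trans ?_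
  have h2 : fderiv ℝ (fderiv ℝ h) (extChartAt 𝓘(ℝ, EP) p p) (infL EG G p ζ)
    (fderiv ℝ (chartAct EG G EP p) (φG 1, extChartAt 𝓘(ℝ, EP) p p) (0, (v : EP))) = μ (-D' ζ) := h1
  rw [hm0] at h2
  refine h2.trans ?_
  rw [h' ζ, neg_neg]
  rfl
end
end HamiltonianSystem

/-! ### Curves in the Lie algebra and invariant inner products -/

section WeakDerivative
variable {W W' : Type*} [AddCommGroup W] [Module ℝ W] [AddCommGroup W'] [Module ℝ W']

/-- The curve `u` in a real vector space has derivative `u'` at `t` when tested against all linear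
functionals. In finite dimensions this is differentiability, with no choice of a norm. -/
def HasWeakDerivAt (u : ℝ → W) (u' : W) (t : ℝ) : Prop :=
  ∀ ℓ : Dual ℝ W, HasDerivAt (fun s => ℓ (u s)) (ℓ u') t

theorem HasWeakDerivAt.map {u : ℝ → W} {u' : W} {t : ℝ} (h : HasWeakDerivAt u u' t) (T :
    W →ₗ[ℝ] W') :
    HasWeakDerivAt (fun s => T (u s)) (T u') t := fun ℓ => h (ℓ ∘ₗ T)

theorem bilin_eq_sum [FiniteDimensional ℝ W'] (b : W →ₗ[ℝ] W' →ₗ[ℝ] ℝ) (x : W) (y : W') :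
    b x y = ∑ i, b.flip (finBasis ℝ W' i) x * (finBasis ℝ W').coord i y := by
  let e := finBasis ℝ W'
  calc b x y = b x (∑ i, e.repr y i • e i) := by rw [e.sum_repr]
    _ = _ := by
      rw [map_sum]
      exact Finset.sum_congr rfl fun i _ => by
        rw [map_smul, smul_eq_mul, mul_comm, LinearMap.flip_apply, Basis.coord_apply]

/-- The product rule for a bilinear form along two curves. -/
theorem HasWeakDerivAt.bilin [FiniteDimensional ℝ W'] {u : ℝ → W} {u' : W} {v : ℝ → W'} {v' : W'}
    {t : ℝ}
    (hu : HasWeakDerivAt u u' t) (hv : HasWeakDerivAt v v' t) (b : W →ₗ[ℝ] W' →ₗ[ℝ] ℝ) :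
    HasDerivAt (fun s => b (u s) (v s)) (b u' (v t) + b (u t) v') t := by
  let e := finBasis ℝ W'
  simp only [bilin_eq_sum b]
  rw [← Finset.sum_add_distrib]
  exact HasDerivAt.fun_sum fun i _ => (hu (b.flip (e i))).mul (hv (e.coord i))

theorem eq_of_hasDerivAt_zero {f : ℝ → ℝ} (h : ∀ t, HasDerivAt f 0 t) (s t : ℝ) : f s = f t :=
  is_const_of_deriv_eq_zero (fun t => (h t).differentiableAt) (fun t => (h t).deriv) s t

theorem continuous_bilin {X : Type*} [TopologicalSpace X] [FiniteDimensional ℝ W'] {u : X → W} {v :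
    X → W'}
    (hu : ∀ ℓ : Dual ℝ W, Continuous fun x => ℓ (u x)) (hv : ∀ ℓ : Dual ℝ W', Continuous fun x => ℓ
      (v x))
    (b : W →ₗ[ℝ] W' →ₗ[ℝ] ℝ) : Continuous fun x => b (u x) (v x) := by
  let e := finBasis ℝ W'
  simp only [bilin_eq_sum b]
  exact continuous_finsetSum _ fun i _ => (hu (b.flip (e i))).mul (hv (e.coord i))

end WeakDerivative

section
variable {EG : Type*} [NormedAddCommGroup EG] [NormedSpace ℝ EG] [FiniteDimensional ℝ EG]
  {G : Type*} [TopologicalSpace G] [ChartedSpace EG G] [Group G] [LieGroup 𝓘(ℝ, EG) ∞ G]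

local notation "φG" => extChartAt 𝓘(ℝ, EG) (1 : G)

theorem IsOneParameterSubgroup.hasWeakDerivAt_Ad {c : ℝ → G}
    {ξ : GroupLieAlgebra 𝓘(ℝ, EG) G} (hc : IsOneParameterSubgroup c ξ) (t : ℝ) (η :
      GroupLieAlgebra 𝓘(ℝ, EG) G) :
    HasWeakDerivAt (fun s => Ad (c s) η) (Ad (c t) ⁅ξ, η⁆) t := fun ℓ => by
  let μ : EG →L[ℝ] ℝ := LinearMap.toContinuousLinearMap (E := EG) (F' := ℝ) ℓ
  exact μ.hasFDerivAt.comp_hasDerivAt t (hc.hasDerivAt_AdL t (η : EG))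

theorem continuous_Ad (ℓ : Dual ℝ (GroupLieAlgebra 𝓘(ℝ, EG) G)) (η : GroupLieAlgebra 𝓘(ℝ, EG) G) :
    Continuous fun g : G => ℓ (Ad g η) := by
  let μ : EG →L[ℝ] ℝ := LinearMap.toContinuousLinearMap (E := EG) (F' := ℝ) ℓ
  have h1 : Continuous fun g : G => AdL (EG := EG) g (η : EG) :=
    continuous_AdL.clm_apply continuous_const
  exact μ.continuous.comp h1

theorem Ad_one : Ad (EG := EG) (1 : G) = 1 := by
  ext v
  exact congrArg (fun l : EG →L[ℝ] EG => l v) (AdL_one (EG := EG) (G := G))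

theorem Ad_mul (g h : G) : Ad (EG := EG) (g * h) = Ad g * Ad h := by
  have h1 (v : EG) : AdL (EG := EG) (g * h) v = AdL g (AdL h v) := AdL_mul_apply g h v
  ext v
  exact h1 v

theorem Ad_inv_Ad (g : G) (η : GroupLieAlgebra 𝓘(ℝ, EG) G) : Ad g⁻¹ (Ad g η) = η := by
  have h1 (v : EG) : AdL (EG := EG) g⁻¹ (AdL g v) = v := AdL_inv_AdL g v
  exact h1 η

theorem Ad_Ad_inv (g : G) (η : GroupLieAlgebra 𝓘(ℝ, EG) G) : Ad g (Ad g⁻¹ η) = η := by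
  have := Ad_inv_Ad g⁻¹ η
  rwa [inv_inv] at this

/-- `Ad g` is a homomorphism of Lie algebras: `Ad_{g x g⁻¹} (Ad_g η) = Ad_g (Ad_x η)` is
differentiated in `x` at the identity. -/
theorem Ad_lie (g : G) (ζ η : GroupLieAlgebra 𝓘(ℝ, EG) G) : Ad g ⁅ζ, η⁆ = ⁅Ad g ζ, Ad g η⁆ := by
  obtain ⟨D, hD, hb⟩ := exists_hasFDerivAt_Ad (EG := EG) (G := G) (η : EG)
  obtain ⟨D', hD', hb'⟩ := exists_hasFDerivAt_Ad (EG := EG) (G := G) (AdL (EG := EG) g (η : EG))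
  have hc := hasFDerivAt_chart_conj (EG := EG) g
  have e0 : (φG ∘ (fun k => g * k * g⁻¹) ∘ (φG).symm) (φG 1) = φG 1 := by simp
  have h1 := HasFDerivAt.comp (g := fun x => AdL (EG := EG) ((φG).symm x) (AdL (EG := EG) g (η :
    EG)))
    (f := φG ∘ (fun k => g * k * g⁻¹) ∘ (φG).symm) (φG 1) (by rw [e0]; exact hD') hc
  have h2 := (AdL (EG := EG) g).hasFDerivAt.comp (φG 1) hD
  have h3 : (fun x => AdL (EG := EG) ((φG).symm x) (AdL (EG := EG) g (η : EG))) ∘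
    (φG ∘ (fun k => g * k * g⁻¹) ∘ (φG).symm)
      =ᶠ[𝓝 (φG 1)] AdL (EG := EG) g ∘ fun x => AdL (EG := EG) ((φG).symm x) (η : EG) := by
    have : ∀ᶠ y in 𝓝 (φG 1), g * (φG).symm y * g⁻¹ ∈ (φG).source := by
      have c1 : ContinuousAt (fun y => g * (φG).symm y * g⁻¹) (φG 1) := by
        have := topologicalGroup_of_lieGroup 𝓘(ℝ, EG) (G := G) ∞
        have := continuousAt_extChartAt_symm (I := 𝓘(ℝ, EG)) (1 : G)
        exact (continuousAt_const.mul this).mul continuousAt_const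
      refine c1.eventually ((isOpen_extChartAt_source (1 : G)).mem_nhds ?_)
      simp
    filter_upwards [this] with y hy
    simp only [Function.comp]
    have h6 (v : EG) : AdL (EG := EG) (g * (φG).symm y * g⁻¹) (AdL g v) = AdL g (AdL ((φG).symm y)
      v) := by
      rw [← AdL_mul_apply, inv_mul_cancel_right, AdL_mul_apply]
    rw [(φG).left_inv hy]
    exact h6 η
  have h4 := h1.unique (h2.congr_of_eventuallyEq h3)
  have h5 : D' (AdL (EG := EG) g ζ) = AdL (EG := EG) g (D ζ) := congrArg (fun l : EG →L[ℝ] EG =>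
    l ζ) h4
  refine ((congrArg (AdL (EG := EG) g) (hb ζ)).symm.trans h5.symm).trans (hb' _)

open MeasureTheory in
/-- Averaging over the compact group gives an `Ad`-invariant inner product. -/
theorem exists_isAdInvariantInner [CompactSpace G] [T2Space G] :
    ∃ B : LinearMap.BilinForm ℝ (GroupLieAlgebra 𝓘(ℝ, EG) G), IsAdInvariantInner B := by
  have hG := topologicalGroup_of_lieGroup 𝓘(ℝ, EG) (G := G) ∞
  let : MeasurableSpace G := borel G
  have : BorelSpace G := ⟨rfl⟩
  let μ : Measure G := Measure.haar
  let e := finBasis ℝ (GroupLieAlgebra 𝓘(ℝ, EG) G)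
  -- the pullback by `Ad g⁻¹` of the inner product for which the basis `e` is orthonormal
  let F : GroupLieAlgebra 𝓘(ℝ, EG) G → GroupLieAlgebra 𝓘(ℝ, EG) G → G → ℝ :=
    fun η ζ g => ∑ i, e.coord i (Ad g⁻¹ η) * e.coord i (Ad g⁻¹ ζ)
  have hF (η ζ) : Continuous (F η ζ) := by
    refine continuous_finsetSum _ fun i _ => ?_
    exact ((continuous_Ad _ η).comp continuous_inv).mul ((continuous_Ad _ ζ).comp continuous_inv)
  have hI (η ζ) : Integrable (F η ζ) μ := (hF η ζ).integrable_of_hasCompactSupport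
    (HasCompactSupport.of_compactSpace _)
  let B : LinearMap.BilinForm ℝ (GroupLieAlgebra 𝓘(ℝ, EG) G) :=
    LinearMap.mk₂ ℝ (fun η ζ => ∫ g, F η ζ g ∂μ)
      (fun a b ζ => by
        rw [← integral_add (hI _ _) (hI _ _)]
        congr 1; ext g; simp only [F, map_add, add_mul, Finset.sum_add_distrib])
      (fun r a ζ => by
        rw [smul_eq_mul, ← integral_const_mul]
        congr 1; ext g; simp only [F, map_smul, smul_eq_mul, mul_assoc, Finset.mul_sum])
      (fun ζ a b => by
        rw [← integral_add (hI _ _) (hI _ _)]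
        congr 1; ext g; simp only [F, map_add, mul_add, Finset.sum_add_distrib])
      (fun r a ζ => by
        rw [smul_eq_mul, ← integral_const_mul]
        congr 1; ext g; simp only [F, map_smul, smul_eq_mul, mul_left_comm, Finset.mul_sum])
  refine ⟨B, fun η ζ => ?_, fun η hη => ?_, fun g η ζ => ?_⟩
  · change ∫ g, F η ζ g ∂μ = ∫ g, F ζ η g ∂μ
    simp only [F, mul_comm]
  · change 0 < ∫ g, F η η g ∂μ
    refine (hF η η).integral_pos_of_hasCompactSupport_nonneg_nonzero
      (HasCompactSupport.of_compactSpace _)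
      (fun g => Finset.sum_nonneg fun i _ => mul_self_nonneg _) (x := 1) ?_
    intro h0
    apply hη
    simp only [F, inv_one, Ad_one] at h0
    rw [Finset.sum_eq_zero_iff_of_nonneg (fun i _ => mul_self_nonneg _)] at h0
    refine e.ext_elem fun i => ?_
    have := h0 i (Finset.mem_univ i)
    simpa using this
  · change ∫ h, F (Ad g η) (Ad g ζ) h ∂μ = ∫ h, F η ζ h ∂μ
    rw [← integral_mul_left_eq_self (μ := μ) (F η ζ) g⁻¹]
    congr 1; ext h
    have (η : GroupLieAlgebra 𝓘(ℝ, EG) G) : Ad (g⁻¹ * h)⁻¹ η = Ad h⁻¹ (Ad g η) := by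
      rw [mul_inv_rev, inv_inv, Ad_mul]; rfl
    simp only [F, this]

/-- The infinitesimal form of the `Ad`-invariance of an inner product. -/
theorem IsAdInvariantInner.ad_skew {B : LinearMap.BilinForm ℝ (GroupLieAlgebra 𝓘(ℝ, EG) G)} (hB :
    IsAdInvariantInner B)
    {c : ℝ → G} {ξ : GroupLieAlgebra 𝓘(ℝ, EG) G} (hc : IsOneParameterSubgroup c ξ) (η ζ :
      GroupLieAlgebra 𝓘(ℝ, EG) G) :
    B ⁅ξ, η⁆ ζ = -B η ⁅ξ, ζ⁆ := by
  have h1 := (hc.hasWeakDerivAt_Ad 0 η).bilin (hc.hasWeakDerivAt_Ad 0 ζ) B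
  simp only [hB.invariant] at h1
  have h2 := h1.unique (hasDerivAt_const _ _)
  exact eq_neg_of_add_eq_zero_left h2

end

/-! ### Relative equilibria -/

namespace HamiltonianSystem
section
variable {EG : Type*} [NormedAddCommGroup EG] [NormedSpace ℝ EG] [FiniteDimensional ℝ EG]
  {G : Type*} [TopologicalSpace G] [ChartedSpace EG G] [Group G] [LieGroup 𝓘(ℝ, EG) ∞ G]
  {EP : Type*} [NormedAddCommGroup EP] [NormedSpace ℝ EP] [FiniteDimensional ℝ EP]
  {P : Type*} [TopologicalSpace P] [ChartedSpace EP P] [IsManifold 𝓘(ℝ, EP) ∞ P] [MulAction G P]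

theorem bilin_hamiltonianVF (Ω : SymplecticForm EP P) (f : P → ℝ) (q : P) (v : TangentSpace 𝓘(ℝ, EP)
    q) :
    Ω.bilin q (Ω.hamiltonianVF f q) v = dFun f q v :=
  LinearMap.BilinForm.apply_toDual_symm_apply _ _

theorem dJ_apply (𝓢 : HamiltonianSystem EG G EP P) (p : P) (v : TangentSpace 𝓘(ℝ, EP) p)
    (η : GroupLieAlgebra 𝓘(ℝ, EG) G) : 𝓢.dJ p v η = 𝓢.symp.bilin p (infGen p η) v :=
  𝓢.momentum p η v

theorem infGen_injective {𝓢 : HamiltonianSystem EG G EP P} {p : P} (hreg : 𝓢.IsRegular p) :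
    Function.Injective (infGen p : GroupLieAlgebra 𝓘(ℝ, EG) G →ₗ[ℝ] TangentSpace 𝓘(ℝ, EP) p) :=
  LinearMap.ker_eq_bot.1 (LinearMap.ker_eq_bot'.2 hreg)

/-- At a relative equilibrium the Hamiltonian vector field is the infinitesimal generator. -/
theorem IsRelativeEquilibrium.infGen_eq {𝓢 : HamiltonianSystem EG G EP P} {p : P}
    {ξ : GroupLieAlgebra 𝓘(ℝ, EG) G} (hp : 𝓢.IsRelativeEquilibrium p ξ) :
    infGen p ξ = 𝓢.symp.hamiltonianVF 𝓢.H p := by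
  obtain ⟨c, hc, hint⟩ := hp
  have h1 := hc.integralCurve 0
  have h2 := hint 0
  have h3 : MDifferentiableAt 𝓘(ℝ, EG) 𝓘(ℝ, EP) (fun g : G => g • p) (c 0) :=
    (𝓢.contMDiff_smul_point p).mdifferentiable (by simp) _
  have h4 := h3.hasMFDerivAt.comp (0 : ℝ) h1
  have h5 := hasMFDerivAt_unique h4 h2
  have h6 := congrArg (fun l : ℝ →L[ℝ] EP => l 1) h5
  -- `c 0 = 1` and `1 • p = p` hold only propositionally
  have h7 : ∀ g : G, g = 1 →
      (mfderiv 𝓘(ℝ, EG) 𝓘(ℝ, EP) (fun g : G => g • p) g : EG →L[ℝ] EP)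
        (mulInvariantVectorField ξ g : EG) =
      (𝓢.symp.hamiltonianVF 𝓢.H (g • p) : EP) → infGen p ξ = 𝓢.symp.hamiltonianVF 𝓢.H p := by
    rintro _ rfl h
    rw [mulInvariantVectorField_one] at h
    have e2 : ∀ q : P, q = p → (mfderiv 𝓘(ℝ, EG) 𝓘(ℝ, EP) (fun g : G => g • p) 1 : EG →L[ℝ] EP) ξ =
      (𝓢.symp.hamiltonianVF 𝓢.H q : EP) → infGen p ξ = 𝓢.symp.hamiltonianVF 𝓢.H p := by
      rintro _ rfl h
      exact h
    exact e2 _ (one_smul _ _) h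
  exact h7 _ hc.map_zero ((congrArg (mfderiv 𝓘(ℝ, EG) 𝓘(ℝ, EP) (fun g : G => g • p) (c 0) :
    EG →L[ℝ] EP)
    (one_smul ℝ (mulInvariantVectorField ξ (c 0) : EG))).symm.trans (h6.trans
      (one_smul ℝ (𝓢.symp.hamiltonianVF 𝓢.H (c 0 • p) : EP))))

section
variable {𝓢 : HamiltonianSystem EG G EP P} {p : P} {ξ : GroupLieAlgebra 𝓘(ℝ, EG) G}

/-- A relative equilibrium is a critical point of the augmented Hamiltonian. -/
theorem IsRelativeEquilibrium.dFun_augmented (hp : 𝓢.IsRelativeEquilibrium p ξ) :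
    dFun (E := EP) (𝓢.augmented ξ) p = 0 := by
  refine LinearMap.ext fun v => ?_
  have h1 : dFun (𝓢.augmented ξ) p v = dFun 𝓢.H p v - dFun (fun q => 𝓢.J q ξ) p v := by
    have e1 := (𝓢.smooth_hamiltonian.mdifferentiable (by simp) p).hasMFDerivAt
    have e2 := ((𝓢.smooth_momentum ξ).mdifferentiable (by simp) p).hasMFDerivAt
    have := (e1.sub e2).mfderiv
    exact congrArg (fun l : EP →L[ℝ] ℝ => l v) this
  rw [h1, 𝓢.momentum, hp.infGen_eq, bilin_hamiltonianVF, sub_self]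
  rfl

/-- The generator lies in `𝔤_μ`, since `⟨dJ(p) ξp, η⟩ = -dH(p) ηp = 0`. -/
theorem IsRelativeEquilibrium.mem_gmu (hp : 𝓢.IsRelativeEquilibrium p ξ) : ξ ∈ 𝓢.gmu p :=
    fun η => by
  have h1 : 𝓢.dJ p (infGen p ξ) η = 0 := by
    rw [dJ_apply, ← (𝓢.symp.bilin_isAlt p).neg_eq, hp.infGen_eq, bilin_hamiltonianVF,
      𝓢.dFun_infGen_eq_zero p 𝓢.smooth_hamiltonian 𝓢.invariant, neg_zero]
  rw [dJ_infGen] at h1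
  linarith

theorem IsRelativeEquilibrium.bilin_lin (hp : 𝓢.IsRelativeEquilibrium p ξ) (v w :
    TangentSpace 𝓘(ℝ, EP) p) :
    𝓢.symp.bilin p (𝓢.lin p ξ v) w = hessian (𝓢.augmented ξ) p v w :=
  bilin_linearization 𝓢.symp p (𝓢.contMDiff_augmented ξ) hp.dFun_augmented v w

theorem IsRelativeEquilibrium.bilin_lin_skew (hp : 𝓢.IsRelativeEquilibrium p ξ) (v w :
    TangentSpace 𝓘(ℝ, EP) p) :
    𝓢.symp.bilin p (𝓢.lin p ξ v) w = -𝓢.symp.bilin p v (𝓢.lin p ξ w) := by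
  rw [hp.bilin_lin, (𝓢.symp.bilin_isAlt p).neg_eq, hp.bilin_lin]
  exact hessian_symm (𝓢.contMDiff_augmented ξ) p v w

/-- `dX_{H_ξ}(p) ζp = -(ad_ξ ζ) p`. -/
theorem IsRelativeEquilibrium.lin_infGen (hp : 𝓢.IsRelativeEquilibrium p ξ) (ζ :
    GroupLieAlgebra 𝓘(ℝ, EG) G) :
    𝓢.lin p ξ (infGen p ζ) = -infGen p (ad ξ ζ) := by
  rw [← sub_eq_zero]
  refine 𝓢.symp.nondegenerate p _ fun w => ?_
  rw [← SymplecticForm.bilin_apply]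
  rw [map_sub, LinearMap.sub_apply, hp.bilin_lin, 𝓢.hessian_infGen p ξ hp.dFun_augmented, dJ_apply,
    sub_eq_zero]
  rw [← map_neg]
  congr 3
  exact (lie_skew ζ ξ).symm

/-- `dJ(p)` intertwines `dX_{H_ξ}(p)` with the transpose of `ad_ξ`. -/
theorem IsRelativeEquilibrium.dJ_lin (hp : 𝓢.IsRelativeEquilibrium p ξ) (v : TangentSpace 𝓘(ℝ, EP)
    p)
    (η : GroupLieAlgebra 𝓘(ℝ, EG) G) : 𝓢.dJ p (𝓢.lin p ξ v) η = 𝓢.dJ p v (ad ξ η) := by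
  rw [dJ_apply, dJ_apply, ← neg_eq_iff_eq_neg.2 (hp.bilin_lin_skew _ _), hp.lin_infGen]
  simp

theorem IsRelativeEquilibrium.ad_mem_gmu (hp : 𝓢.IsRelativeEquilibrium p ξ) {η :
    GroupLieAlgebra 𝓘(ℝ, EG) G}
    (hη : η ∈ 𝓢.gmu p) : ad ξ η ∈ 𝓢.gmu p := fun ζ => by
  change 𝓢.J p ⁅⁅ξ, η⁆, ζ⁆ = 0
  rw [lie_lie, map_sub, hp.mem_gmu, hη, sub_self]

theorem IsRelativeEquilibrium.adMu_apply (hp : 𝓢.IsRelativeEquilibrium p ξ) (η : 𝓢.gmu p) :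
    (𝓢.adMu p ξ η : GroupLieAlgebra 𝓘(ℝ, EG) G) = ad ξ η.1 := by
  rw [adMu, restrictEnd, dif_pos fun v hv => hp.ad_mem_gmu hv]
  rfl

/-- The one-parameter subgroup of `ξ ∈ 𝔤_μ` lies in `G_μ`. -/
theorem J_Ad_oneParameter (hξ : ξ ∈ 𝓢.gmu p) {c : ℝ → G} (hc : IsOneParameterSubgroup c ξ) (t : ℝ)
    (η : GroupLieAlgebra 𝓘(ℝ, EG) G) : 𝓢.J p (Ad (c t) η) = 𝓢.J p η := by
  have h1 : ∀ s, HasDerivAt (fun s => 𝓢.J p (Ad (c s) η)) 0 s := fun s => by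
    have h2 : HasDerivAt (fun r => 𝓢.J p (Ad (c r) (Ad (c s) η))) 0 0 := by
      have := hc.hasWeakDerivAt_Ad 0 (Ad (c s) η) (𝓢.J p)
      rw [hc.map_zero, Ad_one, Module.End.one_apply, hξ] at this
      exact this
    have h3 : (fun s => 𝓢.J p (Ad (c s) η)) = (fun r => 𝓢.J p (Ad (c r) (Ad (c s) η))) ∘ fun x =>
      x - s := by
      ext x
      simp only [Function.comp]
      rw [← Module.End.mul_apply, ← Ad_mul, ← hc.map_add, sub_add_cancel]
    rw [h3]
    have h4 := HasDerivAt.comp (h₂ := fun r => 𝓢.J p (Ad (c r) (Ad (c s) η))) (h₂' := 0) (h :=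
      fun x => x - s) s (by rw [sub_self]; exact h2) ((hasDerivAt_id s).sub_const s)
    simpa using h4
  have := eq_of_hasDerivAt_zero h1 t 0
  rwa [hc.map_zero, Ad_one, Module.End.one_apply] at this

theorem J_Ad_of_mem_toralClosure (hξ : ξ ∈ 𝓢.gmu p) {g : G} (hg : g ∈ toralClosure ξ)
    (η : GroupLieAlgebra 𝓘(ℝ, EG) G) : 𝓢.J p (Ad g η) = 𝓢.J p η := by
  have h1 : IsClosed {g : G | 𝓢.J p (Ad g η) = 𝓢.J p η} := isClosed_eq (continuous_Ad _ _)
    continuous_const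
  refine closure_minimal (fun g hg => ?_) h1 hg
  obtain ⟨c, t, hc, rfl⟩ := hg
  exact J_Ad_oneParameter hξ hc t η

theorem Ad_mem_gmu {g : G} (hg : ∀ η : GroupLieAlgebra 𝓘(ℝ, EG) G, 𝓢.J p (Ad g η) = 𝓢.J p η) {η :
    GroupLieAlgebra 𝓘(ℝ, EG) G}
    (hη : η ∈ 𝓢.gmu p) : Ad g η ∈ 𝓢.gmu p := fun ζ => by
  rw [← Ad_Ad_inv g ζ, ← Ad_lie, hg, hη]

theorem J_Ad_inv {g : G} (hg : ∀ η : GroupLieAlgebra 𝓘(ℝ, EG) G, 𝓢.J p (Ad g η) = 𝓢.J p η) (η :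
    GroupLieAlgebra 𝓘(ℝ, EG) G) :
    𝓢.J p (Ad g⁻¹ η) = 𝓢.J p η := by
  rw [← hg, Ad_Ad_inv]

theorem coAdMu_apply {g : G} (hg : ∀ η : GroupLieAlgebra 𝓘(ℝ, EG) G, 𝓢.J p (Ad g η) = 𝓢.J p η) (ν :
    Dual ℝ (𝓢.gmu p)) (η : 𝓢.gmu p) :
    𝓢.coAdMu p g ν η = ν ⟨Ad g⁻¹ η, Ad_mem_gmu (J_Ad_inv hg) η.2⟩ := by
  rw [coAdMu, restrictEnd, dif_pos fun v hv => Ad_mem_gmu (J_Ad_inv hg) hv]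
  rfl
end
end
end HamiltonianSystem

/-! ### Complexification and the spectral splitting of a resonant pair -/

section Complexification
variable {V : Type*} [AddCommGroup V] [Module ℝ V]

/-- The real part of a vector of the complexification. -/
def reVec : ℂ ⊗[ℝ] V →ₗ[ℝ] V :=
    (TensorProduct.lid ℝ V).toLinearMap ∘ₗ LinearMap.rTensor V Complex.reLm

/-- The imaginary part of a vector of the complexification. -/
def imVec : ℂ ⊗[ℝ] V →ₗ[ℝ] V :=
    (TensorProduct.lid ℝ V).toLinearMap ∘ₗ LinearMap.rTensor V Complex.imLm

@[simp] theorem reVec_tmul (z : ℂ) (v : V) : reVec (z ⊗ₜ[ℝ] v) = z.re • v := by simp [reVec]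

@[simp] theorem imVec_tmul (z : ℂ) (v : V) : imVec (z ⊗ₜ[ℝ] v) = z.im • v := by simp [imVec]

theorem reVec_baseChange (T : Module.End ℝ V) (w : ℂ ⊗[ℝ] V) : reVec (T.baseChange ℂ w) = T
    (reVec w) := by
  induction w with
  | zero => simp
  | tmul z v => simp
  | add a b ha hb => simp [ha, hb]

theorem one_tmul_injective {v : V} (h : (1 : ℂ) ⊗ₜ[ℝ] v = 0) : v = 0 := by
  have := congrArg reVec h
  simpa using this

/-- The real operator `(T - z) (T - z̄)`. -/
def realQuad (T : Module.End ℝ V) (z : ℂ) : Module.End ℝ V :=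
  T * T - (2 * z.re) • T + Complex.normSq z • 1

theorem realQuad_apply (T : Module.End ℝ V) (z : ℂ) (v : V) :
    realQuad T z v = T (T v) - (2 * z.re) • T v + Complex.normSq z • v := by
  simp [realQuad]

theorem realQuad_I_mul (T : Module.End ℝ V) (lam : ℝ) (v : V) :
    realQuad T (Complex.I * lam) v = T (T v) + lam ^ 2 • v := by
  simp [realQuad, sq]

theorem realQuad_comm (T : Module.End ℝ V) (z : ℂ) : Commute (realQuad T z) T := by
  unfold realQuad
  refine Commute.add_left (Commute.sub_left ?_ ?_) ?_
  · exact (Commute.refl T).mul_left (Commute.refl T)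
  · exact (Commute.refl T).smul_left _
  · exact (Commute.one_left T).smul_left _

/-- The factorization of `realQuad T z` in the complexification. -/
theorem baseChange_realQuad (T : Module.End ℝ V) (z : ℂ) (w : ℂ ⊗[ℝ] V) :
    (realQuad T z).baseChange ℂ w =
      T.baseChange ℂ (T.baseChange ℂ w - (starRingEnd ℂ) z • w) - z • (T.baseChange ℂ w -
        (starRingEnd ℂ) z • w) := by
  have h1 : (realQuad T z).baseChange ℂ w =
      T.baseChange ℂ (T.baseChange ℂ w) - (2 * z.re) • T.baseChange ℂ w + Complex.normSq z • w := by
    simp [realQuad, LinearMap.baseChange_add, LinearMap.baseChange_sub, LinearMap.baseChange_mul,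
      LinearMap.baseChange_smul]
  have h2 (r : ℝ) (u : ℂ ⊗[ℝ] V) : r • u = (r : ℂ) • u := (Complex.coe_smul r u).symm
  have h3 : ((2 * z.re : ℝ) : ℂ) = z + (starRingEnd ℂ) z := by rw [Complex.add_conj]
  rw [h1, h2, h2, h3, ← Complex.mul_conj, map_sub, map_smul]
  module

theorem realQuad_conj (T : Module.End ℝ V) (z : ℂ) : realQuad T ((starRingEnd ℂ) z) =
    realQuad T z := by
  simp [realQuad]

variable [FiniteDimensional ℝ V]

theorem injective_of_baseChange {F : Module.End ℝ V} (hF : LinearMap.ker F = ⊥) {w : ℂ ⊗[ℝ] V}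
    (h : F.baseChange ℂ w = 0) : w = 0 := by
  obtain ⟨F', hF'⟩ := F.exists_leftInverse_of_injective hF
  have h1 : (F' * F : Module.End ℝ V) = 1 := hF'
  have h2 : F'.baseChange ℂ (F.baseChange ℂ w) = w := by
    rw [← Module.End.mul_apply, ← LinearMap.baseChange_mul, h1, LinearMap.baseChange_one,
      Module.End.one_apply]
  rw [← h2, h, map_zero]

/-- `z` is an eigenvalue of `T` in the complexification exactly if the real operator `(T - z) (T -
z̄)` is not injective. -/
theorem mem_complexSpectrum_iff (T : Module.End ℝ V) (z : ℂ) :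
    z ∈ complexSpectrum T ↔ ∃ v, v ≠ 0 ∧ realQuad T z v = 0 := by
  rw [complexSpectrum, ← Module.End.hasEigenvalue_iff_mem_spectrum]
  constructor
  · intro h
    obtain ⟨w, hw⟩ := h.exists_hasEigenvector
    by_contra! hn
    refine hw.2 (injective_of_baseChange (F := realQuad T z) (LinearMap.ker_eq_bot'.2 fun v hv =>
      ?_) ?_)
    · by_contra hv0
      exact hn v hv0 hv
    · rw [← realQuad_conj, baseChange_realQuad, Complex.conj_conj, hw.apply_eq_smul]
      simp
  · rintro ⟨v, hv, h⟩
    have h1 := baseChange_realQuad T z (1 ⊗ₜ[ℝ] v)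
    rw [LinearMap.baseChange_tmul, h, TensorProduct.tmul_zero] at h1
    set w := T.baseChange ℂ (1 ⊗ₜ[ℝ] v) - (starRingEnd ℂ) z • ((1 : ℂ) ⊗ₜ[ℝ] v) with hw
    -- Either `(T - z̄) v` is an eigenvector for `z`, or it vanishes; then `z` is real, and `v` is
    -- one.
    by_cases hw0 : w = 0
    · have h2 : z.im • v = 0 := by
        have := congrArg imVec hw0
        rw [hw, LinearMap.baseChange_tmul, TensorProduct.smul_tmul', map_sub, imVec_tmul,
          imVec_tmul] at this
        simpa using this
      have h3 : z.im = 0 := by simpa [hv] using h2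
      have h4 : (starRingEnd ℂ) z = z := Complex.conj_eq_iff_im.2 h3
      rw [h4] at hw
      refine Module.End.hasEigenvalue_of_hasEigenvector (x := (1 : ℂ) ⊗ₜ[ℝ] v) ⟨?_, fun h => hv
        (one_tmul_injective h)⟩
      rw [Module.End.mem_eigenspace_iff, ← sub_eq_zero, ← hw, hw0]
    · refine Module.End.hasEigenvalue_of_hasEigenvector (x := w) ⟨?_, hw0⟩
      rw [Module.End.mem_eigenspace_iff, ← sub_eq_zero, ← h1]

end Complexification

section Resonant
variable {V : Type*} [AddCommGroup V] [Module ℝ V] [FiniteDimensional ℝ V]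

/-- At an eigenvalue of algebraic multiplicity one the generalized eigenspace consists of
eigenvectors. -/
theorem eigen_of_multiplicity_one {T : Module.End ℝ V} {z : ℂ} (h : eigenMultiplicity T z = 1) {w :
    ℂ ⊗[ℝ] V}
    (hw : w ∈ Module.End.maxGenEigenspace (T.baseChange ℂ : Module.End ℂ (ℂ ⊗[ℝ] V)) z) :
    T.baseChange ℂ w = z • w := by
  set Tc : Module.End ℂ (ℂ ⊗[ℝ] V) := T.baseChange ℂ
  have h1 : Module.End.eigenspace Tc z = Module.End.maxGenEigenspace Tc z := by
    refine Submodule.eq_of_le_of_finrank_le Module.End.eigenspace_le_maxGenEigenspace ?_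
    change eigenMultiplicity T z ≤ _
    rw [h]
    rw [Nat.one_le_iff_ne_zero, Ne, Submodule.finrank_eq_zero]
    intro h0
    have h2 : Module.End.maxGenEigenspace Tc z = ⊥ := by
      by_contra hne
      have h4 : Module.End.HasUnifEigenvalue Tc z ⊤ := hne
      have h5 : Module.End.HasUnifEigenvalue Tc z 1 := h4.lt zero_lt_one
      exact h5 h0
    have h3 : eigenMultiplicity T z = 0 := by
      change finrank ℂ (Module.End.maxGenEigenspace Tc z) = 0
      rw [h2, finrank_bot]
    omega
  rw [← h1] at hw
  exact Module.End.mem_eigenspace_iff.1 hw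

variable (T : Module.End ℝ V) {lam : ℝ}

theorem isCompl_iSup_maxGenEigenspace (Tc : Module.End ℂ (ℂ ⊗[ℝ] V)) (s : Set ℂ) :
    IsCompl (⨆ z ∈ s, Module.End.maxGenEigenspace Tc z)
      (⨆ z ∈ sᶜ, Module.End.maxGenEigenspace Tc z) := by
  have h1 : iSupIndep (Module.End.maxGenEigenspace Tc) := Module.End.independent_maxGenEigenspace Tc
  refine ⟨h1.disjoint_biSup_biSup disjoint_compl_right, ?_⟩
  rw [codisjoint_iff, ← iSup_union, union_compl_self, iSup_univ]
  exact Module.End.iSup_maxGenEigenspace_eq_top Tc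

theorem conj_I_mul (lam : ℝ) : (starRingEnd ℂ) (Complex.I * lam) = -(Complex.I * lam) := by simp

/-- In the complexification the sum of the resonant eigenspaces and its spectral complement are the
kernel and the range of `T² + λ²`. -/
theorem iSup_resonant (hm : ∀ z ∈ resonantPair lam, eigenMultiplicity T z = 1) :
    (⨆ z ∈ resonantPair lam, Module.End.maxGenEigenspace (T.baseChange ℂ : Module.End ℂ (ℂ ⊗[ℝ] V))
      z) =
      LinearMap.ker ((realQuad T (Complex.I * lam)).baseChange ℂ) ∧
    (⨆ z ∈ (resonantPair lam)ᶜ, Module.End.maxGenEigenspace (T.baseChange ℂ : Module.End ℂ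
      (ℂ ⊗[ℝ] V)) z) =
      LinearMap.range ((realQuad T (Complex.I * lam)).baseChange ℂ) := by
  set Tc : Module.End ℂ (ℂ ⊗[ℝ] V) := T.baseChange ℂ with hTc
  set Q : Module.End ℂ (ℂ ⊗[ℝ] V) := (realQuad T (Complex.I * lam)).baseChange ℂ with hQ
  have hc := isCompl_iSup_maxGenEigenspace Tc (resonantPair lam)
  have hcomm : Commute Tc Q := by
    have := (realQuad_comm T (Complex.I * lam)).eq
    change Tc * Q = Q * Tc
    rw [hTc, hQ, ← LinearMap.baseChange_mul, ← LinearMap.baseChange_mul, this]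
  have h1 : (⨆ z ∈ resonantPair lam, Module.End.maxGenEigenspace Tc z) ≤ LinearMap.ker Q := by
    refine iSup₂_le fun z hz w hw => ?_
    have hw' := eigen_of_multiplicity_one (hm z hz) hw
    rw [LinearMap.mem_ker, hQ]
    rcases hz with rfl | rfl
    · rw [← realQuad_conj, baseChange_realQuad, Complex.conj_conj, hw']
      simp
    · rw [baseChange_realQuad, conj_I_mul, hw']
      simp
  -- `T² + λ²` is injective on the generalized eigenspaces of the other eigenvalues
  have hinj : ∀ z ∉ resonantPair lam, ∀ w ∈ Module.End.maxGenEigenspace Tc z, Q w = 0 → w = 0 := by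
    intro z hz w hw h0
    have hd (z' : ℂ) (hz' : z' ≠ z) (u : ℂ ⊗[ℝ] V) (hu : u ∈ Module.End.maxGenEigenspace Tc z)
      (hu' : Tc u - z' • u = 0) : u = 0 := by
      have h2 : u ∈ Module.End.maxGenEigenspace Tc z' :=
        Module.End.eigenspace_le_maxGenEigenspace (Module.End.mem_eigenspace_iff.2
          (sub_eq_zero.1 hu'))
      have := (Module.End.disjoint_genEigenspace Tc hz' ⊤ ⊤).le_bot ⟨h2, hu⟩
      simpa using this
    rw [hQ, baseChange_realQuad] at h0
    have h3 : Tc w ∈ Module.End.maxGenEigenspace Tc z := Module.End.mapsTo_maxGenEigenspace_of_comm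
      (Commute.refl Tc) z hw
    refine hd _ (fun h => hz (h ▸ ?_)) w hw (hd _ (fun h => hz (h ▸ ?_)) _ (sub_mem h3
      (Submodule.smul_mem _ _ hw)) h0)
    · rw [conj_I_mul]; exact Or.inr rfl
    · exact Or.inl rfl
  have h2 : (⨆ z ∈ (resonantPair lam)ᶜ, Module.End.maxGenEigenspace Tc z) ≤ LinearMap.range Q := by
    refine iSup₂_le fun z hz w hw => ?_
    have hmap : ∀ w ∈ Module.End.maxGenEigenspace Tc z, Q w ∈ Module.End.maxGenEigenspace Tc z :=
      Module.End.mapsTo_maxGenEigenspace_of_comm hcomm z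
    have hs : Function.Surjective (Q.restrict hmap) := by
      refine LinearMap.surjective_of_injective (LinearMap.ker_eq_bot.1
        (LinearMap.ker_eq_bot'.2 fun u hu => ?_))
      exact Subtype.ext (hinj z hz u.1 u.2 (congrArg Subtype.val hu))
    obtain ⟨u, hu⟩ := hs ⟨w, hw⟩
    exact ⟨u.1, congrArg Subtype.val hu⟩
  -- Both inclusions are equalities, since the dimensions add up to that of the whole space on
  -- either side.
  have hf1 := Submodule.finrank_mono h1
  have hf2 := Submodule.finrank_mono h2
  have hf3 := Submodule.finrank_add_eq_of_isCompl hc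
  have hf4 := LinearMap.finrank_range_add_finrank_ker Q
  exact ⟨Submodule.eq_of_le_of_finrank_le h1
    (by omega), Submodule.eq_of_le_of_finrank_le h2 (by omega)⟩

theorem spectralSubspace_resonant (hm : ∀ z ∈ resonantPair lam, eigenMultiplicity T z = 1) :
    spectralSubspace T (resonantPair lam) = LinearMap.ker (realQuad T (Complex.I * lam)) := by
  ext v
  rw [spectralSubspace, (iSup_resonant T hm).1]
  change (realQuad T (Complex.I * lam)).baseChange ℂ (1 ⊗ₜ[ℝ] v) = 0 ↔ _
  rw [LinearMap.baseChange_tmul, LinearMap.mem_ker]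
  exact ⟨one_tmul_injective, fun h => by rw [h, TensorProduct.tmul_zero]⟩

theorem spectralSubspace_nonresonant (hm : ∀ z ∈ resonantPair lam, eigenMultiplicity T z = 1) :
    spectralSubspace T (resonantPair lam)ᶜ = LinearMap.range (realQuad T (Complex.I * lam)) := by
  ext v
  rw [spectralSubspace, (iSup_resonant T hm).2]
  change (∃ w, (realQuad T (Complex.I * lam)).baseChange ℂ w = 1 ⊗ₜ[ℝ] v) ↔ _
  constructor
  · rintro ⟨w, hw⟩
    have := congrArg reVec hw
    rw [reVec_baseChange, reVec_tmul, Complex.one_re, one_smul] at this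
    exact ⟨_, this⟩
  · rintro ⟨u, rfl⟩
    exact ⟨1 ⊗ₜ[ℝ] u, by rw [LinearMap.baseChange_tmul]⟩

theorem isCompl_range_ker_realQuad (hm : ∀ z ∈ resonantPair lam, eigenMultiplicity T z = 1) :
    IsCompl (LinearMap.range (realQuad T (Complex.I * lam))) (LinearMap.ker (realQuad T
      (Complex.I * lam))) := by
  set Q := realQuad T (Complex.I * lam)
  have hd : Disjoint (LinearMap.range Q) (LinearMap.ker Q) := by
    rw [Submodule.disjoint_def]
    rintro _ ⟨u, rfl⟩ h0
    have h1 : (1 : ℂ) ⊗ₜ[ℝ] Q u ∈ LinearMap.ker (Q.baseChange ℂ) := by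
      rw [LinearMap.mem_ker, LinearMap.baseChange_tmul, LinearMap.mem_ker.1 h0,
        TensorProduct.tmul_zero]
    have h2 : (1 : ℂ) ⊗ₜ[ℝ] Q u ∈ LinearMap.range (Q.baseChange ℂ) :=
      ⟨1 ⊗ₜ[ℝ] u, by rw [LinearMap.baseChange_tmul]⟩
    rw [← (iSup_resonant T hm).1] at h1
    rw [← (iSup_resonant T hm).2] at h2
    have h3 := (isCompl_iSup_maxGenEigenspace (T.baseChange ℂ) (resonantPair lam)).disjoint.le_bot
      ⟨h1, h2⟩
    exact one_tmul_injective (by simpa using h3)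
  refine ⟨hd, ?_⟩
  rw [codisjoint_iff]
  refine Submodule.eq_top_of_disjoint _ _ ?_ hd
  exact (LinearMap.finrank_range_add_finrank_ker Q).ge

/-- The resonant subspace of `T` is not zero. -/
theorem exists_ne_zero_mem_ker_realQuad (hm : ∀ z ∈ resonantPair lam, eigenMultiplicity T z = 1) :
    ∃ v, v ≠ 0 ∧ T (T v) = -lam ^ 2 • v := by
  have h1 : Complex.I * lam ∈ complexSpectrum T := by
    rw [complexSpectrum, ← Module.End.hasEigenvalue_iff_mem_spectrum]
    have h2 := hm (Complex.I * lam) (Or.inl rfl)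
    have h3 : Module.End.maxGenEigenspace (T.baseChange ℂ : Module.End ℂ (ℂ ⊗[ℝ] V))
      (Complex.I * lam) ≠ ⊥ := by
      intro h0
      rw [eigenMultiplicity, h0, finrank_bot] at h2
      omega
    have h4 : Module.End.HasUnifEigenvalue (T.baseChange ℂ : Module.End ℂ (ℂ ⊗[ℝ] V))
      (Complex.I * lam) ⊤ := h3
    exact h4.lt zero_lt_one
  obtain ⟨v, hv, h⟩ := (mem_complexSpectrum_iff T _).1 h1
  rw [realQuad_I_mul] at h
  exact ⟨v, hv, by rw [eq_neg_of_add_eq_zero_left h, neg_smul]⟩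

/-- The real resonant subspace is at most two-dimensional: `v ↦ (T + iλ) v` embeds it into the
complex eigenline of `iλ`. -/
theorem finrank_ker_realQuad_le (hl : 0 < lam) (hm : ∀ z ∈ resonantPair lam, eigenMultiplicity T z =
    1) :
    finrank ℝ (LinearMap.ker (realQuad T (Complex.I * lam))) ≤ 2 := by
  let X := Module.End.maxGenEigenspace (T.baseChange ℂ : Module.End ℂ (ℂ ⊗[ℝ] V)) (Complex.I * lam)
  have h1 : finrank ℝ X = 2 := by
    have := finrank_mul_finrank ℝ ℂ X
    rw [Complex.finrank_real_complex] at this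
    have h2 : finrank ℂ X = 1 := hm _ (Or.inl rfl)
    rw [h2] at this
    omega
  let F : V →ₗ[ℝ] ℂ ⊗[ℝ] V := TensorProduct.mk ℝ ℂ V 1 ∘ₗ T + TensorProduct.mk ℝ ℂ V
    (Complex.I * lam)
  have hF (v : V) : F v = T.baseChange ℂ (1 ⊗ₜ[ℝ] v) - (starRingEnd ℂ) (Complex.I * lam) •
    ((1 : ℂ) ⊗ₜ[ℝ] v) := by
    rw [conj_I_mul, neg_smul, sub_neg_eq_add, TensorProduct.smul_tmul', smul_eq_mul, mul_one,
      LinearMap.baseChange_tmul]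
    rfl
  have hmem (v : LinearMap.ker (realQuad T (Complex.I * lam))) : F v ∈ X.restrictScalars ℝ := by
    have h2 := baseChange_realQuad T (Complex.I * lam) (1 ⊗ₜ[ℝ] (v : V))
    rw [LinearMap.baseChange_tmul, LinearMap.mem_ker.1 v.2, TensorProduct.tmul_zero, ← hF] at h2
    exact Module.End.eigenspace_le_maxGenEigenspace (Module.End.mem_eigenspace_iff.2
      (sub_eq_zero.1 h2.symm))
  let F' := (F ∘ₗ Submodule.subtype _).codRestrict (X.restrictScalars ℝ) hmem
  have hinj : Function.Injective F' := by
    refine LinearMap.ker_eq_bot.1 (LinearMap.ker_eq_bot'.2 fun v hv => Subtype.ext ?_)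
    have h2 : F v = 0 := congrArg Subtype.val hv
    have h3 := congrArg imVec h2
    simpa [F, hl.ne'] using h3
  have h4 := LinearMap.finrank_le_finrank_of_injective hinj
  have h5 : finrank ℝ (X.restrictScalars ℝ) = finrank ℝ X := rfl
  omega

end Resonant

/-! ### Jordan decompositions and skew operators -/

section JordanDecomposition
open Polynomial
variable {V W : Type*} [AddCommGroup V] [Module ℝ V] [AddCommGroup W] [Module ℝ W]

/-- An intertwining relation passes to polynomials in the operators. -/
theorem aeval_intertwine {A : Module.End ℝ V} {D : Module.End ℝ W} {T : V →ₗ[ℝ] W}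
    (h : ∀ v, T (A v) = D (T v)) (p : ℝ[X]) (v : V) : T (aeval A p v) = aeval D p (T v) := by
  induction p using Polynomial.induction_on' generalizing v with
  | add p q hp hq => simp [hp, hq]
  | monomial n a =>
    have h1 (v : V) : T ((A ^ n) v) = (D ^ n) (T v) := by
      induction n generalizing v with
      | zero => simp
      | succ n ih => rw [pow_succ, pow_succ, Module.End.mul_apply, Module.End.mul_apply, ih, h]
    simp [aeval_monomial, h1]

theorem IsJordanDecomposition.unique [FiniteDimensional ℝ V] {A S N S' N' : Module.End ℝ V} (h :
    IsJordanDecomposition A S N)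
    (h' : IsJordanDecomposition A S' N') : N = N' :=
  (Module.End.isNilpotent_isSemisimple_unique h.nilpotent h.semisimple h'.nilpotent h'.semisimple
    h.commute.symm h'.commute.symm (by rw [add_comm, ← h.sum_eq, add_comm N', ← h'.sum_eq])).1

/-- The nilpotent part of an operator is a polynomial in the operator. -/
theorem IsJordanDecomposition.exists_aeval [FiniteDimensional ℝ V] {A S N : Module.End ℝ V} (h :
    IsJordanDecomposition A S N) :
    ∃ p : ℝ[X], N = aeval A p := by
  obtain ⟨n, hn, s, hs, hn', hs', hA⟩ := A.exists_isNilpotent_isSemisimple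
  rw [Algebra.adjoin_singleton_eq_range_aeval] at hn hs
  obtain ⟨p, rfl⟩ := hn
  obtain ⟨q, rfl⟩ := hs
  exact ⟨p, h.unique ⟨by rw [add_comm]; exact hA, (Commute.all q p).map (aeval A), hs', hn'⟩⟩

theorem bilin_aeval_of_skew {b : LinearMap.BilinForm ℝ V} {A : Module.End ℝ V} (hA : ∀ v w, b (A v)
    w = -b v (A w))
    (p : ℝ[X]) (v w : V) : b (aeval A p v) w = b v (aeval (-A) p w) := by
  induction p using Polynomial.induction_on' generalizing v w with
  | add p q hp hq => simp [hp, hq]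
  | monomial n a =>
    have h1 (v w : V) : b ((A ^ n) v) w = b v (((-A) ^ n) w) := by
      induction n generalizing v w with
      | zero => simp
      | succ n ih =>
        rw [pow_succ, pow_succ', Module.End.mul_apply, Module.End.mul_apply, ih, hA,
          LinearMap.neg_apply, map_neg]
    simp [aeval_monomial, h1]

/-- The nilpotent part of an infinitesimally symplectic operator is infinitesimally symplectic. -/
theorem IsJordanDecomposition.skew [FiniteDimensional ℝ V] {b : LinearMap.BilinForm ℝ V} (hb :
    b.Nondegenerate)
    {A S N : Module.End ℝ V} (h : IsJordanDecomposition A S N) (hA : ∀ v w, b (A v) w = -b v (A w))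
      (v w : V) :
    b (N v) w = -b v (N w) := by
  obtain ⟨p, hp⟩ := h.exists_aeval
  -- `q(-A)` is the `b`-transpose of `q(A)`. Hence `p(-A)` is nilpotent and `(X - p)(-A)` is
  -- semisimple, and they are the parts `-N` and `-S` of `-A`.
  have hz : ∀ q : ℝ[X], aeval A q = 0 → aeval (-A) q = 0 := fun q hq => by
    refine LinearMap.ext fun w => hb.2 _ fun v => ?_
    rw [← bilin_aeval_of_skew hA, hq, LinearMap.zero_apply, map_zero, LinearMap.zero_apply]
  have hS : S = aeval A (X - p) := by rw [map_sub, aeval_X, ← hp, h.sum_eq, add_sub_cancel_right]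
  have hN : IsNilpotent (aeval (-A) p) := by
    obtain ⟨k, hk⟩ := h.nilpotent
    exact ⟨k, by rw [← map_pow]; exact hz _ (by rw [map_pow, ← hp, hk])⟩
  have hS' : (aeval (-A) (X - p)).IsSemisimple := by
    refine Module.End.isSemisimple_of_squarefree_aeval_eq_zero h.semisimple.minpoly_squarefree ?_
    rw [← aeval_comp]
    refine hz _ ?_
    rw [aeval_comp, ← hS, minpoly.aeval]
  have h1 : IsJordanDecomposition (-A) (aeval (-A) (X - p)) (aeval (-A) p) :=
    ⟨by simp, (Commute.all _ _).map (aeval (-A)), hS', hN⟩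
  have h2 : IsJordanDecomposition (-A) (-S) (-N) :=
    ⟨by rw [h.sum_eq, neg_add], h.commute.neg_left.neg_right, Module.End.isSemisimple_neg.2 h.semisimple, h.nilpotent.neg⟩
  rw [hp, bilin_aeval_of_skew hA, h1.unique h2, hp]
  simp

/-- A polynomial that is nilpotent on `A` vanishes on every semisimple quotient of `A`. -/
theorem aeval_eq_zero_of_surjective {A : Module.End ℝ V} {D : Module.End ℝ W} {T : V →ₗ[ℝ] W} (hT :
    Function.Surjective T)
    [FiniteDimensional ℝ W]
    (h : ∀ v, T (A v) = D (T v)) (hD : D.IsSemisimple) {p : ℝ[X]} (hp : IsNilpotent (aeval A p)) :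
      aeval D p = 0 := by
  refine Module.End.eq_zero_of_isNilpotent_isSemisimple ?_ (hD.aeval p)
  obtain ⟨k, hk⟩ := hp
  refine ⟨k, LinearMap.ext fun w => ?_⟩
  obtain ⟨v, rfl⟩ := hT w
  rw [← map_pow, ← aeval_intertwine h, map_pow, hk]
  simp

/-- A polynomial that is nilpotent on `D` vanishes on every semisimple suboperator of `D`. -/
theorem aeval_eq_zero_of_injective {A : Module.End ℝ V} {D : Module.End ℝ W} {T : V →ₗ[ℝ] W} (hT :
    Function.Injective T)
    [FiniteDimensional ℝ V]
    (h : ∀ v, T (A v) = D (T v)) (hA : A.IsSemisimple) {p : ℝ[X]} (hp : IsNilpotent (aeval D p)) :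
      aeval A p = 0 := by
  refine Module.End.eq_zero_of_isNilpotent_isSemisimple ?_ (hA.aeval p)
  obtain ⟨k, hk⟩ := hp
  refine ⟨k, LinearMap.ext fun v => hT ?_⟩
  rw [← map_pow, aeval_intertwine h, map_pow, hk]
  simp

end JordanDecomposition

section Skew
variable {V W : Type*} [AddCommGroup V] [Module ℝ V] [FiniteDimensional ℝ V] [AddCommGroup W]
  [Module ℝ W] [FiniteDimensional ℝ W]
  {b : LinearMap.BilinForm ℝ V} {D : Module.End ℝ V}

/-- An operator that is skew with respect to an inner product is semisimple: the orthogonal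
complement of an invariant subspace is invariant. -/
theorem isSemisimple_of_skew (hs : ∀ x y, b x y = b y x) (hpos : ∀ x, x ≠ 0 → 0 < b x x)
    (hD : ∀ x y, b (D x) y = -b x (D y)) : D.IsSemisimple := by
  rw [Module.End.isSemisimple_iff]
  intro p hp
  have hr : b.IsRefl := fun x y h => by rw [hs, h]
  refine ⟨b.orthogonal p, fun x hx y hy => ?_,
    (LinearMap.BilinForm.isCompl_orthogonal_iff_disjoint hr).2 ?_⟩
  · have := hx (D y) (hp hy)
    change b (D y) x = 0 at this
    change b y (D x) = 0
    rw [hD] at this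
    linarith
  · rw [Submodule.disjoint_def]
    intro x hx hx'
    by_contra h0
    exact (hpos x h0).ne' (hx' x hx)

/-- The spectrum of an operator that is skew with respect to an inner product is symmetric, since
its eigenvalues are purely imaginary. -/
theorem neg_mem_complexSpectrum_of_skew (hs : ∀ x y, b x y = b y x) (hpos : ∀ x, x ≠ 0 → 0 < b x x)
    (hD : ∀ x y, b (D x) y = -b x (D y)) {z : ℂ} (hz : -z ∈ complexSpectrum D) :
      z ∈ complexSpectrum D := by
  rw [mem_complexSpectrum_iff] at hz ⊢
  obtain ⟨v, hv, h⟩ := hz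
  refine ⟨v, hv, ?_⟩
  rw [realQuad_apply] at h ⊢
  have hsk (x : V) : b (D x) x = 0 := by
    have := hD x x
    rw [hs x] at this
    linarith
  -- The pairing of `(D - z)(D - z̄) v = 0` with `D v` leaves `Re z * b (D v) (D v) = 0`, and `z`
  -- and `-z` have the same quadratic factor if `Re z = 0`; if `D v = 0`, then `z = 0`.
  have h1 := congrArg (fun x => b x (D v)) h
  simp only [map_add, map_sub, map_smul, LinearMap.add_apply, LinearMap.sub_apply,
    LinearMap.smul_apply, hsk (D v), hs v, hsk v, smul_eq_mul,
    map_zero, LinearMap.zero_apply, mul_zero, add_zero, zero_sub, neg_eq_zero, mul_eq_zero] at h1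
  have h2 : D v = 0 ∨ z.re = 0 := by
    rcases h1 with h1 | h1
    · right; simpa using h1
    · left; by_contra h0; exact (hpos _ h0).ne' h1
  rcases h2 with h2 | h2 <;> simpa [h2] using h

/-- A linear map `F` with `F L = -D F` maps the generalized eigenspace of `L` for `z` into that of
`D` for `-z`; so it vanishes on the part of the spectrum of `L` that does not meet that of `-D`. -/
theorem eq_zero_of_intertwine_neg {L : Module.End ℝ W} {F : W →ₗ[ℝ] V} (hF : ∀ x, F (L x) = -D
    (F x)) {s : Set ℂ}
    (hsp : ∀ z ∉ s, z ∈ complexSpectrum L → -z ∉ complexSpectrum D) {x : W} (hx :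
      x ∈ spectralSubspace L sᶜ) : F x = 0 := by
  set Lc : Module.End ℂ (ℂ ⊗[ℝ] W) := L.baseChange ℂ with hLc
  set Dc : Module.End ℂ (ℂ ⊗[ℝ] V) := D.baseChange ℂ with hDc
  have hc (w : ℂ ⊗[ℝ] W) : F.baseChange ℂ (Lc w) = -Dc (F.baseChange ℂ w) := by
    have : F ∘ₗ L = (-D) ∘ₗ F := LinearMap.ext hF
    rw [hLc, hDc, ← LinearMap.comp_apply, ← LinearMap.baseChange_comp, this,
      LinearMap.baseChange_comp]
    simp
  have h1 : (⨆ z ∈ sᶜ, Module.End.maxGenEigenspace Lc z) ≤ LinearMap.ker (F.baseChange ℂ) := by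
    refine iSup₂_le fun z hz w hw => ?_
    rw [LinearMap.mem_ker]
    by_contra hne
    have hw0 : w ≠ 0 := by rintro rfl; simp at hne
    have e1 : z ∈ complexSpectrum L := by
      rw [complexSpectrum, ← Module.End.hasEigenvalue_iff_mem_spectrum]
      have h4 : Module.End.HasUnifEigenvalue Lc z ⊤ := fun h0 => hw0 (by
        have : w ∈ Module.End.genEigenspace Lc z ⊤ := hw
        rw [h0] at this
        simpa using this)
      exact h4.lt zero_lt_one
    refine hsp z hz e1 ?_
    rw [complexSpectrum, ← Module.End.hasEigenvalue_iff_mem_spectrum]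
    have hpow : ∀ (k : ℕ) (u : ℂ ⊗[ℝ] W), F.baseChange ℂ (((Lc - z • 1) ^ k) u) = (-1 : ℂ) ^ k •
      ((Dc - (-z) • 1) ^ k) (F.baseChange ℂ u) := by
      intro k
      induction k with
      | zero => simp
      | succ k ih =>
        intro u
        rw [pow_succ, Module.End.mul_apply, ih, pow_succ, pow_succ, Module.End.mul_apply]
        have : F.baseChange ℂ ((Lc - z • 1) u) = -((Dc - (-z) • 1) (F.baseChange ℂ u)) := by
          simp [hc]
          abel
        rw [this, map_neg]
        simp
        abel
    obtain ⟨k, hk⟩ := (Module.End.mem_maxGenEigenspace _ _ _).1 hw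
    have h2 := hpow k w
    rw [hk, map_zero] at h2
    have h3 : F.baseChange ℂ w ∈ Module.End.maxGenEigenspace Dc (-z) := by
      refine (Module.End.mem_maxGenEigenspace _ _ _).2 ⟨k, ?_⟩
      simpa using h2.symm
    have h4 : Module.End.HasUnifEigenvalue Dc (-z) ⊤ := fun h0 => hne (by
        have : F.baseChange ℂ w ∈ Module.End.genEigenspace Dc (-z) ⊤ := h3
        rw [h0] at this
        simpa using this)
    exact h4.lt zero_lt_one
  have h2 : F.baseChange ℂ (1 ⊗ₜ[ℝ] x) = 0 := h1 hx
  rw [LinearMap.baseChange_tmul] at h2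
  exact one_tmul_injective h2

end Skew

/-! ### The reduced tangent space and the maps `N²¹` and `N¹³` -/

/-- The transpose of a linear map with respect to a nondegenerate form. -/
theorem exists_dual_of_nondegenerate {X Y : Type*} [AddCommGroup X] [Module ℝ X]
    [FiniteDimensional ℝ X] [AddCommGroup Y] [Module ℝ Y]
    {b : LinearMap.BilinForm ℝ X} (hb : b.Nondegenerate) (F : X →ₗ[ℝ] Y) :
    ∃ F' : Dual ℝ Y →ₗ[ℝ] X, ∀ ν x, b (F' ν) x = ν (F x) :=
  ⟨(b.toDual hb).symm.toLinearMap ∘ₗ F.dualMap, fun ν x =>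
    LinearMap.BilinForm.apply_toDual_symm_apply (hB := hb) _ _⟩

namespace HamiltonianSystem
section
variable {EG : Type*} [NormedAddCommGroup EG] [NormedSpace ℝ EG] [FiniteDimensional ℝ EG]
  {G : Type*} [TopologicalSpace G] [ChartedSpace EG G] [Group G] [LieGroup 𝓘(ℝ, EG) ∞ G]
  {EP : Type*} [NormedAddCommGroup EP] [NormedSpace ℝ EP] [FiniteDimensional ℝ EP]
  {P : Type*} [TopologicalSpace P] [ChartedSpace EP P] [IsManifold 𝓘(ℝ, EP) ∞ P] [MulAction G P]
  {𝓢 : HamiltonianSystem EG G EP P} {p : P} {ξ : GroupLieAlgebra 𝓘(ℝ, EG) G}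

/-- `ker dJ(p)` is the symplectic complement of `𝔤p`. -/
theorem mem_kerdJ {v : TangentSpace 𝓘(ℝ, EP) p} :
    v ∈ 𝓢.kerdJ p ↔ ∀ η : GroupLieAlgebra 𝓘(ℝ, EG) G, 𝓢.symp.bilin p (infGen p η) v = 0 := by
  rw [kerdJ, LinearMap.mem_ker, LinearMap.ext_iff]
  simp only [dJ_apply, LinearMap.zero_apply]

/-- `𝔤p ∩ ker dJ(p) = 𝔤_μ p`. -/
theorem infGen_mem_kerdJ {η : GroupLieAlgebra 𝓘(ℝ, EG) G} :
    (infGen p η : TangentSpace 𝓘(ℝ, EP) p) ∈ 𝓢.kerdJ p ↔ η ∈ 𝓢.gmu p := by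
  rw [kerdJ, LinearMap.mem_ker, LinearMap.ext_iff]
  simp only [dJ_infGen, LinearMap.zero_apply, neg_eq_zero]
  rfl

theorem infGen_mem_gmuOrbit (η : 𝓢.gmu p) : (infGen p (η : GroupLieAlgebra 𝓘(ℝ, EG) G) :
    TangentSpace 𝓘(ℝ, EP) p) ∈ 𝓢.gmuOrbit p :=
  Submodule.mem_map_of_mem η.2

theorem bilin_swap (v w : TangentSpace 𝓘(ℝ, EP) p) : 𝓢.symp.bilin p v w = -𝓢.symp.bilin p w v :=
  ((𝓢.symp.bilin_isAlt p).neg_eq w v).symm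

/-- The symplectic complement of `ker dJ(p)` is `𝔤p`. -/
theorem mem_range_infGen {v : TangentSpace 𝓘(ℝ, EP) p} (hv : ∀ w ∈ 𝓢.kerdJ p, 𝓢.symp.bilin p v w =
    0) :
    ∃ η : GroupLieAlgebra 𝓘(ℝ, EG) G, infGen p η = v := by
  have h1 : 𝓢.kerdJ p = (𝓢.symp.bilin p).orthogonal
      (LinearMap.range (infGen p : GroupLieAlgebra 𝓘(ℝ, EG) G →ₗ[ℝ] TangentSpace 𝓘(ℝ, EP) p)) := by
    ext w
    rw [mem_kerdJ]
    constructor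
    · rintro h _ ⟨η, rfl⟩
      exact h η
    · exact fun h η => h _ ⟨η, rfl⟩
  have h2 := LinearMap.BilinForm.orthogonal_orthogonal (𝓢.symp.bilin_nondegenerate p)
    (𝓢.symp.bilin_isAlt p).isRefl
    (LinearMap.range (infGen p : GroupLieAlgebra 𝓘(ℝ, EG) G →ₗ[ℝ] TangentSpace 𝓘(ℝ, EP) p))
  rw [← h1] at h2
  have h3 : v ∈ (𝓢.symp.bilin p).orthogonal (𝓢.kerdJ p) := fun w hw => by
    change 𝓢.symp.bilin p w v = 0
    rw [bilin_swap, hv w hw, neg_zero]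
  rwa [h2] at h3

theorem redProj_surjective : Function.Surjective (𝓢.redProj p) := Submodule.mkQ_surjective _

theorem redProj_eq_zero {v : 𝓢.kerdJ p} : 𝓢.redProj p v = 0 ↔ (v : TangentSpace 𝓘(ℝ, EP)
    p) ∈ 𝓢.gmuOrbit p := by
  rw [redProj, Submodule.mkQ_apply, Submodule.Quotient.mk_eq_zero]
  rfl

theorem redForm_swap (x y : 𝓢.RedTangent p) : 𝓢.redForm p x y = -𝓢.redForm p y x := by
  obtain ⟨v, rfl⟩ := redProj_surjective x
  obtain ⟨w, rfl⟩ := redProj_surjective y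
  rw [redForm_redProj, redForm_redProj, bilin_swap]

theorem eq_zero_of_redForm {x : 𝓢.RedTangent p} (h : ∀ y, 𝓢.redForm p x y = 0) : x = 0 := by
  obtain ⟨v, rfl⟩ := redProj_surjective x
  obtain ⟨η, hη⟩ := mem_range_infGen (v := v.1) fun w hw => h (𝓢.redProj p ⟨w, hw⟩)
  rw [redProj_eq_zero, ← hη]
  have : η ∈ 𝓢.gmu p := infGen_mem_kerdJ.1 (hη ▸ v.2)
  exact Submodule.mem_map_of_mem this

theorem redForm_nondegenerate : (𝓢.redForm p).Nondegenerate :=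
  ⟨fun _ h => eq_zero_of_redForm h, fun x h => eq_zero_of_redForm fun y =>
    by rw [redForm_swap, h y, neg_zero]⟩

theorem dJmu_apply (v : TangentSpace 𝓘(ℝ, EP) p) (η : 𝓢.gmu p) :
    𝓢.dJmu p v η = 𝓢.symp.bilin p (infGen p (η : GroupLieAlgebra 𝓘(ℝ, EG) G)) v :=
  𝓢.dJ_apply p v η

theorem exists_bilin_eq (ℓ : Dual ℝ (TangentSpace 𝓘(ℝ, EP) p)) : ∃ v, ∀ w, 𝓢.symp.bilin p w v =
    ℓ w := by
  refine ⟨-((𝓢.symp.bilin p).toDual (𝓢.symp.bilin_nondegenerate p)).symm ℓ, fun w => ?_⟩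
  rw [bilin_swap, map_neg, LinearMap.neg_apply, neg_neg,
    LinearMap.BilinForm.apply_toDual_symm_apply]

/-- At a regular point every element of `𝔤_μ*` is the restriction of some `dJ(p) v`. -/
theorem dJmu_surjective (hreg : 𝓢.IsRegular p) : Function.Surjective (𝓢.dJmu p) := by
  intro ν
  obtain ⟨ν', rfl⟩ := Subspace.dualRestrict_surjective (W := 𝓢.gmu p) ν
  obtain ⟨ℓ, rfl⟩ := LinearMap.dualMap_surjective_of_injective (infGen_injective hreg) ν'
  obtain ⟨v, hv⟩ := 𝓢.exists_bilin_eq ℓ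
  exact ⟨v, LinearMap.ext fun η => (dJmu_apply v η).trans (hv _)⟩

section RelativeEquilibrium

theorem IsRelativeEquilibrium.lin_mem_kerdJ (hp : 𝓢.IsRelativeEquilibrium p ξ) {v :
    TangentSpace 𝓘(ℝ, EP) p} (hv : v ∈ 𝓢.kerdJ p) :
    𝓢.lin p ξ v ∈ 𝓢.kerdJ p := by
  have hv' : 𝓢.dJ p v = 0 := hv
  refine LinearMap.mem_ker.2 (LinearMap.ext fun η => ?_)
  rw [hp.dJ_lin, hv']
  rfl

theorem IsRelativeEquilibrium.lin_mem_gmuOrbit (hp : 𝓢.IsRelativeEquilibrium p ξ) {v :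
    TangentSpace 𝓘(ℝ, EP) p} (hv : v ∈ 𝓢.gmuOrbit p) :
    𝓢.lin p ξ v ∈ 𝓢.gmuOrbit p := by
  obtain ⟨η, hη, rfl⟩ := hv
  rw [hp.lin_infGen]
  exact neg_mem (Submodule.mem_map_of_mem (hp.ad_mem_gmu hη))

theorem IsRelativeEquilibrium.redLin_redProj (hp : 𝓢.IsRelativeEquilibrium p ξ) (v : 𝓢.kerdJ p) :
    𝓢.redLin p ξ (𝓢.redProj p v) = 𝓢.redProj p ⟨𝓢.lin p ξ v, hp.lin_mem_kerdJ v.2⟩ := by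
  rw [redLin, inducedEnd, dif_pos ⟨fun v hv => hp.lin_mem_kerdJ hv, fun v hv =>
    hp.lin_mem_gmuOrbit hv⟩]
  rfl

theorem IsRelativeEquilibrium.redForm_redLin (hp : 𝓢.IsRelativeEquilibrium p ξ) (x y :
    𝓢.RedTangent p) :
    𝓢.redForm p (𝓢.redLin p ξ x) y = -𝓢.redForm p x (𝓢.redLin p ξ y) := by
  obtain ⟨v, rfl⟩ := redProj_surjective x
  obtain ⟨w, rfl⟩ := redProj_surjective y
  rw [hp.redLin_redProj, hp.redLin_redProj, redForm_redProj, redForm_redProj]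
  exact hp.bilin_lin_skew _ _

/-- Formal stability: up to a sign the reduced Hessian `ω_μ(L x, x)` is positive definite. -/
theorem IsRelativeEquilibrium.exists_sign (hp : 𝓢.IsRelativeEquilibrium p ξ) (hstab :
    𝓢.IsFormallyStable p ξ) :
    ∃ s : ℝ, (s = 1 ∨ s = -1) ∧ ∀ x : 𝓢.RedTangent p, x ≠ 0 → 0 < s * 𝓢.redForm p (𝓢.redLin p ξ x)
      x := by
  have key (v : 𝓢.kerdJ p) : 𝓢.redForm p (𝓢.redLin p ξ (𝓢.redProj p v)) (𝓢.redProj p v) =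
      hessian (𝓢.augmented ξ) p v.1 v.1 := by
    rw [hp.redLin_redProj, redForm_redProj, ← hp.bilin_lin]
  rcases hstab with h | h
  · refine ⟨1, Or.inl rfl, fun x hx => ?_⟩
    obtain ⟨v, rfl⟩ := redProj_surjective x
    rw [key, one_mul]
    exact h v v.2 fun h0 => hx (redProj_eq_zero.2 h0)
  · refine ⟨-1, Or.inr rfl, fun x hx => ?_⟩
    obtain ⟨v, rfl⟩ := redProj_surjective x
    rw [key]
    have := h v v.2 fun h0 => hx (redProj_eq_zero.2 h0)
    linarith

/-- The reduced linearization is skew with respect to the definite reduced Hessian `ω_μ(L x, y)`. -/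
theorem IsRelativeEquilibrium.redLin_isSemisimple (hp : 𝓢.IsRelativeEquilibrium p ξ) (hstab :
    𝓢.IsFormallyStable p ξ) :
    (𝓢.redLin p ξ).IsSemisimple := by
  obtain ⟨s, -, hs⟩ := hp.exists_sign hstab
  refine isSemisimple_of_skew (b := s • (𝓢.redForm p ∘ₗ 𝓢.redLin p ξ)) (fun x y => ?_) hs fun x y =>
    ?_
  · change s * 𝓢.redForm p (𝓢.redLin p ξ x) y = s * 𝓢.redForm p (𝓢.redLin p ξ y) x
    rw [hp.redForm_redLin, ← redForm_swap]
  · change s * 𝓢.redForm p (𝓢.redLin p ξ (𝓢.redLin p ξ x)) y = -(s * 𝓢.redForm p (𝓢.redLin p ξ x)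
      (𝓢.redLin p ξ y))
    rw [hp.redForm_redLin]
    ring

theorem bilin_ad_skew {B : LinearMap.BilinForm ℝ (GroupLieAlgebra 𝓘(ℝ, EG) G)} (hB :
    IsAdInvariantInner B)
    (hp : 𝓢.IsRelativeEquilibrium p ξ) (η ζ : GroupLieAlgebra 𝓘(ℝ, EG) G) : B (ad ξ η) ζ = -B η
      (ad ξ ζ) := by
  obtain ⟨c, hc, -⟩ := hp
  exact hB.ad_skew hc η ζ

theorem IsRelativeEquilibrium.ad_isSemisimple [CompactSpace G] [T2Space G] (hp :
    𝓢.IsRelativeEquilibrium p ξ) :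
    (ad ξ).IsSemisimple := by
  obtain ⟨B, hB⟩ := exists_isAdInvariantInner (EG := EG) (G := G)
  exact isSemisimple_of_skew hB.symm hB.pos (bilin_ad_skew hB hp)

section Nilpotent
variable {S N : Module.End ℝ (TangentSpace 𝓘(ℝ, EP) p)}

theorem IsRelativeEquilibrium.bilin_nilpotent (hp : 𝓢.IsRelativeEquilibrium p ξ) (hSN :
    IsJordanDecomposition (𝓢.lin p ξ) S N)
    (v w : TangentSpace 𝓘(ℝ, EP) p) : 𝓢.symp.bilin p (N v) w = -𝓢.symp.bilin p v (N w) :=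
  hSN.skew (𝓢.symp.bilin_nondegenerate p) hp.bilin_lin_skew v w

theorem IsRelativeEquilibrium.bilin_semisimple (hp : 𝓢.IsRelativeEquilibrium p ξ) (hSN :
    IsJordanDecomposition (𝓢.lin p ξ) S N)
    (v w : TangentSpace 𝓘(ℝ, EP) p) : 𝓢.symp.bilin p (S v) w = -𝓢.symp.bilin p v (S w) := by
  have h1 := hp.bilin_lin_skew v w
  rw [hSN.sum_eq, LinearMap.add_apply, LinearMap.add_apply, map_add, map_add, LinearMap.add_apply,
    hp.bilin_nilpotent hSN] at h1
  linarith

/-- The nilpotent part vanishes on the tangent space to the orbit. -/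
theorem IsRelativeEquilibrium.nilpotent_infGen [CompactSpace G] [T2Space G] (hp :
    𝓢.IsRelativeEquilibrium p ξ) (hreg : 𝓢.IsRegular p)
    (hSN : IsJordanDecomposition (𝓢.lin p ξ) S N) (η : GroupLieAlgebra 𝓘(ℝ, EG) G) :
      N (infGen p η) = 0 := by
  obtain ⟨q, hq⟩ := hSN.exists_aeval
  have hi (ζ : GroupLieAlgebra 𝓘(ℝ, EG) G) : (infGen p ((-ad ξ) ζ) : TangentSpace 𝓘(ℝ, EP) p) =
    𝓢.lin p ξ (infGen p ζ) := by
    rw [hp.lin_infGen, LinearMap.neg_apply, map_neg]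
  rw [hq, ← aeval_intertwine (A := -ad ξ) hi, aeval_eq_zero_of_injective (infGen_injective hreg) hi
    (Module.End.isSemisimple_neg.2 hp.ad_isSemisimple) (hq ▸ hSN.nilpotent), LinearMap.zero_apply,
      map_zero]

/-- The image of the nilpotent part lies in `ker dJ(p) = (𝔤p)^ω`, since it is skew and vanishes on
`𝔤p`. -/
theorem IsRelativeEquilibrium.nilpotent_mem_kerdJ [CompactSpace G] [T2Space G] (hp :
    𝓢.IsRelativeEquilibrium p ξ) (hreg : 𝓢.IsRegular p)
    (hSN : IsJordanDecomposition (𝓢.lin p ξ) S N) (v : TangentSpace 𝓘(ℝ, EP) p) : N v ∈ 𝓢.kerdJ p :=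
      by
  refine mem_kerdJ.2 fun η => ?_
  rw [← neg_eq_zero, ← hp.bilin_nilpotent hSN, hp.nilpotent_infGen hreg hSN, map_zero,
    LinearMap.zero_apply]

/-- Formal stability makes the reduced linearization semisimple, so the nilpotent part maps `ker
dJ(p)` to the tangent space of the `G_μ`-orbit. -/
theorem IsRelativeEquilibrium.nilpotent_mem_gmuOrbit (hp : 𝓢.IsRelativeEquilibrium p ξ) (hstab :
    𝓢.IsFormallyStable p ξ)
    (hSN : IsJordanDecomposition (𝓢.lin p ξ) S N) {v : TangentSpace 𝓘(ℝ, EP) p} (hv :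
      v ∈ 𝓢.kerdJ p) : N v ∈ 𝓢.gmuOrbit p := by
  obtain ⟨q, hq⟩ := hSN.exists_aeval
  -- `N = q(A)` induces `q(L)` on the reduced tangent space, which is nilpotent and semisimple
  let A' : Module.End ℝ (𝓢.kerdJ p) := (𝓢.lin p ξ).restrict fun v hv => hp.lin_mem_kerdJ hv
  have h1 (u : 𝓢.kerdJ p) : (𝓢.kerdJ p).subtype (A' u) = 𝓢.lin p ξ ((𝓢.kerdJ p).subtype u) := rfl
  have h2 (u : 𝓢.kerdJ p) : 𝓢.redProj p (A' u) = 𝓢.redLin p ξ (𝓢.redProj p u) :=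
    (hp.redLin_redProj u).symm
  have h3 : IsNilpotent (Polynomial.aeval A' q) := by
    obtain ⟨k, hk⟩ := hSN.nilpotent
    refine ⟨k, LinearMap.ext fun u => Subtype.ext ?_⟩
    have := aeval_intertwine h1 (q ^ k) u
    rw [map_pow, map_pow, ← hq, hk] at this
    exact this
  have h4 := aeval_eq_zero_of_surjective redProj_surjective h2 (hp.redLin_isSemisimple hstab) h3
  have h5 := aeval_intertwine h2 q ⟨v, hv⟩
  rw [h4, LinearMap.zero_apply, redProj_eq_zero] at h5
  have h6 := aeval_intertwine h1 q ⟨v, hv⟩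
  rw [← hq] at h6
  exact h6 ▸ h5

theorem IsRelativeEquilibrium.exists_isN21 [CompactSpace G] [T2Space G] (hp :
    𝓢.IsRelativeEquilibrium p ξ) (hreg : 𝓢.IsRegular p)
    (hstab : 𝓢.IsFormallyStable p ξ) (hSN : IsJordanDecomposition (𝓢.lin p ξ) S N) :
    ∃ N21 : 𝓢.RedTangent p →ₗ[ℝ] 𝓢.gmu p, 𝓢.IsN21 p N N21 := by
  let e : 𝓢.gmu p ≃ₗ[ℝ] 𝓢.gmuOrbit p := Submodule.equivMapOfInjective (infGen p)
    (infGen_injective hreg) (𝓢.gmu p)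
  let F : 𝓢.kerdJ p →ₗ[ℝ] 𝓢.gmuOrbit p := (N ∘ₗ (𝓢.kerdJ p).subtype).codRestrict _ fun v =>
    hp.nilpotent_mem_gmuOrbit hstab hSN v.2
  refine ⟨((𝓢.gmuOrbit p).submoduleOf (𝓢.kerdJ p)).liftQ (e.symm.toLinearMap ∘ₗ F) ?_, fun v => ?_⟩
  · rintro ⟨v, hv⟩ ⟨η, hη, h⟩
    have h0 : infGen p η = v := h
    rw [LinearMap.mem_ker, LinearMap.comp_apply]
    have : F ⟨v, hv⟩ = 0 := Subtype.ext (by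
      change N v = 0
      rw [← h0, hp.nilpotent_infGen hreg hSN])
    rw [this, map_zero]
  · change N v = (e (e.symm (F v)) : TangentSpace 𝓘(ℝ, EP) p)
    rw [e.apply_symm_apply]
    rfl

section N21
variable {N21 : 𝓢.RedTangent p →ₗ[ℝ] 𝓢.gmu p}

/-- `N¹³` is the transpose of `N²¹` with respect to the reduced form. -/
theorem IsRelativeEquilibrium.exists_isN13 [CompactSpace G] [T2Space G] (hp :
    𝓢.IsRelativeEquilibrium p ξ) (hreg : 𝓢.IsRegular p)
    (hSN : IsJordanDecomposition (𝓢.lin p ξ) S N) (h21 : 𝓢.IsN21 p N N21) :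
    ∃ N13 : Dual ℝ (𝓢.gmu p) →ₗ[ℝ] 𝓢.RedTangent p, 𝓢.IsN13 p N N13 ∧ ∀ ν x, 𝓢.redForm p (N13 ν) x =
      ν (N21 x) := by
  obtain ⟨N13, he⟩ := exists_dual_of_nondegenerate (redForm_nondegenerate (𝓢 := 𝓢) (p := p)) N21
  refine ⟨N13, fun z => ⟨hp.nilpotent_mem_kerdJ hreg hSN z, ?_⟩, he⟩
  rw [← sub_eq_zero]
  refine eq_zero_of_redForm fun x => ?_
  obtain ⟨v, rfl⟩ := redProj_surjective x
  rw [map_sub, LinearMap.sub_apply, redForm_redProj, sub_eq_zero]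
  refine (he _ _).trans ?_
  rw [dJmu_apply, ← h21 v, hp.bilin_nilpotent hSN, ← bilin_swap]

/-- `N` commutes with `dX_{H_ξ}(p)`, which is `L` on the reduced tangent space and `-ad_ξ` on `𝔤_μ
p`. -/
theorem IsRelativeEquilibrium.N21_redLin (hp : 𝓢.IsRelativeEquilibrium p ξ) (hreg : 𝓢.IsRegular p)
    (hSN : IsJordanDecomposition (𝓢.lin p ξ) S N) (h21 : 𝓢.IsN21 p N N21) (x : 𝓢.RedTangent p) :
    N21 (𝓢.redLin p ξ x) = -𝓢.adMu p ξ (N21 x) := by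
  obtain ⟨v, rfl⟩ := redProj_surjective x
  have h1 : Commute (𝓢.lin p ξ) N := by
    rw [hSN.sum_eq]
    exact hSN.commute.add_left (Commute.refl N)
  have h2 : (infGen p (N21 (𝓢.redLin p ξ (𝓢.redProj p v)) : GroupLieAlgebra 𝓘(ℝ, EG) G) :
    TangentSpace 𝓘(ℝ, EP) p) =
      infGen p (-ad ξ (N21 (𝓢.redProj p v) : GroupLieAlgebra 𝓘(ℝ, EG) G)) := by
    rw [hp.redLin_redProj, ← h21, map_neg, ← hp.lin_infGen, ← h21]
    exact (LinearMap.congr_fun h1.eq v.1).symm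
  have h3 := infGen_injective hreg h2
  refine Subtype.ext (h3.trans ?_)
  rw [NegMemClass.coe_neg, hp.adMu_apply]

end N21
end Nilpotent
end RelativeEquilibrium
end
end HamiltonianSystem

/-! ### Localization of `N²¹` and `N¹³`, and the splitting of the tangent space -/

namespace HamiltonianSystem
section
variable {EG : Type*} [NormedAddCommGroup EG] [NormedSpace ℝ EG] [FiniteDimensional ℝ EG]
  {G : Type*} [TopologicalSpace G] [ChartedSpace EG G] [Group G] [LieGroup 𝓘(ℝ, EG) ∞ G]
  {EP : Type*} [NormedAddCommGroup EP] [NormedSpace ℝ EP] [FiniteDimensional ℝ EP]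
  {P : Type*} [TopologicalSpace P] [ChartedSpace EP P] [IsManifold 𝓘(ℝ, EP) ∞ P] [MulAction G P]
  {𝓢 : HamiltonianSystem EG G EP P} {p : P} {ξ : GroupLieAlgebra 𝓘(ℝ, EG) G}

section Resonance
variable {lam : ℝ}

theorem IsResonant.gmuRes_eq (hres : 𝓢.IsResonant p ξ lam) :
    𝓢.gmuRes p ξ lam = LinearMap.ker (realQuad (𝓢.adMu p ξ) (Complex.I * lam)) :=
  spectralSubspace_resonant _ hres.mult_group

theorem IsResonant.gmuNonres_eq (hres : 𝓢.IsResonant p ξ lam) :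
    𝓢.gmuNonres p ξ lam = LinearMap.range (realQuad (𝓢.adMu p ξ) (Complex.I * lam)) :=
  spectralSubspace_nonresonant _ hres.mult_group

theorem IsResonant.redRes_eq (hres : 𝓢.IsResonant p ξ lam) :
    𝓢.redRes p ξ lam = LinearMap.ker (realQuad (𝓢.redLin p ξ) (Complex.I * lam)) :=
  spectralSubspace_resonant _ hres.mult_reduced

theorem IsResonant.redNonres_eq (hres : 𝓢.IsResonant p ξ lam) :
    𝓢.redNonres p ξ lam = LinearMap.range (realQuad (𝓢.redLin p ξ) (Complex.I * lam)) :=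
  spectralSubspace_nonresonant _ hres.mult_reduced

theorem IsResonant.isCompl_gmu (hres : 𝓢.IsResonant p ξ lam) :
    IsCompl (𝓢.gmuNonres p ξ lam) (𝓢.gmuRes p ξ lam) := by
  rw [hres.gmuRes_eq, hres.gmuNonres_eq]
  exact isCompl_range_ker_realQuad _ hres.mult_group

theorem IsResonant.isCompl_red (hres : 𝓢.IsResonant p ξ lam) :
    IsCompl (𝓢.redNonres p ξ lam) (𝓢.redRes p ξ lam) := by
  rw [hres.redRes_eq, hres.redNonres_eq]
  exact isCompl_range_ker_realQuad _ hres.mult_reduced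

theorem IsResonant.mem_gmuRes (hres : 𝓢.IsResonant p ξ lam) {η : 𝓢.gmu p} :
    η ∈ 𝓢.gmuRes p ξ lam ↔ 𝓢.adMu p ξ (𝓢.adMu p ξ η) + lam ^ 2 • η = 0 := by
  rw [hres.gmuRes_eq, LinearMap.mem_ker, realQuad_I_mul]

theorem IsResonant.mem_redRes (hres : 𝓢.IsResonant p ξ lam) {x : 𝓢.RedTangent p} :
    x ∈ 𝓢.redRes p ξ lam ↔ 𝓢.redLin p ξ (𝓢.redLin p ξ x) + lam ^ 2 • x = 0 := by
  rw [hres.redRes_eq, LinearMap.mem_ker, realQuad_I_mul]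

theorem IsResonant.mem_redNonres (hres : 𝓢.IsResonant p ξ lam) {x : 𝓢.RedTangent p} :
    x ∈ 𝓢.redNonres p ξ lam ↔ ∃ y, 𝓢.redLin p ξ (𝓢.redLin p ξ y) + lam ^ 2 • y = x := by
  rw [hres.redNonres_eq, LinearMap.mem_range]
  simp only [realQuad_I_mul]

theorem IsResonant.mem_gmuNonres (hres : 𝓢.IsResonant p ξ lam) {x : 𝓢.gmu p} :
    x ∈ 𝓢.gmuNonres p ξ lam ↔ ∃ y, 𝓢.adMu p ξ (𝓢.adMu p ξ y) + lam ^ 2 • y = x := by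
  rw [hres.gmuNonres_eq, LinearMap.mem_range]
  simp only [realQuad_I_mul]

theorem adMu_skew (hp : 𝓢.IsRelativeEquilibrium p ξ) {B : LinearMap.BilinForm ℝ
    (GroupLieAlgebra 𝓘(ℝ, EG) G)}
    (hB : IsAdInvariantInner B) (η ζ : 𝓢.gmu p) : B (𝓢.adMu p ξ η : 𝓢.gmu p) ζ = -B η
      (𝓢.adMu p ξ ζ : 𝓢.gmu p) := by
  rw [hp.adMu_apply, hp.adMu_apply]
  exact bilin_ad_skew hB hp _ _

section Localization
variable {S N : Module.End ℝ (TangentSpace 𝓘(ℝ, EP) p)} {N21 : 𝓢.RedTangent p →ₗ[ℝ] 𝓢.gmu p}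
  {N13 : Dual ℝ (𝓢.gmu p) →ₗ[ℝ] 𝓢.RedTangent p}

/-- `N²¹` exchanges `L` and `-ad_ξ`, whose spectra meet only in the resonant pair. -/
theorem IsResonant.redNonres_le_ker [CompactSpace G] [T2Space G] (hres : 𝓢.IsResonant p ξ lam)
    (hp : 𝓢.IsRelativeEquilibrium p ξ)
    (hL : ∀ x, N21 (𝓢.redLin p ξ x) = -𝓢.adMu p ξ (N21 x)) :
      𝓢.redNonres p ξ lam ≤ LinearMap.ker N21 := by
  obtain ⟨B, hB⟩ := exists_isAdInvariantInner (EG := EG) (G := G)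
  intro x hx
  refine eq_zero_of_intertwine_neg hL (fun z hz hzL hzD => hz ?_) hx
  rw [← hres.inter]
  refine ⟨neg_mem_complexSpectrum_of_skew (b := B.restrict (𝓢.gmu p)) (fun η ζ => hB.symm _ _)
    (fun η hη => hB.pos _ fun h => hη (Subtype.ext h)) (adMu_skew hp hB) hzD, hzL⟩

theorem IsResonant.range_N21_le (hres : 𝓢.IsResonant p ξ lam)
    (hL : ∀ x, N21 (𝓢.redLin p ξ x) = -𝓢.adMu p ξ (N21 x)) (hker :
      𝓢.redNonres p ξ lam ≤ LinearMap.ker N21) :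
    LinearMap.range N21 ≤ 𝓢.gmuRes p ξ lam := by
  rintro _ ⟨x, rfl⟩
  obtain ⟨u, hu, v, hv, rfl⟩ := Submodule.mem_sup.1
    (hres.isCompl_red.sup_eq_top ▸ Submodule.mem_top : x ∈ _)
  rw [map_add, LinearMap.mem_ker.1 (hker hu), zero_add, hres.mem_gmuRes]
  have h := congrArg N21 (hres.mem_redRes.1 hv)
  rw [map_add, hL, hL, map_neg, neg_neg, map_smul, map_zero] at h
  exact h

theorem dualNonres_le_ker (hr : LinearMap.range N21 ≤ 𝓢.gmuRes p ξ lam)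
    (hdual : ∀ ν x, 𝓢.redForm p (N13 ν) x = ν (N21 x)) : 𝓢.dualNonres p ξ lam ≤ LinearMap.ker N13 :=
      by
  intro ν hν
  refine eq_zero_of_redForm fun x => ?_
  rw [hdual]
  exact (Submodule.mem_dualAnnihilator ν).1 hν _ (hr ⟨x, rfl⟩)

/-- The transpose of `N²¹` maps into the resonant part, since `N²¹` vanishes on the range of `L² +
λ²` and this operator is its own transpose. -/
theorem IsResonant.range_N13_le (hres : 𝓢.IsResonant p ξ lam) (hp : 𝓢.IsRelativeEquilibrium p ξ)
    (hker : 𝓢.redNonres p ξ lam ≤ LinearMap.ker N21)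
    (hdual : ∀ ν x, 𝓢.redForm p (N13 ν) x = ν (N21 x)) : LinearMap.range N13 ≤ 𝓢.redRes p ξ lam :=
      by
  rintro _ ⟨ν, rfl⟩
  rw [hres.mem_redRes]
  refine eq_zero_of_redForm fun y => ?_
  have h1 := hdual ν (𝓢.redLin p ξ (𝓢.redLin p ξ y) + lam ^ 2 • y)
  rw [LinearMap.mem_ker.1 (hker (hres.mem_redNonres.2 ⟨y, rfl⟩)), map_zero, map_add, map_smul] at h1
  rw [map_add, LinearMap.add_apply, map_smul, LinearMap.smul_apply, hp.redForm_redLin,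
    hp.redForm_redLin, neg_neg, h1]

end Localization
end Resonance

namespace Splitting
variable {S N : Module.End ℝ (TangentSpace 𝓘(ℝ, EP) p)} (σ : 𝓢.Splitting p S)

theorem bilin_infGen_kerdJ (η : GroupLieAlgebra 𝓘(ℝ, EG) G) {v : TangentSpace 𝓘(ℝ, EP) p} (hv :
    v ∈ 𝓢.kerdJ p) :
    𝓢.symp.bilin p v (infGen p η) = 0 := by
  rw [bilin_swap, mem_kerdJ.1 hv, neg_zero]

/-- The symplectic form is nondegenerate on `W_red`. -/
theorem eq_zero_of_mem_W {w : TangentSpace 𝓘(ℝ, EP) p} (hw : w ∈ σ.W) (h : ∀ w' ∈ σ.W,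
    𝓢.symp.bilin p w w' = 0) : w = 0 := by
  obtain ⟨η, hη⟩ := mem_range_infGen (𝓢 := 𝓢) (v := w) fun u hu => by
    rw [← σ.W_sup] at hu
    obtain ⟨w', hw', o, ⟨ζ, hζ, rfl⟩, rfl⟩ := Submodule.mem_sup.1 hu
    rw [map_add, h w' hw', bilin_infGen_kerdJ _ (σ.W_le hw), add_zero]
  have h1 : η ∈ 𝓢.gmu p := infGen_mem_kerdJ.1 (hη ▸ σ.W_le hw)
  have h2 : w ∈ σ.W ⊓ 𝓢.gmuOrbit p := ⟨hw, hη ▸ infGen_mem_gmuOrbit ⟨η, h1⟩⟩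
  rwa [σ.W_inf] at h2

/-- An element of `𝔟` whose generator is symplectically orthogonal to `𝔟p` vanishes: its generator
then lies in `ker dJ(p)`, and `𝔟 ∩ 𝔤_μ = 0`. -/
theorem eq_zero_of_mem_b {β : GroupLieAlgebra 𝓘(ℝ, EG) G} (hβ : β ∈ σ.b)
    (h : ∀ β' ∈ σ.b, 𝓢.symp.bilin p (infGen p β') (infGen p β) = 0) : β = 0 := by
  have h1 : (infGen p β : TangentSpace 𝓘(ℝ, EP) p) ∈ 𝓢.kerdJ p := mem_kerdJ.2 fun η => by
    obtain ⟨β', hβ', ζ, hζ, rfl⟩ := Submodule.mem_sup.1 (σ.b_compl.sup_eq_top ▸ Submodule.mem_top :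
      η ∈ _)
    rw [map_add, map_add, LinearMap.add_apply, h β' hβ', bilin_infGen_kerdJ _
      (infGen_mem_kerdJ.2 hζ), add_zero]
  have h2 := σ.b_compl.inf_eq_bot.le ⟨hβ, infGen_mem_kerdJ.1 h1⟩
  simpa using h2

/-- The symplectic complement of `W_red ⊕ 𝔟p`, tested on each summand. -/
theorem mem_orthogonal {z : TangentSpace 𝓘(ℝ, EP) p} :
    z ∈ (𝓢.symp.bilin p).orthogonal (σ.W ⊔ σ.bOrbit) ↔
      (∀ w ∈ σ.W, 𝓢.symp.bilin p w z = 0) ∧ ∀ β ∈ σ.b, 𝓢.symp.bilin p (infGen p β) z = 0 := by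
  constructor
  · intro h
    exact ⟨fun w hw => h w (Submodule.mem_sup_left hw), fun β hβ => h _ (Submodule.mem_sup_right
      (Submodule.mem_map_of_mem hβ))⟩
  · rintro ⟨h1, h2⟩ u hu
    obtain ⟨w, hw, _, ⟨β, hβ, rfl⟩, rfl⟩ := Submodule.mem_sup.1 hu
    change 𝓢.symp.bilin p _ z = 0
    rw [map_add, LinearMap.add_apply, h1 w hw, h2 β hβ, add_zero]

theorem Z_le : σ.Z ≤ (𝓢.symp.bilin p).orthogonal (σ.W ⊔ σ.bOrbit) := by
  rw [bOrbit, ← σ.Z_sup]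
  exact le_sup_left

theorem gmuOrbit_le : 𝓢.gmuOrbit p ≤ (𝓢.symp.bilin p).orthogonal (σ.W ⊔ σ.bOrbit) := by
  rw [bOrbit, ← σ.Z_sup]
  exact le_sup_right

/-- `W_red ⊕ 𝔟p` is a symplectic subspace. -/
theorem isCompl_orthogonal : IsCompl (σ.W ⊔ σ.bOrbit) ((𝓢.symp.bilin p).orthogonal
    (σ.W ⊔ σ.bOrbit)) := by
  rw [LinearMap.BilinForm.isCompl_orthogonal_iff_disjoint (𝓢.symp.bilin_isAlt p).isRefl,
    Submodule.disjoint_def]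
  intro u hu hu'
  obtain ⟨w, hw, _, ⟨β, hβ, rfl⟩, rfl⟩ := Submodule.mem_sup.1 hu
  obtain ⟨h1, h2⟩ := σ.mem_orthogonal.1 hu'
  have e1 : w = 0 := σ.eq_zero_of_mem_W hw fun w' hw' => by
    have := h1 w' hw'
    rw [map_add, bilin_infGen_kerdJ _ (σ.W_le hw'), add_zero] at this
    rw [bilin_swap, this, neg_zero]
  have e2 : β = 0 := σ.eq_zero_of_mem_b hβ fun β' hβ' => by
    have := h2 β' hβ'
    rwa [map_add, mem_kerdJ.1 (σ.W_le hw), zero_add] at this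
  rw [e1, e2, map_zero, add_zero]

theorem exists_assemble (v : TangentSpace 𝓘(ℝ, EP) p) :
    ∃ (w : σ.W) (η : 𝓢.gmu p) (z : σ.Z) (β : σ.b), v = σ.assemble w η z β := by
  obtain ⟨u, hu, o, ho, rfl⟩ := Submodule.mem_sup.1
    (σ.isCompl_orthogonal.sup_eq_top ▸ Submodule.mem_top : v ∈ _)
  obtain ⟨w, hw, _, ⟨β, hβ, rfl⟩, rfl⟩ := Submodule.mem_sup.1 hu
  rw [bOrbit, ← σ.Z_sup] at ho
  obtain ⟨z, hz, _, ⟨η, hη, rfl⟩, rfl⟩ := Submodule.mem_sup.1 ho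
  refine ⟨⟨w, hw⟩, ⟨η, hη⟩, ⟨z, hz⟩, ⟨β, hβ⟩, ?_⟩
  simp only [assemble]
  abel

theorem eq_zero_of_add_eq_zero {w o z β : TangentSpace 𝓘(ℝ, EP) p} (hw : w ∈ σ.W) (ho :
    o ∈ 𝓢.gmuOrbit p) (hz : z ∈ σ.Z)
    (hβ : β ∈ σ.bOrbit) (h : w + o + z + β = 0) : w = 0 ∧ o = 0 ∧ z = 0 ∧ β = 0 := by
  have hd := Submodule.disjoint_def.1 σ.isCompl_orthogonal.disjoint
  have h1 : w + β = -(z + o) := by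
    rw [eq_neg_iff_add_eq_zero, ← h]; abel
  have h2 : w + β = 0 := hd _ (Submodule.add_mem_sup hw hβ) (h1 ▸ neg_mem (add_mem (σ.Z_le hz)
    (σ.gmuOrbit_le ho)))
  have h3 : z + o = 0 := by rw [h1, neg_eq_zero] at h2; exact h2
  have h4 : z = 0 := by
    have : z ∈ σ.Z ⊓ 𝓢.gmuOrbit p := ⟨hz, by rw [eq_neg_of_add_eq_zero_left h3]; exact neg_mem ho⟩
    rwa [σ.Z_inf] at this
  have h5 : β = 0 := by
    obtain ⟨β', hβ', rfl⟩ := hβ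
    have : β' = 0 := σ.eq_zero_of_mem_b hβ' fun β'' hβ'' => by
      rw [eq_neg_of_add_eq_zero_right h2, map_neg, mem_kerdJ.1 (σ.W_le hw), neg_zero]
    rw [this, map_zero]
  refine ⟨?_, ?_, h4, h5⟩
  · rwa [h5, add_zero] at h2
  · rwa [h4, zero_add] at h3

theorem isInternal : DirectSum.IsInternal ![σ.W, 𝓢.gmuOrbit p, σ.Z, σ.bOrbit] := by
  refine DirectSum.isInternal_submodule_of_iSupIndep_of_iSup_eq_top ?_ ?_
  · classical
    rw [iSupIndep_iff_finsetSum_eq_zero_imp_eq_zero]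
    intro s v hv h0 i hi
    let u : Fin 4 → TangentSpace 𝓘(ℝ, EP) p := fun i => if i ∈ s then v i else 0
    have hu (i : Fin 4) : u i ∈ ![σ.W, 𝓢.gmuOrbit p, σ.Z, σ.bOrbit] i := by
      by_cases h : i ∈ s
      · simpa only [u, if_pos h] using hv i h
      · simp only [u, if_neg h, zero_mem]
    have hsum : ∑ i, u i = 0 := by
      rw [← h0]
      simp only [u, Finset.sum_ite_mem, Finset.univ_inter]
    rw [Fin.sum_univ_four] at hsum
    obtain ⟨e0, e1, e2, e3⟩ := σ.eq_zero_of_add_eq_zero (hu 0) (hu 1) (hu 2) (hu 3) hsum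
    have hall : ∀ i, u i = 0 := fun i => by fin_cases i <;> assumption
    have := hall i
    simpa only [u, if_pos hi] using this
  · rw [eq_top_iff]
    intro v _
    obtain ⟨w, η, z, β, rfl⟩ := σ.exists_assemble v
    have hle (i : Fin 4) := le_iSup ![σ.W, 𝓢.gmuOrbit p, σ.Z, σ.bOrbit] i
    exact add_mem (add_mem (add_mem (hle 0 w.2) (hle 1 (infGen_mem_gmuOrbit η))) (hle 2 z.2))
      (hle 3 (Submodule.mem_map_of_mem β.2))

theorem dJmu_of_mem_kerdJ {v : TangentSpace 𝓘(ℝ, EP) p} (hv : v ∈ 𝓢.kerdJ p) : 𝓢.dJmu p v = 0 :=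
  LinearMap.ext fun η => by rw [dJmu_apply, mem_kerdJ.1 hv, LinearMap.zero_apply]

theorem dJmu_infGen (β : GroupLieAlgebra 𝓘(ℝ, EG) G) : 𝓢.dJmu p (infGen p β) = 0 :=
  LinearMap.ext fun η => by
    rw [dJmu_apply, bilin_infGen_kerdJ _ (infGen_mem_kerdJ.2 η.2), LinearMap.zero_apply]

theorem dJmu_assemble (w : σ.W) (η : 𝓢.gmu p) (z : σ.Z) (β : σ.b) :
    𝓢.dJmu p (σ.assemble w η z β) = 𝓢.dJmu p z := by
  rw [assemble, map_add, map_add, map_add, dJmu_of_mem_kerdJ (σ.W_le w.2), dJmu_infGen, dJmu_infGen]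
  simp

/-- `dJ(p)` identifies `Z` with `𝔤_μ*`. -/
theorem dJmu_bijective (hreg : 𝓢.IsRegular p) : Function.Bijective (𝓢.dJmu p ∘ₗ σ.Z.subtype) := by
  constructor
  · refine LinearMap.ker_eq_bot.1 (LinearMap.ker_eq_bot'.2 ?_)
    rintro ⟨z, hz⟩ h0
    have h0' : 𝓢.dJmu p z = 0 := h0
    have h1 := σ.mem_orthogonal.1 (σ.Z_le hz)
    have h2 : z ∈ 𝓢.kerdJ p := mem_kerdJ.2 fun η => by
      obtain ⟨β, hβ, ζ, hζ, rfl⟩ := Submodule.mem_sup.1 (σ.b_compl.sup_eq_top ▸ Submodule.mem_top :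
        η ∈ _)
      have h3 := LinearMap.congr_fun h0' ⟨ζ, hζ⟩
      rw [dJmu_apply, LinearMap.zero_apply] at h3
      rw [map_add, map_add, LinearMap.add_apply, h1.2 β hβ, h3, add_zero]
    rw [← σ.W_sup] at h2
    obtain ⟨w, hw, o, ho, rfl⟩ := Submodule.mem_sup.1 h2
    have h4 : w = 0 := Submodule.disjoint_def.1 σ.isCompl_orthogonal.disjoint w
      (Submodule.mem_sup_left hw) (by
      have := sub_mem (σ.Z_le hz) (σ.gmuOrbit_le ho)
      rwa [add_sub_cancel_right] at this)
    have h5 : w + o ∈ σ.Z ⊓ 𝓢.gmuOrbit p := ⟨hz, by rwa [h4, zero_add]⟩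
    rw [σ.Z_inf] at h5
    exact Subtype.ext h5
  · intro ν
    obtain ⟨v, rfl⟩ := dJmu_surjective hreg ν
    obtain ⟨w, η, z, β, rfl⟩ := σ.exists_assemble v
    exact ⟨z, (σ.dJmu_assemble w η z β).symm⟩

theorem exists_mem_Z (hreg : 𝓢.IsRegular p) (ν : Dual ℝ (𝓢.gmu p)) : ∃ z ∈ σ.Z, 𝓢.dJmu p z = ν := by
  obtain ⟨z, hz⟩ := (σ.dJmu_bijective hreg).2 ν
  exact ⟨z, z.2, hz⟩

section Nilpotent
variable {N23 : LinearMap.BilinForm ℝ (Dual ℝ (𝓢.gmu p))}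
  {N21 : 𝓢.RedTangent p →ₗ[ℝ] 𝓢.gmu p} {lam : ℝ}

/-- In terms of representatives in `Z`, the form `N²³` is `ω(N z, z')`. -/
theorem bilin_of_isN23 (h : IsN23 σ N N23) {z z' : TangentSpace 𝓘(ℝ, EP) p} (hz : z ∈ σ.Z) (hz' :
    z' ∈ σ.Z) :
    N23 (𝓢.dJmu p z) (𝓢.dJmu p z') = 𝓢.symp.bilin p (N z) z' := by
  obtain ⟨w, hw, η, hN, hη⟩ := h z (σ.Z_le hz)
  rw [hη, hN, map_add, LinearMap.add_apply, (σ.mem_orthogonal.1 (σ.Z_le hz')).1 w hw, zero_add,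
    dJmu_apply]

theorem exists_isN23 [CompactSpace G] [T2Space G] (hp : 𝓢.IsRelativeEquilibrium p ξ) (hreg :
    𝓢.IsRegular p)
    (hSN : IsJordanDecomposition (𝓢.lin p ξ) S N) : ∃ N23, IsN23 σ N N23 := by
  let e := LinearEquiv.ofBijective _ (σ.dJmu_bijective hreg)
  let ρ : Dual ℝ (𝓢.gmu p) →ₗ[ℝ] TangentSpace 𝓘(ℝ, EP) p := σ.Z.subtype ∘ₗ e.symm.toLinearMap
  have hρ (ν) : 𝓢.dJmu p (ρ ν) = ν := e.apply_symm_apply ν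
  have hρ' (z : σ.Z) : ρ (𝓢.dJmu p z) = z := congrArg Subtype.val (e.symm_apply_apply z)
  have hρZ (ν) : ρ ν ∈ σ.Z := (e.symm ν).2
  refine ⟨(𝓢.symp.bilin p).compl₁₂ (N ∘ₗ ρ) ρ, fun v hv => ?_⟩
  have hv' := hv
  rw [bOrbit, ← σ.Z_sup] at hv'
  obtain ⟨z, hz, _, ⟨ζ, hζ, rfl⟩, rfl⟩ := Submodule.mem_sup.1 hv'
  have hk := hp.nilpotent_mem_kerdJ hreg hSN z
  rw [← σ.W_sup] at hk
  obtain ⟨w, hw, _, ⟨η, hη, rfl⟩, hN⟩ := Submodule.mem_sup.1 hk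
  refine ⟨w, hw, ⟨η, hη⟩, ?_, fun ν => ?_⟩
  · rw [map_add, hp.nilpotent_infGen hreg hSN, add_zero, hN]
  · rw [map_add, dJmu_infGen, add_zero, LinearMap.compl₁₂_apply, LinearMap.comp_apply, hρ' ⟨z, hz⟩,
      ← hN, map_add,
      LinearMap.add_apply, (σ.mem_orthogonal.1 (σ.Z_le (hρZ ν))).1 w hw, zero_add]
    conv_rhs => rw [← hρ ν]
    exact (dJmu_apply (ρ ν) ⟨η, hη⟩).symm

theorem isN23_symm (hp : 𝓢.IsRelativeEquilibrium p ξ) (hreg : 𝓢.IsRegular p)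
    (hSN : IsJordanDecomposition (𝓢.lin p ξ) S N) (h : IsN23 σ N N23) (ν ν') : N23 ν ν' =
      N23 ν' ν := by
  obtain ⟨z, hz, rfl⟩ := σ.exists_mem_Z hreg ν
  obtain ⟨z', hz', rfl⟩ := σ.exists_mem_Z hreg ν'
  rw [σ.bilin_of_isN23 h hz hz', σ.bilin_of_isN23 h hz' hz, hp.bilin_nilpotent hSN, ← bilin_swap]

/-- `N²³` is infinitesimally invariant under the coadjoint action of `ξ`, since the semisimple part
`S` is skew, commutes with `N`, preserves `Z` and induces the transpose of `ad_ξ` on `𝔤_μ*`. -/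
theorem isN23_skew [CompactSpace G] [T2Space G] (hp : 𝓢.IsRelativeEquilibrium p ξ) (hreg :
    𝓢.IsRegular p)
    (hSN : IsJordanDecomposition (𝓢.lin p ξ) S N) (h : IsN23 σ N N23) (ν ν') :
    N23 ((𝓢.adMu p ξ).dualMap ν) ν' = -N23 ν ((𝓢.adMu p ξ).dualMap ν') := by
  have key (z) : (𝓢.adMu p ξ).dualMap (𝓢.dJmu p z) = 𝓢.dJmu p (S z) := by
    have h1 : S z = 𝓢.lin p ξ z - N z :=
      by rw [hSN.sum_eq, LinearMap.add_apply, add_sub_cancel_right]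
    rw [h1, map_sub, dJmu_of_mem_kerdJ (hp.nilpotent_mem_kerdJ hreg hSN z), sub_zero]
    refine LinearMap.ext fun η => ?_
    rw [LinearMap.dualMap_apply, dJmu_apply, hp.adMu_apply, dJmu_apply, ← dJ_apply, ← dJ_apply,
      hp.dJ_lin]
  obtain ⟨z, hz, rfl⟩ := σ.exists_mem_Z hreg ν
  obtain ⟨z', hz', rfl⟩ := σ.exists_mem_Z hreg ν'
  rw [key, key, σ.bilin_of_isN23 h (σ.Z_invariant z hz) hz', σ.bilin_of_isN23 h hz
    (σ.Z_invariant z' hz'),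
    ← hp.bilin_semisimple hSN, ← Module.End.mul_apply, ← Module.End.mul_apply, hSN.commute.eq]

theorem nilHamiltonian_assemble [CompactSpace G] [T2Space G] (hp : 𝓢.IsRelativeEquilibrium p ξ)
    (hreg : 𝓢.IsRegular p)
    (hSN : IsJordanDecomposition (𝓢.lin p ξ) S N) (h21 : 𝓢.IsN21 p N N21) (h : IsN23 σ N N23)
    (w : σ.W) (η : 𝓢.gmu p) (z : σ.Z) (β : σ.b) :
    𝓢.nilHamiltonian p N (σ.assemble w η z β) = 𝓢.nilNormalForm p N21 N23 (σ.toRed w)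
      (𝓢.dJmu p z) := by
  have hk := hp.nilpotent_mem_kerdJ hreg hSN
  have h1 : N (σ.assemble w η z β) = N w + N z := by
    rw [assemble, map_add, map_add, map_add, hp.nilpotent_infGen hreg hSN,
      hp.nilpotent_infGen hreg hSN, add_zero, add_zero]
  have h2 : N w = infGen p (N21 (σ.toRed w) : GroupLieAlgebra 𝓘(ℝ, EG) G) := h21 ⟨w, σ.W_le w.2⟩
  have h3 : 𝓢.symp.bilin p (N w) w = 0 := by rw [h2, mem_kerdJ.1 (σ.W_le w.2)]
  have h4 : 𝓢.symp.bilin p (N w) z = 𝓢.dJmu p z (N21 (σ.toRed w)) := by rw [h2, dJmu_apply]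
  have h5 : 𝓢.symp.bilin p (N z) w = 𝓢.dJmu p z (N21 (σ.toRed w)) := by
    rw [hp.bilin_nilpotent hSN, ← bilin_swap, h4]
  rw [nilHamiltonian, h1, assemble]
  simp only [map_add, LinearMap.add_apply, bilin_infGen_kerdJ _ (hk _), h3, h4, h5]
  rw [nilNormalForm, σ.bilin_of_isN23 h z.2 z.2]
  ring

/-- The resonant and nonresonant parts of `𝔤_μ*` are orthogonal for `N²³`: they are the kernel and
the range of the transpose of `ad_ξ² + λ²`, which is symmetric for `N²³`. -/
theorem isN23_eq_zero [CompactSpace G] [T2Space G] (hp : 𝓢.IsRelativeEquilibrium p ξ) (hreg :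
    𝓢.IsRegular p)
    (hSN : IsJordanDecomposition (𝓢.lin p ξ) S N) (hres : 𝓢.IsResonant p ξ lam) (h : IsN23 σ N N23)
    {ν₀ ν₁ : Dual ℝ (𝓢.gmu p)} (h0 : ν₀ ∈ 𝓢.dualNonres p ξ lam) (h1 : ν₁ ∈ 𝓢.dualRes p ξ lam) :
      N23 ν₀ ν₁ = 0 := by
  -- `𝔤_μ^{0*}`, the annihilator of a kernel, is the range of the transpose
  rw [dualNonres, hres.gmuRes_eq, ← LinearMap.range_dualMap_eq_dualAnnihilator_ker] at h0
  obtain ⟨ν, rfl⟩ := h0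
  have e (ν : Dual ℝ (𝓢.gmu p)) : (realQuad (𝓢.adMu p ξ) (Complex.I * lam)).dualMap ν =
      (𝓢.adMu p ξ).dualMap ((𝓢.adMu p ξ).dualMap ν) + lam ^ 2 • ν := by
    refine LinearMap.ext fun η => ?_
    rw [LinearMap.dualMap_apply, realQuad_I_mul]
    simp
  have h2 : (realQuad (𝓢.adMu p ξ) (Complex.I * lam)).dualMap ν₁ = 0 := LinearMap.ext fun η => by
    refine (Submodule.mem_dualAnnihilator ν₁).1 h1 _ ?_
    rw [hres.gmuNonres_eq]
    exact ⟨η, rfl⟩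
  have h3 := congrArg (N23 ν) h2
  rw [e, map_add, map_smul, map_zero] at h3
  rw [e, map_add, LinearMap.add_apply, map_smul, LinearMap.smul_apply, σ.isN23_skew hp hreg hSN h,
    σ.isN23_skew hp hreg hSN h, neg_neg, h3]

end Nilpotent
end Splitting
end
end HamiltonianSystem

/-! ### Exponentials and the invariance of the nilpotent Hamiltonian -/

section Exponential
variable {V : Type*} [AddCommGroup V] [Module ℝ V] [FiniteDimensional ℝ V]

theorem expEnd_zero : expEnd (0 : Module.End ℝ V) = 1 := by
  rw [expEnd, map_zero, NormedSpace.exp_zero, Matrix.toLin_one]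
  rfl

open scoped Matrix.Norms.Operator in
/-- `d/dt exp(tT) x = T exp(tT) x`. -/
theorem hasWeakDerivAt_expEnd (T : Module.End ℝ V) (x : V) (t : ℝ) :
    HasWeakDerivAt (fun s => expEnd (s • T) x) (T (expEnd (t • T) x)) t := by
  intro ℓ
  set e := finBasis ℝ V
  set M := LinearMap.toMatrix e e T with hM
  let F : Matrix _ _ ℝ →ₗ[ℝ] ℝ := ℓ ∘ₗ LinearMap.applyₗ x ∘ₗ (Matrix.toLin e e).toLinearMap
  have h1 := hasDerivAt_exp_smul_const' M t
  have h2 := (LinearMap.toContinuousLinearMap F).hasFDerivAt.comp_hasDerivAt t h1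
  have h3 : LinearMap.toContinuousLinearMap F (M * NormedSpace.exp (t • M)) = ℓ
    (T (expEnd (t • T) x)) := by
    change ℓ (Matrix.toLin e e (M * NormedSpace.exp (t • M)) x) = _
    rw [Matrix.toLin_mul e e e, hM, Matrix.toLin_toMatrix, expEnd, map_smul]
    rfl
  have h4 : (LinearMap.toContinuousLinearMap F ∘ fun u : ℝ => NormedSpace.exp (u • M)) = fun s => ℓ
    (expEnd (s • T) x) := by
    ext s
    change ℓ (Matrix.toLin e e (NormedSpace.exp (s • M)) x) = _
    rw [expEnd, map_smul]
  exact (h2.congr_deriv h3).congr_of_eventuallyEq (Eventually.of_forall fun s =>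
    (congrFun h4 s).symm)

theorem hasWeakDerivAt_dual {u : ℝ → Dual ℝ V} {u' : Dual ℝ V} {t : ℝ} (h : ∀ x, HasDerivAt
    (fun s => u s x) (u' x) t) :
    HasWeakDerivAt u u' t := fun ℓ => by
  obtain ⟨x, rfl⟩ := (Module.evalEquiv ℝ V).surjective ℓ
  exact h x

end Exponential

namespace HamiltonianSystem
section
variable {EG : Type*} [NormedAddCommGroup EG] [NormedSpace ℝ EG] [FiniteDimensional ℝ EG]
  {G : Type*} [TopologicalSpace G] [ChartedSpace EG G] [Group G] [LieGroup 𝓘(ℝ, EG) ∞ G]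
  {EP : Type*} [NormedAddCommGroup EP] [NormedSpace ℝ EP] [FiniteDimensional ℝ EP]
  {P : Type*} [TopologicalSpace P] [ChartedSpace EP P] [IsManifold 𝓘(ℝ, EP) ∞ P] [MulAction G P]
  {𝓢 : HamiltonianSystem EG G EP P} {p : P} {ξ : GroupLieAlgebra 𝓘(ℝ, EG) G}

theorem oneParameter_mem_toralClosure {c : ℝ → G} (hc : IsOneParameterSubgroup c ξ) (t : ℝ) :
    c t ∈ toralClosure ξ :=
  subset_closure ⟨c, t, hc, rfl⟩

/-- `T_ξ` fixes `ξ`. -/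
theorem Ad_generator {g : G} (hg : g ∈ toralClosure ξ) : Ad g ξ = ξ := by
  have h1 (ℓ : Dual ℝ (GroupLieAlgebra 𝓘(ℝ, EG) G)) : ℓ (Ad g ξ) = ℓ ξ := by
    have hcl : IsClosed {g : G | ℓ (Ad g ξ) = ℓ ξ} := isClosed_eq (continuous_Ad _ _)
      continuous_const
    refine closure_minimal (fun g hg => ?_) hcl hg
    obtain ⟨c, t, hc, rfl⟩ := hg
    have h2 (s : ℝ) : HasDerivAt (fun s => ℓ (Ad (c s) ξ)) 0 s := by
      have := hc.hasWeakDerivAt_Ad s ξ ℓ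
      rwa [lie_self, map_zero, map_zero] at this
    have h3 := eq_of_hasDerivAt_zero h2 t 0
    rwa [hc.map_zero, Ad_one, Module.End.one_apply] at h3
  rw [← sub_eq_zero]
  refine (Module.forall_dual_apply_eq_zero_iff ℝ _).1 fun ℓ => ?_
  rw [map_sub, h1, sub_self]

theorem Ad_inv_ad {g : G} (hg : g ∈ toralClosure ξ) (η : GroupLieAlgebra 𝓘(ℝ, EG) G) :
    Ad g⁻¹ (ad ξ η) = ad ξ (Ad g⁻¹ η) := by
  have h1 : Ad g⁻¹ ξ = ξ := by
    conv_lhs => rw [← Ad_generator hg]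
    exact Ad_inv_Ad g ξ
  change Ad g⁻¹ ⁅ξ, η⁆ = ⁅ξ, Ad g⁻¹ η⁆
  rw [Ad_lie, h1]

section Coadjoint
variable {lam : ℝ}

theorem coAdMu_mem_dualNonres (hp : 𝓢.IsRelativeEquilibrium p ξ) (hres : 𝓢.IsResonant p ξ lam) {g :
    G} (hg : g ∈ toralClosure ξ)
    {ν : Dual ℝ (𝓢.gmu p)} (hν : ν ∈ 𝓢.dualNonres p ξ lam) :
      𝓢.coAdMu p g ν ∈ 𝓢.dualNonres p ξ lam := by
  have hJ := J_Ad_of_mem_toralClosure hp.mem_gmu hg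
  refine (Submodule.mem_dualAnnihilator _).2 fun η hη => ?_
  rw [coAdMu_apply hJ]
  refine (Submodule.mem_dualAnnihilator ν).1 hν _ ?_
  rw [hres.mem_gmuRes] at hη ⊢
  have h1 := congrArg (fun η : 𝓢.gmu p => Ad g⁻¹ (η : GroupLieAlgebra 𝓘(ℝ, EG) G)) hη
  refine Subtype.ext ?_
  simp only [Submodule.coe_add, Submodule.coe_smul, hp.adMu_apply, map_add, map_smul, Ad_inv_ad hg,
    Submodule.coe_zero, map_zero] at h1 ⊢
  exact h1

theorem coAdMu_mem_dualRes (hp : 𝓢.IsRelativeEquilibrium p ξ) (hres : 𝓢.IsResonant p ξ lam) {g : G}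
    (hg : g ∈ toralClosure ξ)
    {ν : Dual ℝ (𝓢.gmu p)} (hν : ν ∈ 𝓢.dualRes p ξ lam) : 𝓢.coAdMu p g ν ∈ 𝓢.dualRes p ξ lam := by
  have hJ := J_Ad_of_mem_toralClosure hp.mem_gmu hg
  refine (Submodule.mem_dualAnnihilator _).2 fun η hη => ?_
  rw [coAdMu_apply hJ]
  refine (Submodule.mem_dualAnnihilator ν).1 hν _ ?_
  rw [hres.mem_gmuNonres] at hη ⊢
  obtain ⟨ζ, rfl⟩ := hη
  refine ⟨⟨Ad g⁻¹ ζ, Ad_mem_gmu (J_Ad_inv hJ) ζ.2⟩, Subtype.ext ?_⟩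
  simp only [Submodule.coe_add, Submodule.coe_smul, hp.adMu_apply, map_add, map_smul, Ad_inv_ad hg]

/-- `d/dt CoAd_{c(t)} ν = -CoAd_{c(t)} ν ∘ ad_ξ`. -/
theorem hasWeakDerivAt_coAdMu (hp : 𝓢.IsRelativeEquilibrium p ξ) {c : ℝ → G} (hc :
    IsOneParameterSubgroup c ξ)
    (ν : Dual ℝ (𝓢.gmu p)) (t : ℝ) :
    HasWeakDerivAt (fun s => 𝓢.coAdMu p (c s) ν) (-(𝓢.adMu p ξ).dualMap (𝓢.coAdMu p (c t) ν)) t :=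
      by
  refine hasWeakDerivAt_dual fun η => ?_
  obtain ⟨ν', rfl⟩ := Subspace.dualRestrict_surjective (W := 𝓢.gmu p) ν
  have hJ (s : ℝ) := J_Ad_of_mem_toralClosure hp.mem_gmu (oneParameter_mem_toralClosure hc s)
  have h1 (s : ℝ) (η : 𝓢.gmu p) : 𝓢.coAdMu p (c s) ((𝓢.gmu p).dualRestrict ν') η = ν' (Ad (c (-s))
    η) := by
    rw [coAdMu_apply (hJ s), hc.map_neg]
    rfl
  simp only [h1]
  rw [LinearMap.neg_apply, LinearMap.dualMap_apply, h1, hp.adMu_apply]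
  have h2 := (hc.hasWeakDerivAt_Ad (-t) (η : GroupLieAlgebra 𝓘(ℝ, EG) G) ν').scomp t
    (hasDerivAt_neg t)
  refine h2.congr_deriv ?_
  rw [neg_smul, one_smul]
  rfl

theorem coAdMu_zero (hp : 𝓢.IsRelativeEquilibrium p ξ) {c : ℝ → G} (hc : IsOneParameterSubgroup c ξ)
    (ν : Dual ℝ (𝓢.gmu p)) : 𝓢.coAdMu p (c 0) ν = ν := by
  refine LinearMap.ext fun η => ?_
  rw [coAdMu_apply (J_Ad_of_mem_toralClosure hp.mem_gmu (oneParameter_mem_toralClosure hc 0))]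
  congr 1
  refine Subtype.ext ?_
  change Ad (c 0)⁻¹ _ = _
  rw [hc.map_zero, inv_one, Ad_one, Module.End.one_apply]

/-- A form that is infinitesimally invariant under the coadjoint action of `ξ` is invariant under
the closure `T_ξ` of its one-parameter subgroup. -/
theorem bilin_coAdMu (hp : 𝓢.IsRelativeEquilibrium p ξ) {N23 : LinearMap.BilinForm ℝ
    (Dual ℝ (𝓢.gmu p))}
    (h : ∀ ν ν', N23 ((𝓢.adMu p ξ).dualMap ν) ν' = -N23 ν ((𝓢.adMu p ξ).dualMap ν')) {g : G} (hg :
      g ∈ toralClosure ξ)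
    (ν ν' : Dual ℝ (𝓢.gmu p)) : N23 (𝓢.coAdMu p g ν) (𝓢.coAdMu p g ν') = N23 ν ν' := by
  obtain ⟨μ, hμ⟩ := Subspace.dualRestrict_surjective (W := 𝓢.gmu p) ν
  obtain ⟨μ', hμ'⟩ := Subspace.dualRestrict_surjective (W := 𝓢.gmu p) ν'
  -- The coadjoint action on `𝔤_μ*` is defined by the restriction of `Ad g⁻¹` for `g ∈ G_μ` only;
  -- `R` is the same on `T_ξ` and continuous on all of `G`.
  let R : Dual ℝ (GroupLieAlgebra 𝓘(ℝ, EG) G) → G → Dual ℝ (𝓢.gmu p) := fun μ g =>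
    (𝓢.gmu p).dualRestrict (μ ∘ₗ Ad g⁻¹)
  have hR (μ : Dual ℝ (GroupLieAlgebra 𝓘(ℝ, EG) G)) {g : G} (hg : g ∈ toralClosure ξ) :
      𝓢.coAdMu p g ((𝓢.gmu p).dualRestrict μ) = R μ g := by
    have hJ := J_Ad_of_mem_toralClosure hp.mem_gmu hg
    refine LinearMap.ext fun η => ?_
    rw [coAdMu_apply hJ]
    rfl
  have hcont (μ : Dual ℝ (GroupLieAlgebra 𝓘(ℝ, EG) G)) (ℓ : Dual ℝ (Dual ℝ (𝓢.gmu p))) :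
    Continuous fun g => ℓ (R μ g) := by
    have := topologicalGroup_of_lieGroup 𝓘(ℝ, EG) (G := G) ∞
    obtain ⟨η, rfl⟩ := (Module.evalEquiv ℝ (𝓢.gmu p)).surjective ℓ
    exact (continuous_Ad μ (η : GroupLieAlgebra 𝓘(ℝ, EG) G)).comp continuous_inv
  have hcl : IsClosed {g : G | N23 (R μ g) (R μ' g) = N23 ν ν'} :=
    isClosed_eq (continuous_bilin (hcont μ) (hcont μ') N23) continuous_const
  have h1 : g ∈ {g : G | N23 (R μ g) (R μ' g) = N23 ν ν'} := by
    refine closure_minimal (fun g hg => ?_) hcl hg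
    have hg' : g ∈ toralClosure ξ := subset_closure hg
    obtain ⟨c, t, hc, rfl⟩ := hg
    have hd (s : ℝ) : HasDerivAt (fun s => N23 (𝓢.coAdMu p (c s) ν) (𝓢.coAdMu p (c s) ν')) 0 s := by
      have h2 := (hasWeakDerivAt_coAdMu hp hc ν s).bilin (hasWeakDerivAt_coAdMu hp hc ν' s) N23
      rw [map_neg, LinearMap.neg_apply, h, map_neg, neg_neg, add_neg_cancel] at h2
      exact h2
    have h3 := eq_of_hasDerivAt_zero hd t 0
    rw [coAdMu_zero hp hc, coAdMu_zero hp hc] at h3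
    change N23 (R μ (c t)) (R μ' (c t)) = _
    rw [← hR μ hg', ← hR μ' hg', hμ, hμ', h3]
  have h2 : N23 (R μ g) (R μ' g) = N23 ν ν' := h1
  rw [← h2, ← hμ, ← hμ', hR μ hg, hR μ' hg]

/-- The pairing `⟨ν, N²¹x⟩` is invariant under the simultaneous rotation of `ν` and `x`: its
derivative vanishes by `N²¹ L = -ad_ξ N²¹`. -/
theorem pairing_circle (hp : 𝓢.IsRelativeEquilibrium p ξ) {N21 : 𝓢.RedTangent p →ₗ[ℝ] 𝓢.gmu p}
    (hL : ∀ x, N21 (𝓢.redLin p ξ x) = -𝓢.adMu p ξ (N21 x)) {c : ℝ → G} (hc :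
      IsOneParameterSubgroup c ξ) (lam θ : ℝ)
    (ν : Dual ℝ (𝓢.gmu p)) (x : 𝓢.RedTangent p) :
    𝓢.coAdMu p (c (θ / lam)) ν (N21 (𝓢.circleRed p ξ lam (-θ) x)) = ν (N21 x) := by
  have hd (s : ℝ) : HasDerivAt (fun s => 𝓢.coAdMu p (c s) ν (N21 (expEnd (s • (-𝓢.redLin p ξ)) x)))
    0 s := by
    have h2 := (hasWeakDerivAt_coAdMu hp hc ν s).bilin ((hasWeakDerivAt_expEnd (-𝓢.redLin p ξ)
      x s).map N21) LinearMap.id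
    simpa [hL] using h2
  have h3 := eq_of_hasDerivAt_zero hd (θ / lam) 0
  rw [coAdMu_zero hp hc, zero_smul, expEnd_zero, Module.End.one_apply] at h3
  have h5 : (-θ / lam) • 𝓢.redLin p ξ = (θ / lam) • (-𝓢.redLin p ξ) := by
    refine LinearMap.ext fun y => ?_
    simp [neg_div]
  rw [circleRed, h5, h3]

/-- The normal form of `H_nil` is invariant under `T_ξ × S¹`: the groups preserve the summands of
`𝔤_μ*`, between which `N²³` has no cross terms, and `𝔤_μ^{0*}` annihilates the image of `N²¹`. -/
theorem nilNormalForm_invariant (hp : 𝓢.IsRelativeEquilibrium p ξ) (hres : 𝓢.IsResonant p ξ lam)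
    {N21 : 𝓢.RedTangent p →ₗ[ℝ] 𝓢.gmu p} {N23 : LinearMap.BilinForm ℝ (Dual ℝ (𝓢.gmu p))}
    (hL : ∀ x, N21 (𝓢.redLin p ξ x) = -𝓢.adMu p ξ (N21 x)) (hr :
      LinearMap.range N21 ≤ 𝓢.gmuRes p ξ lam)
    (hsymm : ∀ ν ν', N23 ν ν' = N23 ν' ν)
    (hskew : ∀ ν ν', N23 ((𝓢.adMu p ξ).dualMap ν) ν' = -N23 ν ((𝓢.adMu p ξ).dualMap ν'))
    (hcross : ∀ ν₀ ∈ 𝓢.dualNonres p ξ lam, ∀ ν₁ ∈ 𝓢.dualRes p ξ lam, N23 ν₀ ν₁ = 0)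
    {c : ℝ → G} (hc : IsOneParameterSubgroup c ξ) {t : G} (ht : t ∈ toralClosure ξ) (θ : ℝ) (x :
      𝓢.RedTangent p)
    {ν₀ ν₁ : Dual ℝ (𝓢.gmu p)} (h0 : ν₀ ∈ 𝓢.dualNonres p ξ lam) (h1 : ν₁ ∈ 𝓢.dualRes p ξ lam) :
    𝓢.nilNormalForm p N21 N23 (𝓢.circleRed p ξ lam (-θ) x) (𝓢.coAdMu p t ν₀ + 𝓢.coAdMu p
      (c (θ / lam)) ν₁) =
      𝓢.nilNormalForm p N21 N23 x (ν₀ + ν₁) := by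
  have hct := oneParameter_mem_toralClosure hc (θ / lam)
  have h0' := coAdMu_mem_dualNonres hp hres ht h0
  have h1' := coAdMu_mem_dualRes hp hres hct h1
  have hz {ν : Dual ℝ (𝓢.gmu p)} (hν : ν ∈ 𝓢.dualNonres p ξ lam) (y) : ν (N21 y) = 0 :=
    (Submodule.mem_dualAnnihilator ν).1 hν _ (hr ⟨y, rfl⟩)
  simp only [nilNormalForm, map_add, LinearMap.add_apply, hz h0, hz h0', pairing_circle hp hL hc,
    bilin_coAdMu hp hskew ht,
    bilin_coAdMu hp hskew hct, hcross _ h0 _ h1, hcross _ h0' _ h1', hsymm ν₁ ν₀, hsymm (𝓢.coAdMu p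
      (c (θ / lam)) ν₁)]

end Coadjoint
end
end HamiltonianSystem

/-! ### Adapted bases -/

theorem exists_cos_sin_eq {x y : ℝ} (h : x ^ 2 + y ^ 2 = 1) : ∃ θ : ℝ, Real.cos θ = x ∧ Real.sin θ =
    y := by
  have h1 : ‖(⟨x, y⟩ : ℂ)‖ = 1 := by
    rw [Complex.norm_def, Complex.normSq_mk, ← sq, ← sq, h, Real.sqrt_one]
  refine ⟨Complex.arg ⟨x, y⟩, ?_, ?_⟩
  · have := Complex.norm_mul_cos_arg (⟨x, y⟩ : ℂ)
    rwa [h1, one_mul] at this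
  · have := Complex.norm_mul_sin_arg (⟨x, y⟩ : ℂ)
    rwa [h1, one_mul] at this

theorem exists_basis_of_pair {V : Type*} [AddCommGroup V] [Module ℝ V] [FiniteDimensional ℝ V] {K :
    Submodule ℝ V} (hK : finrank ℝ K ≤ 2)
    {u v : V} (hu : u ∈ K) (hv : v ∈ K) (h : ∀ a b : ℝ, a • u + b • v = 0 → a = 0 ∧ b = 0) :
    ∃ f : Basis (Fin 2) ℝ K, (f 0 : V) = u ∧ (f 1 : V) = v := by
  have hl : LinearIndependent ℝ ![(⟨u, hu⟩ : K), ⟨v, hv⟩] := by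
    rw [LinearIndependent.pair_iff]
    intro a b hab
    exact h a b (congrArg Subtype.val hab)
  have hc : Fintype.card (Fin 2) = finrank ℝ K :=
    le_antisymm hl.fintype_card_le_finrank (by simpa using hK)
  exact ⟨basisOfLinearIndependentOfCardEqFinrank hl hc, by simp, by simp⟩

theorem basis_expansion {V : Type*} [AddCommGroup V] [Module ℝ V] {K : Submodule ℝ V} (f :
    Basis (Fin 2) ℝ K) {u : V} (hu : u ∈ K) :
    ∃ a b : ℝ, u = a • (f 0 : V) + b • (f 1 : V) := by
  refine ⟨f.repr ⟨u, hu⟩ 0, f.repr ⟨u, hu⟩ 1, ?_⟩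
  have := congrArg Subtype.val (f.sum_repr ⟨u, hu⟩)
  rw [Fin.sum_univ_two] at this
  exact this.symm

namespace HamiltonianSystem
section
variable {EG : Type*} [NormedAddCommGroup EG] [NormedSpace ℝ EG] [FiniteDimensional ℝ EG]
  {G : Type*} [TopologicalSpace G] [ChartedSpace EG G] [Group G] [LieGroup 𝓘(ℝ, EG) ∞ G]
  {EP : Type*} [NormedAddCommGroup EP] [NormedSpace ℝ EP] [FiniteDimensional ℝ EP]
  {P : Type*} [TopologicalSpace P] [ChartedSpace EP P] [IsManifold 𝓘(ℝ, EP) ∞ P] [MulAction G P]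
  {𝓢 : HamiltonianSystem EG G EP P} {p : P} {ξ : GroupLieAlgebra 𝓘(ℝ, EG) G} {lam s : ℝ}
  {B : LinearMap.BilinForm ℝ (GroupLieAlgebra 𝓘(ℝ, EG) G)}
  {f f' : Basis (Fin 2) ℝ (𝓢.redRes p ξ lam)} {e e' : Basis (Fin 2) ℝ (𝓢.gmuRes p ξ lam)}

/-- The sign of an adapted basis is the sign of the reduced Hessian, since `ω_μ(L f₁, f₁) = sλ` in
an adapted basis with sign `s`. -/
theorem not_isAdapted_neg (hl : 0 < lam) (hs : s = 1 ∨ s = -1)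
    (hdef : ∀ x : 𝓢.RedTangent p, x ≠ 0 → 0 < s * 𝓢.redForm p (𝓢.redLin p ξ x) x) :
      ¬ 𝓢.IsAdapted p ξ lam B (-s) f e := by
  intro h
  have h0 : (f 0 : 𝓢.RedTangent p) ≠ 0 := fun h0 => f.ne_zero 0 (Subtype.ext h0)
  have h1 := hdef _ h0
  rw [h.red_zero, map_smul, LinearMap.smul_apply, redForm_swap, h.darboux, smul_eq_mul] at h1
  rcases hs with rfl | rfl <;> linarith

/-- A Darboux basis `f₁, f₂` of `W_red¹` on which `L` is a rotation with the sign `s` of the reduced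
Hessian. -/
theorem exists_red_basis (hp : 𝓢.IsRelativeEquilibrium p ξ) (hres : 𝓢.IsResonant p ξ lam) (hs :
    s = 1 ∨ s = -1)
    (hdef : ∀ x : 𝓢.RedTangent p, x ≠ 0 → 0 < s * 𝓢.redForm p (𝓢.redLin p ξ x) x) :
    ∃ f : Basis (Fin 2) ℝ (𝓢.redRes p ξ lam), 𝓢.redForm p (f 0) (f 1) = 1 ∧
      𝓢.redLin p ξ (f 0) = -(s * lam) • (f 1 : 𝓢.RedTangent p) ∧ 𝓢.redLin p ξ (f 1) = (s * lam) •
        (f 0 : 𝓢.RedTangent p) := by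
  have hl := hres.pos
  have hs2 : s * s = 1 := by rcases hs with rfl | rfl <;> norm_num
  obtain ⟨v, hv, hv2⟩ := exists_ne_zero_mem_ker_realQuad (𝓢.redLin p ξ) hres.mult_reduced
  set m := s * 𝓢.redForm p (𝓢.redLin p ξ v) v with hm
  have hmpos : 0 < m := hdef v hv
  -- `u = r v` with `r² = λ / m` makes `s ω_μ(L u, u) = λ`, which is `ω_μ(u, w) = 1` for `w = -(s /
  -- λ) L u`
  set r := Real.sqrt (lam / m) with hr
  have hr2 : r * r = lam / m := Real.mul_self_sqrt (by positivity)
  set u := r • v with hu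
  set w := -(s / lam) • 𝓢.redLin p ξ u with hw
  have hu2 : 𝓢.redLin p ξ (𝓢.redLin p ξ u) = -lam ^ 2 • u := by
    rw [hu, map_smul, map_smul, hv2, smul_comm]
  have e1 : 𝓢.redLin p ξ u = -(s * lam) • w := by
    rw [hw, smul_smul]
    have : -(s * lam) * -(s / lam) = 1 := by field_simp; linarith
    rw [this, one_smul]
  have e2 : 𝓢.redLin p ξ w = (s * lam) • u := by
    rw [hw, map_smul, hu2, smul_smul]
    congr 1
    field_simp
  have e3 : 𝓢.redForm p u w = 1 := by
    have h1 : 𝓢.redForm p (𝓢.redLin p ξ u) u = r * r * 𝓢.redForm p (𝓢.redLin p ξ v) v := by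
      rw [hu, map_smul, map_smul, map_smul, LinearMap.smul_apply, smul_eq_mul, smul_eq_mul,
        mul_assoc]
    have h2 : 𝓢.redForm p u w = (s / lam) * 𝓢.redForm p (𝓢.redLin p ξ u) u := by
      rw [hw, map_smul, smul_eq_mul, hp.redForm_redLin]
      ring
    have h3 : s * 𝓢.redForm p (𝓢.redLin p ξ v) v = m := rfl
    rw [h2, h1, hr2]
    have : s / lam * (lam / m * 𝓢.redForm p (𝓢.redLin p ξ v) v) = (s * 𝓢.redForm p (𝓢.redLin p ξ v)
      v) / m := by
      field_simp
    rw [this, h3, div_self hmpos.ne']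
  have hmem : u ∈ 𝓢.redRes p ξ lam := by
    rw [hres.mem_redRes, hu2, neg_smul, neg_add_cancel]
  have hmem' : w ∈ 𝓢.redRes p ξ lam := by
    rw [hres.mem_redRes, e2, map_smul, e1, smul_smul, ← add_smul]
    have : s * lam * -(s * lam) + lam ^ 2 = 0 := by linear_combination (-lam ^ 2) * hs2
    rw [this, zero_smul]
  have hfr : finrank ℝ (𝓢.redRes p ξ lam) ≤ 2 := by
    rw [hres.redRes_eq]
    exact finrank_ker_realQuad_le _ hl hres.mult_reduced
  have huu (x : 𝓢.RedTangent p) : 𝓢.redForm p x x = 0 := by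
    have := redForm_swap x x
    linarith
  obtain ⟨f, rfl', rfl''⟩ := exists_basis_of_pair hfr hmem hmem' fun a b hab => by
    have h1 := congrArg (𝓢.redForm p u) hab
    have h2 := congrArg (𝓢.redForm p w) hab
    simp only [map_add, map_smul, huu, e3, redForm_swap w u, smul_eq_mul, map_zero] at h1 h2
    constructor <;> linarith
  exact ⟨f, by rw [rfl', rfl'', e3], by rw [rfl', rfl'', e1], by rw [rfl', rfl'', e2]⟩

/-- An orthonormal basis `e₁, e₂` of `𝔤_μ¹` on which `ad_ξ` is a rotation with sign `s`, and whose
first vector has the direction of a given `v ≠ 0`. -/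
theorem exists_group_basis (hp : 𝓢.IsRelativeEquilibrium p ξ) (hB : IsAdInvariantInner B) (hres :
    𝓢.IsResonant p ξ lam)
    (hs : s = 1 ∨ s = -1) {v : 𝓢.gmu p} (hv : v ∈ 𝓢.gmuRes p ξ lam) (hv0 : v ≠ 0) :
    ∃ e : Basis (Fin 2) ℝ (𝓢.gmuRes p ξ lam), (∀ i j : Fin 2, B (e i : 𝓢.gmu p) (e j : 𝓢.gmu p) =
      if i = j then 1 else 0) ∧
      𝓢.adMu p ξ (e 0) = (s * lam) • (e 1 : 𝓢.gmu p) ∧ 𝓢.adMu p ξ (e 1) = -(s * lam) • (e 0 :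
        𝓢.gmu p) ∧
      v = Real.sqrt (B v v) • (e 0 : 𝓢.gmu p) := by
  have hl := hres.pos
  have hs2 : s * s = 1 := by rcases hs with rfl | rfl <;> norm_num
  let b : LinearMap.BilinForm ℝ (𝓢.gmu p) := B.restrict (𝓢.gmu p)
  have hb : ∀ η ζ : 𝓢.gmu p, B η ζ = b η ζ := fun _ _ => rfl
  have hskew : ∀ η ζ, b (𝓢.adMu p ξ η) ζ = -b η (𝓢.adMu p ξ ζ) := adMu_skew hp hB
  have hsymm : ∀ η ζ, b η ζ = b ζ η := fun η ζ => hB.symm _ _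
  have hpos : 0 < b v v := hB.pos _ fun h => hv0 (Subtype.ext h)
  simp only [hb]
  set r := Real.sqrt (b v v) with hr
  have hrpos : 0 < r := Real.sqrt_pos.2 hpos
  have hr2 : r * r = b v v := Real.mul_self_sqrt hpos.le
  set u := r⁻¹ • v with hu
  set w := (s / lam) • 𝓢.adMu p ξ u with hw
  have hmem : u ∈ 𝓢.gmuRes p ξ lam := Submodule.smul_mem _ _ hv
  have hu2 : 𝓢.adMu p ξ (𝓢.adMu p ξ u) = -lam ^ 2 • u := by
    rw [neg_smul]
    exact eq_neg_of_add_eq_zero_left (hres.mem_gmuRes.1 hmem)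
  have e1 : 𝓢.adMu p ξ u = (s * lam) • w := by
    rw [hw, smul_smul]
    have : s * lam * (s / lam) = 1 := by field_simp; linarith
    rw [this, one_smul]
  have e2 : 𝓢.adMu p ξ w = -(s * lam) • u := by
    rw [hw, map_smul, hu2, smul_smul]
    congr 1
    field_simp
  clear_value w
  have b00 : b u u = 1 := by
    rw [hu, map_smul, map_smul, LinearMap.smul_apply, smul_eq_mul, smul_eq_mul, ← hr2]
    field_simp
  have b01 : b u w = 0 := by
    have h1 := hskew u u
    rw [hsymm, e1, map_smul, smul_eq_mul] at h1
    have hsl : s * lam ≠ 0 := mul_ne_zero (by rcases hs with rfl | rfl <;> norm_num) hl.ne'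
    have : s * lam * b u w = 0 := by linarith
    exact (mul_eq_zero.1 this).resolve_left hsl
  have b11 : b w w = 1 := by
    have h1 := hskew u w
    rw [e1, e2, map_smul, map_smul, LinearMap.smul_apply, smul_eq_mul, smul_eq_mul, b00] at h1
    have hsl : s * lam ≠ 0 := mul_ne_zero (by rcases hs with rfl | rfl <;> norm_num) hl.ne'
    exact mul_left_cancel₀ hsl (by linarith)
  have hmem' : w ∈ 𝓢.gmuRes p ξ lam := by
    rw [hres.mem_gmuRes, e2, map_smul, e1, smul_smul, ← add_smul]
    have : -(s * lam) * (s * lam) + lam ^ 2 = 0 := by linear_combination (-lam ^ 2) * hs2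
    rw [this, zero_smul]
  have hfr : finrank ℝ (𝓢.gmuRes p ξ lam) ≤ 2 := by
    rw [hres.gmuRes_eq]
    exact finrank_ker_realQuad_le _ hl hres.mult_group
  obtain ⟨e, h0, h1⟩ := exists_basis_of_pair hfr hmem hmem' fun a c hab => by
    have h1 := congrArg (b u) hab
    have h2 := congrArg (b w) hab
    simp only [map_add, map_smul, b00, b01, b11, hsymm w u, smul_eq_mul, map_zero] at h1 h2
    constructor <;> linarith
  refine ⟨e, fun i j => ?_, by rw [h0, h1, e1], by rw [h0, h1, e2], ?_⟩
  · fin_cases i <;> fin_cases j <;> simp [h0, h1, b00, b01, b11, hsymm w u]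
  · rw [h0, hu, smul_smul, mul_inv_cancel₀ hrpos.ne', one_smul]

/-- Two adapted bases of `W_red¹` with the same sign differ by a rotation. -/
theorem IsAdapted.red_rotation (hl : 0 < lam) (hs : s = 1 ∨ s = -1) (h :
    𝓢.IsAdapted p ξ lam B s f e)
    (h' : 𝓢.IsAdapted p ξ lam B s f' e') : ∃ a b : ℝ, a ^ 2 + b ^ 2 = 1 ∧
      (f' 0 : 𝓢.RedTangent p) = a • (f 0 : 𝓢.RedTangent p) + b • (f 1 : 𝓢.RedTangent p) ∧
      (f' 1 : 𝓢.RedTangent p) = a • (f 1 : 𝓢.RedTangent p) - b • (f 0 : 𝓢.RedTangent p) := by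
  have hsl : -(s * lam) ≠ 0 := neg_ne_zero.2 (mul_ne_zero
    (by rcases hs with rfl | rfl <;> norm_num) hl.ne')
  obtain ⟨a, b, hab⟩ := basis_expansion f (f' 0).2
  have h1 : (f' 1 : 𝓢.RedTangent p) = a • (f 1 : 𝓢.RedTangent p) - b • (f 0 : 𝓢.RedTangent p) := by
    refine smul_right_injective _ hsl ?_
    change -(s * lam) • (f' 1 : 𝓢.RedTangent p) = -(s * lam) • _
    rw [← h'.red_zero, hab, map_add, map_smul, map_smul, h.red_zero, h.red_one]
    module
  refine ⟨a, b, ?_, hab, h1⟩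
  have huu (x : 𝓢.RedTangent p) : 𝓢.redForm p x x = 0 := by
    have := redForm_swap x x
    linarith
  have h2 := h'.darboux
  rw [hab, h1] at h2
  simp only [map_add, map_sub, map_smul, LinearMap.add_apply, LinearMap.smul_apply, huu, h.darboux,
    redForm_swap (f 1 : 𝓢.RedTangent p) (f 0), smul_eq_mul] at h2
  linarith

/-- Two adapted bases of `𝔤_μ¹` with the same sign differ by a rotation. -/
theorem IsAdapted.group_rotation (hl : 0 < lam) (hs : s = 1 ∨ s = -1) (h :
    𝓢.IsAdapted p ξ lam B s f e)
    (h' : 𝓢.IsAdapted p ξ lam B s f' e') : ∃ a b : ℝ, a ^ 2 + b ^ 2 = 1 ∧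
      (e' 0 : 𝓢.gmu p) = a • (e 0 : 𝓢.gmu p) + b • (e 1 : 𝓢.gmu p) ∧
      (e' 1 : 𝓢.gmu p) = a • (e 1 : 𝓢.gmu p) - b • (e 0 : 𝓢.gmu p) := by
  have hsl : s * lam ≠ 0 := mul_ne_zero (by rcases hs with rfl | rfl <;> norm_num) hl.ne'
  obtain ⟨a, b, hab⟩ := basis_expansion e (e' 0).2
  have h1 : (e' 1 : 𝓢.gmu p) = a • (e 1 : 𝓢.gmu p) - b • (e 0 : 𝓢.gmu p) := by
    refine smul_right_injective _ hsl ?_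
    change (s * lam) • (e' 1 : 𝓢.gmu p) = (s * lam) • _
    rw [← h'.group_zero, hab, map_add, map_smul, map_smul, h.group_zero, h.group_one]
    module
  refine ⟨a, b, ?_, hab, h1⟩
  have h2 := h'.orthonormal 0 0
  have h00 := h.orthonormal 0 0
  have h01 := h.orthonormal 0 1
  have h10 := h.orthonormal 1 0
  have h11 := h.orthonormal 1 1
  rw [hab] at h2
  simp only [Submodule.coe_add, Submodule.coe_smul, map_add, map_smul, LinearMap.add_apply,
    LinearMap.smul_apply, smul_eq_mul,
    h00, h01, h10, h11] at h2
  norm_num at h2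
  linarith

section Nilpotent
variable {N21 : 𝓢.RedTangent p →ₗ[ℝ] 𝓢.gmu p} {κ : ℝ}

/-- If `N²¹` is `κ` times the identity in some adapted bases, it is `κ` times a rotation in all. -/
theorem IsAdapted.exists_rotation (hl : 0 < lam) (hs : s = 1 ∨ s = -1) (h :
    𝓢.IsAdapted p ξ lam B s f e)
    (hκ : ∀ i, N21 (f i) = κ • (e i : 𝓢.gmu p)) (h' : 𝓢.IsAdapted p ξ lam B s f' e') : ∃ θ : ℝ,
      N21 (f' 0) = κ • (Real.cos θ • (e' 0 : 𝓢.gmu p) + Real.sin θ • (e' 1 : 𝓢.gmu p)) ∧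
      N21 (f' 1) = κ • (-Real.sin θ • (e' 0 : 𝓢.gmu p) + Real.cos θ • (e' 1 : 𝓢.gmu p)) := by
  obtain ⟨a, b, hab, hf0, hf1⟩ := h.red_rotation hl hs h'
  obtain ⟨c, d, hcd, he0, he1⟩ := h'.group_rotation hl hs h
  obtain ⟨θ, hc, hd⟩ := exists_cos_sin_eq (x := a * c - b * d) (y := b * c + a * d)
    (by linear_combination (c ^ 2 + d ^ 2) * hab + hcd)
  refine ⟨θ, ?_, ?_⟩
  · rw [hf0, map_add, map_smul, map_smul, hκ, hκ, hc, hd, he0, he1]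
    module
  · rw [hf1, map_sub, map_smul, map_smul, hκ, hκ, hc, hd, he0, he1]
    module

/-- Adapted bases in which `N²¹` is a nonnegative multiple of the identity: `e₁` is chosen in the
direction of `N²¹ f₁`, and then `N²¹ f₂` is determined by `N²¹ L = -ad_ξ N²¹`. -/
theorem exists_adapted (hp : 𝓢.IsRelativeEquilibrium p ξ) (hB : IsAdInvariantInner B) (hres :
    𝓢.IsResonant p ξ lam)
    (hs : s = 1 ∨ s = -1) (hdef : ∀ x : 𝓢.RedTangent p, x ≠ 0 → 0 < s * 𝓢.redForm p (𝓢.redLin p ξ x)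
      x)
    (hL : ∀ x, N21 (𝓢.redLin p ξ x) = -𝓢.adMu p ξ (N21 x)) (hr :
      LinearMap.range N21 ≤ 𝓢.gmuRes p ξ lam) :
    ∃ κ : ℝ, 0 ≤ κ ∧ ∃ f e, 𝓢.IsAdapted p ξ lam B s f e ∧ ∀ i, N21 (f i) = κ • (e i : 𝓢.gmu p) := by
  obtain ⟨f, hf, hf0, hf1⟩ := exists_red_basis hp hres hs hdef
  have hsl : -(s * lam) ≠ 0 := neg_ne_zero.2 (mul_ne_zero
    (by rcases hs with rfl | rfl <;> norm_num) hres.pos.ne')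
  have key : ∀ κ : ℝ, 0 ≤ κ → ∀ e : Basis (Fin 2) ℝ (𝓢.gmuRes p ξ lam),
      (∀ i j : Fin 2, B (e i : 𝓢.gmu p) (e j : 𝓢.gmu p) = if i = j then 1 else 0) →
      𝓢.adMu p ξ (e 0) = (s * lam) • (e 1 : 𝓢.gmu p) → 𝓢.adMu p ξ (e 1) = -(s * lam) • (e 0 :
        𝓢.gmu p) →
      N21 (f 0) = κ • (e 0 : 𝓢.gmu p) →
      ∃ κ : ℝ, 0 ≤ κ ∧ ∃ f e, 𝓢.IsAdapted p ξ lam B s f e ∧ ∀ i, N21 (f i) = κ • (e i : 𝓢.gmu p) :=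
        by
    intro κ hκ e he he0 he1 h0
    refine ⟨κ, hκ, f, e, ⟨hf, he, hf0, hf1, he0, he1⟩, fun i => ?_⟩
    have h1 : N21 (f 1) = κ • (e 1 : 𝓢.gmu p) := by
      refine smul_right_injective _ hsl ?_
      change -(s * lam) • N21 (f 1) = -(s * lam) • _
      rw [← map_smul, ← hf0, hL, h0, map_smul, he0]
      module
    fin_cases i
    · exact h0
    · exact h1
  by_cases h0 : N21 (f 0) = 0
  · obtain ⟨v, hv, hv2⟩ := exists_ne_zero_mem_ker_realQuad (𝓢.adMu p ξ) hres.mult_group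
    have hmem : v ∈ 𝓢.gmuRes p ξ lam := by rw [hres.mem_gmuRes, hv2, neg_smul, neg_add_cancel]
    obtain ⟨e, he, he0, he1, -⟩ := exists_group_basis hp hB hres hs hmem hv
    exact key 0 le_rfl e he he0 he1 (by rw [h0, zero_smul])
  · obtain ⟨e, he, he0, he1, h2⟩ := exists_group_basis hp hB hres hs (hr ⟨_, rfl⟩) h0
    exact key _ (Real.sqrt_nonneg _) e he he0 he1 h2

/-- On `𝔤_μ^{1*}` the form `N²³` is a multiple of the inner product. -/
theorem IsAdapted.exists_inertia (hp : 𝓢.IsRelativeEquilibrium p ξ) (hB : IsAdInvariantInner B)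
    (hres : 𝓢.IsResonant p ξ lam)
    (hs : s = 1 ∨ s = -1) (h : 𝓢.IsAdapted p ξ lam B s f e) {N23 : LinearMap.BilinForm ℝ
      (Dual ℝ (𝓢.gmu p))}
    (hsymm : ∀ ν ν', N23 ν ν' = N23 ν' ν)
    (hskew : ∀ ν ν', N23 ((𝓢.adMu p ξ).dualMap ν) ν' = -N23 ν ((𝓢.adMu p ξ).dualMap ν')) :
    ∃ I₁ : ℝ, ∀ f' e', 𝓢.IsAdapted p ξ lam B s f' e' → ∀ ν ∈ 𝓢.dualRes p ξ lam,
      N23 ν ν = I₁ * (ν (e' 0) ^ 2 + ν (e' 1) ^ 2) := by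
  have hsl : s * lam ≠ 0 := mul_ne_zero (by rcases hs with rfl | rfl <;> norm_num) hres.pos.ne'
  -- `ε₁, ε₂` is the dual basis of `𝔤_μ^{1*}`, on which the transpose of `ad_ξ` is a rotation
  let ε (i : Fin 2) : Dual ℝ (𝓢.gmu p) := B.restrict (𝓢.gmu p) (e i : 𝓢.gmu p)
  have hε (i : Fin 2) (η : 𝓢.gmu p) : ε i η = B (e i : 𝓢.gmu p) η := rfl
  have d0 : (𝓢.adMu p ξ).dualMap (ε 0) = -(s * lam) • ε 1 := LinearMap.ext fun η => by
    rw [LinearMap.dualMap_apply, hε, ← neg_eq_iff_eq_neg.2 (adMu_skew hp hB _ _), h.group_zero,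
      Submodule.coe_smul, map_smul,
      LinearMap.smul_apply, LinearMap.smul_apply, hε, smul_eq_mul, smul_eq_mul, neg_mul]
  have d1 : (𝓢.adMu p ξ).dualMap (ε 1) = (s * lam) • ε 0 := LinearMap.ext fun η => by
    rw [LinearMap.dualMap_apply, hε, ← neg_eq_iff_eq_neg.2 (adMu_skew hp hB _ _), h.group_one,
      Submodule.coe_smul, map_smul,
      LinearMap.smul_apply, LinearMap.smul_apply, hε, smul_eq_mul, smul_eq_mul, neg_mul, neg_neg]
  have n01 : N23 (ε 0) (ε 1) = 0 := by
    have h1 := hskew (ε 0) (ε 0)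
    rw [d0, map_smul, map_smul, LinearMap.smul_apply, smul_eq_mul, smul_eq_mul, hsymm (ε 1)] at h1
    have : s * lam * N23 (ε 0) (ε 1) = 0 := by linarith
    exact (mul_eq_zero.1 this).resolve_left hsl
  have n11 : N23 (ε 1) (ε 1) = N23 (ε 0) (ε 0) := by
    have h1 := hskew (ε 0) (ε 1)
    rw [d0, d1, map_smul, map_smul, LinearMap.smul_apply, smul_eq_mul, smul_eq_mul] at h1
    exact mul_left_cancel₀ hsl (by linarith)
  refine ⟨N23 (ε 0) (ε 0), fun f' e' h' ν hν => ?_⟩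
  have hann (ν : Dual ℝ (𝓢.gmu p)) (hν : ν ∈ 𝓢.dualRes p ξ lam) (η : 𝓢.gmu p) :
      ν (𝓢.adMu p ξ (𝓢.adMu p ξ η)) + lam ^ 2 * ν η = 0 := by
    have := (Submodule.mem_dualAnnihilator ν).1 hν _ (hres.mem_gmuNonres.2 ⟨η, rfl⟩)
    simpa using this
  -- Both sides vanish on `𝔤_μ⁰`, and they agree on `e₁` and `e₂`.
  have hexp : ν = ν (e 0) • ε 0 + ν (e 1) • ε 1 := by
    refine LinearMap.ext fun η => ?_
    obtain ⟨x, hx, y, hy, rfl⟩ := Submodule.mem_sup.1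
      (hres.isCompl_gmu.sup_eq_top ▸ Submodule.mem_top : η ∈ _)
    obtain ⟨a, b, rfl⟩ := basis_expansion e hy
    obtain ⟨ζ, rfl⟩ := hres.mem_gmuNonres.1 hx
    have hdd (i : Fin 2) : ε i (𝓢.adMu p ξ (𝓢.adMu p ξ ζ)) + lam ^ 2 * ε i ζ = 0 := by
      have hss : s * s = 1 := by rcases hs with rfl | rfl <;> norm_num
      have h2 : (𝓢.adMu p ξ).dualMap ((𝓢.adMu p ξ).dualMap (ε i)) = -lam ^ 2 • ε i := by
        fin_cases i
        · simp only [Fin.zero_eta, d0, d1, map_smul, smul_smul]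
          congr 1
          linear_combination (-lam ^ 2) * hss
        · simp only [Fin.mk_one, d0, d1, map_smul, smul_smul]
          congr 1
          linear_combination (-lam ^ 2) * hss
      have h3 := LinearMap.congr_fun h2 ζ
      rw [LinearMap.dualMap_apply, LinearMap.dualMap_apply, LinearMap.smul_apply, smul_eq_mul] at h3
      rw [h3]
      ring
    have h00 : ε 0 (e 0) = 1 := h.orthonormal 0 0
    have h01 : ε 0 (e 1) = 0 := h.orthonormal 0 1
    have h10 : ε 1 (e 0) = 0 := h.orthonormal 1 0
    have h11 : ε 1 (e 1) = 1 := h.orthonormal 1 1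
    simp only [map_add, map_smul, LinearMap.add_apply, LinearMap.smul_apply, smul_eq_mul, h00, h01,
      h10, h11, hann ν hν]
    linear_combination (-ν (e 0)) * hdd 0 - ν (e 1) * hdd 1
  obtain ⟨a, b, hab, he0, he1⟩ := h.group_rotation hres.pos hs h'
  have h1 : N23 ν ν = N23 (ε 0) (ε 0) * (ν (e 0) ^ 2 + ν (e 1) ^ 2) := by
    conv_lhs => rw [hexp]
    simp only [map_add, map_smul, LinearMap.add_apply, LinearMap.smul_apply, smul_eq_mul, n01, n11,
      hsymm (ε 1) (ε 0)]
    ring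
  rw [h1, he0, he1, map_add, map_sub, map_smul, map_smul, map_smul, map_smul]
  simp only [smul_eq_mul]
  linear_combination (-N23 (ε 0) (ε 0) * (ν (e 0) ^ 2 + ν (e 1) ^ 2)) * hab

end Nilpotent
end
end HamiltonianSystem

end RelEq

theorem mainTheorem2
    {EG : Type*} [NormedAddCommGroup EG] [NormedSpace ℝ EG] [FiniteDimensional ℝ EG]
    {G : Type*} [TopologicalSpace G] [ChartedSpace EG G] [Group G] [LieGroup 𝓘(ℝ, EG) ∞ G]
    [CompactSpace G] [T2Space G]
    {EP : Type*} [NormedAddCommGroup EP] [NormedSpace ℝ EP] [FiniteDimensional ℝ EP]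
    {P : Type*} [TopologicalSpace P] [ChartedSpace EP P] [IsManifold 𝓘(ℝ, EP) ∞ P] [T2Space P]
    [MulAction G P]
    (𝓢 : RelEq.HamiltonianSystem EG G EP P) (p : P) (ξ : GroupLieAlgebra 𝓘(ℝ, EG) G)
    (hp : 𝓢.IsRelativeEquilibrium p ξ) (hreg : 𝓢.IsRegular p) (hstab : 𝓢.IsFormallyStable p ξ)
    (lam : ℝ) (hres : 𝓢.IsResonant p ξ lam)
    (S N : Module.End ℝ (TangentSpace 𝓘(ℝ, EP) p))
    (hSN : RelEq.IsJordanDecomposition (𝓢.lin p ξ) S N) :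
    IsCompl (𝓢.redNonres p ξ lam) (𝓢.redRes p ξ lam) ∧
    IsCompl (𝓢.gmuNonres p ξ lam) (𝓢.gmuRes p ξ lam) ∧
    ∃ (N21 : 𝓢.RedTangent p →ₗ[ℝ] 𝓢.gmu p) (N13 : Dual ℝ (𝓢.gmu p) →ₗ[ℝ] 𝓢.RedTangent p),
      𝓢.IsN21 p N N21 ∧ 𝓢.IsN13 p N N13 ∧
      (∀ ν x, 𝓢.redForm p (N13 ν) x = ν (N21 x)) ∧
      -- localization of `N²¹` and `N¹³` to the resonant parts
      𝓢.redNonres p ξ lam ≤ LinearMap.ker N21 ∧ LinearMap.range N21 ≤ 𝓢.gmuRes p ξ lam ∧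
      𝓢.dualNonres p ξ lam ≤ LinearMap.ker N13 ∧ LinearMap.range N13 ≤ 𝓢.redRes p ξ lam ∧
      -- `H_nil` and its `T_ξ × S¹` symmetry, for every splitting of the tangent space
      (∀ σ : 𝓢.Splitting p S,
        DirectSum.IsInternal ![σ.W, 𝓢.gmuOrbit p, σ.Z, σ.bOrbit] ∧
        ∃ N23 : LinearMap.BilinForm ℝ (Dual ℝ (𝓢.gmu p)),
          RelEq.HamiltonianSystem.IsN23 σ N N23 ∧ (∀ ν ν', N23 ν ν' = N23 ν' ν) ∧
          (∀ (w : σ.W) (η : 𝓢.gmu p) (z : σ.Z) (β : σ.b),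
            𝓢.nilHamiltonian p N (σ.assemble w η z β) =
            𝓢.nilNormalForm p N21 N23 (σ.toRed w) (𝓢.dJmu p z)) ∧
          (∀ c : ℝ → G, RelEq.IsOneParameterSubgroup c ξ →
            ∀ t ∈ RelEq.toralClosure ξ, ∀ θ : ℝ, ∀ x ∈ 𝓢.redRes p ξ lam,
            ∀ ν₀ ∈ 𝓢.dualNonres p ξ lam, ∀ ν₁ ∈ 𝓢.dualRes p ξ lam,
            𝓢.nilNormalForm p N21 N23 (𝓢.circleRed p ξ lam (-θ) x)
              (𝓢.coAdMu p t ν₀ + 𝓢.coAdMu p (c (θ / lam)) ν₁) =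
            𝓢.nilNormalForm p N21 N23 x (ν₀ + ν₁))) ∧
      -- the two cases: `s = 1` and `s = -1`
      ∃ s : ℝ, (s = 1 ∨ s = -1) ∧
        ∀ B : LinearMap.BilinForm ℝ (GroupLieAlgebra 𝓘(ℝ, EG) G), RelEq.IsAdInvariantInner B →
          (¬ ∃ f e, 𝓢.IsAdapted p ξ lam B (-s) f e) ∧
          ∃ κ : ℝ, 0 ≤ κ ∧
            -- `N²¹¹` is `κ` times a rotation
            (∀ f e, 𝓢.IsAdapted p ξ lam B s f e → ∃ θ : ℝ,
              N21 (f 0) = κ • (Real.cos θ • (e 0 : 𝓢.gmu p) + Real.sin θ • (e 1 : 𝓢.gmu p)) ∧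
              N21 (f 1) = κ • (-Real.sin θ • (e 0 : 𝓢.gmu p) + Real.cos θ • (e 1 : 𝓢.gmu p))) ∧
            -- the rotation can be made trivial
            (∃ f e, 𝓢.IsAdapted p ξ lam B s f e ∧ ∀ i, N21 (f i) = κ • (e i : 𝓢.gmu p)) ∧
            -- the normal form of `H_nil`
            ∀ (σ : 𝓢.Splitting p S) (N23 : LinearMap.BilinForm ℝ (Dual ℝ (𝓢.gmu p))),
              RelEq.HamiltonianSystem.IsN23 σ N N23 →
              ∃ I₁ : ℝ, ∀ f e, 𝓢.IsAdapted p ξ lam B s f e →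
                (∀ i, N21 (f i) = κ • (e i : 𝓢.gmu p)) →
                ∀ (w : σ.W) (η : 𝓢.gmu p) (z : σ.Z) (β : σ.b),
                ∀ q₀ ∈ 𝓢.redNonres p ξ lam, ∀ x₁ x₂ : ℝ,
                ∀ ν₀ ∈ 𝓢.dualNonres p ξ lam, ∀ ν₁ ∈ 𝓢.dualRes p ξ lam, ∀ π₁ π₂ : ℝ,
                  σ.toRed w = q₀ + x₁ • (f 0 : 𝓢.RedTangent p) + x₂ • (f 1 : 𝓢.RedTangent p) →
                  𝓢.dJmu p z = ν₀ + ν₁ → π₁ = ν₁ (e 0) → π₂ = ν₁ (e 1) →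
                  𝓢.nilHamiltonian p N (σ.assemble w η z β) =
                  1 / 2 * N23 ν₀ ν₀ + 1 / 2 * I₁ * (π₁ ^ 2 + π₂ ^ 2) +
                    κ * (π₁ * x₁ + π₂ * x₂) := by
  obtain ⟨s, hs, hdef⟩ := hp.exists_sign hstab
  obtain ⟨N21, h21⟩ := hp.exists_isN21 hreg hstab hSN
  obtain ⟨N13, h13, hdual⟩ := hp.exists_isN13 hreg hSN h21
  have hL := hp.N21_redLin hreg hSN h21
  have hker := hres.redNonres_le_ker hp hL
  have hr := hres.range_N21_le hL hker
  refine ⟨hres.isCompl_red, hres.isCompl_gmu, N21, N13, h21, h13, hdual, hker, hr,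
    RelEq.HamiltonianSystem.dualNonres_le_ker hr hdual, hres.range_N13_le hp hker hdual, fun σ =>
      ⟨σ.isInternal, ?_⟩,
    s, hs, fun B hB => ⟨?_, ?_⟩⟩
  · obtain ⟨N23, h23⟩ := σ.exists_isN23 hp hreg hSN
    exact ⟨N23, h23, σ.isN23_symm hp hreg hSN h23, σ.nilHamiltonian_assemble hp hreg hSN h21 h23,
      fun c hc t ht θ x _ ν₀ h0 ν₁ h1 =>
        RelEq.HamiltonianSystem.nilNormalForm_invariant hp hres hL hr
        (σ.isN23_symm hp hreg hSN h23) (σ.isN23_skew hp hreg hSN h23)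
        (fun _ h0 _ h1 => σ.isN23_eq_zero hp hreg hSN hres h23 h0 h1) hc ht θ x h0 h1⟩
  · rintro ⟨f, e, h⟩
    exact RelEq.HamiltonianSystem.not_isAdapted_neg hres.pos hs hdef h
  · obtain ⟨κ, hκ0, f, e, h, hκ⟩ := RelEq.HamiltonianSystem.exists_adapted hp hB hres hs hdef hL hr
    refine ⟨κ, hκ0, fun f' e' h' => h.exists_rotation hres.pos hs hκ h', ⟨f, e, h, hκ⟩,
      fun σ N23 h23 => ?_⟩
    have hsymm := σ.isN23_symm hp hreg hSN h23
    obtain ⟨I₁, hI⟩ := h.exists_inertia hp hB hres hs hsymm (σ.isN23_skew hp hreg hSN h23)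
    refine ⟨I₁, fun f' e' h' hκ' w η z β q₀ hq₀ x₁ x₂ ν₀ h0 ν₁ h1 π₁ π₂ hw hz hπ₁ hπ₂ => ?_⟩
    have hcross := σ.isN23_eq_zero hp hreg hSN hres h23 h0 h1
    have hz0 (y : 𝓢.gmu p) (hy : y ∈ 𝓢.gmuRes p ξ lam) : ν₀ y = 0 :=
      (Submodule.mem_dualAnnihilator ν₀).1 h0 _ hy
    rw [σ.nilHamiltonian_assemble hp hreg hSN h21 h23, hw, hz,
      RelEq.HamiltonianSystem.nilNormalForm]
    simp only [map_add, map_smul, map_zero, LinearMap.add_apply, LinearMap.mem_ker.1 (hker hq₀),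
      hκ', hsymm ν₁ ν₀, hcross,
      hz0 _ (e' 0).2, hz0 _ (e' 1).2, ← hπ₁, ← hπ₂, hI f' e' h' ν₁ h1, smul_eq_mul]
    ring
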